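/- **Setting.** Let $G$ be a countable group with identity $e$, and let $\mu$ be a probability measure on $G$ whose support generates $G$ as a group. Let $\Omega=G^{\mathbb N}$, $\mathbb P=\mu^{\mathbb N}$, $X_n(\omega)=\omega_n$ ($n\ge1$), and let $\theta(\omega_1,\omega_2,\dots)=(\omega_2,\omega_3,\dots)$. Put $S_0=e$, $S_n=S_{n-1}X_n$, $R_n=\{S_0,\dots,S_n\}$, $R_\infty=\bigcup_n R_n$, $\mathcal G_n=\sigma((R_k,S_k):k\ge n)$ and $\mathcal G_\infty=\bigcap_n\mathcal G_n$. Write $H(Y)=-\sum_y\mathbb P(Y=y)\ln\mathbb P(Y=y)$ for the entropy of a discrete random element $Y$, and $H(Y\mid Z)$ for the expected entropy of the regular conditional distribution of $Y$ given $Z$ (the entropy of a non-discrete distribution being $+\infty$). Assume $0<H(X_1)<\infty$. The walk $S$ is *recurrent* if $\mathbb P(\exists n\ge1,\ S_n=e)=1$. It is a *random walk escaping to $-\infty$ without left jump* if there is $a\in G$ such that $$\operatorname{supp}(\mu)\subseteq\{a^{-1},e,a,a^2,\dots\}\quad\text{and}\quad\sum_{i\ge-1}i\,\mu(\{a^i\})<0$$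 (the series being convergent; then $G$ is isomorphic to $\mathbb Z$). **Theorem 1.2.** The limit $h_R(\mu)=\lim_{n\to\infty}H(R_n)/n$ exists, and the following four statements are equivalent: 1. $h_R(\mu)=0$; 2. $\mathbb P(\exists n\ge1,\ S_n=x)=1$ for some $x\in G$; 3. $S$ is either recurrent or a random walk escaping to $-\infty$ without left jump; 4. $H(R_\infty\circ\theta\mid R_\infty)=H(R_\infty\mid R_\infty\circ\theta)$ and $\mathcal G_\infty\equiv\sigma(R_\infty)\bmod\mathbb P$, i.e. every event of either $\sigma$-algebra differs from some event of the other by a $\mathbb P$-null set. -/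

import Mathlib

open MeasureTheory ProbabilityTheory Filter Topology
open scoped ENNReal

noncomputable section

namespace RangeEntropy

/-! ### Shannon entropy -/

open Classical in
/-- The Shannon entropy `-∑_y ν({y}) ln ν({y})` of a probability measure `ν`, with values in
`[0, ∞]`. It is the sum when `ν` is discrete (carried by a countable set), and `∞` otherwise. -/
def measureEntropy {E : Type*} [MeasurableSpace E] (ν : Measure E) : ℝ≥0∞ :=
  if ∃ C : Set E, C.Countable ∧ ν Cᶜ = 0 then
    ∑' y : E, ENNReal.ofReal (Real.negMulLog (ν.real {y}))
  else ∞

/-- The entropy `H(Y)` of a random element `Y`, i.e. the entropy of its law. -/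
def entropy {Ω E : Type*} [MeasurableSpace Ω] [MeasurableSpace E]
    (P : Measure Ω) (Y : Ω → E) : ℝ≥0∞ :=
  measureEntropy (P.map Y)

/-- The conditional entropy `H(Y | Z)`: the expectation of the entropy of the regular conditional
distribution of `Y` given `Z`. -/
def condEntropy {Ω E F : Type*} [MeasurableSpace Ω] [MeasurableSpace E] [StandardBorelSpace E]
    [Nonempty E] [MeasurableSpace F] (P : Measure Ω) [IsFiniteMeasure P]
    (Y : Ω → E) (Z : Ω → F) : ℝ≥0∞ :=
  ∫⁻ z, measureEntropy (condDistrib Y Z P z) ∂(P.map Z)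

/-- Two σ-algebras coincide mod `P`: every event of one differs from some event of the other by
a `P`-null set. -/
def EqMod {Ω : Type*} [MeasurableSpace Ω] (P : Measure Ω) (m₁ m₂ : MeasurableSpace Ω) : Prop :=
  (∀ A, MeasurableSet[m₁] A → ∃ B, MeasurableSet[m₂] B ∧ A =ᵐ[P] B) ∧
  (∀ B, MeasurableSet[m₂] B → ∃ A, MeasurableSet[m₁] A ∧ A =ᵐ[P] B)

/-- The subsets of a countable set form a standard Borel space (for the product σ-algebra of
`{0,1}^G`, generated by the events `{g ∈ A}`). -/
instance standardBorelSpace_set {G : Type*} [Countable G] : StandardBorelSpace (Set G) :=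
  inferInstanceAs (StandardBorelSpace (G → Prop))

/-! ### The random walk -/

variable {G : Type*}

/-- The time shift `θ(ω₁, ω₂, …) = (ω₂, ω₃, …)` on `G^ℕ`; the coordinate `ω n` is `ω_{n+1}`. -/
def shift (ω : ℕ → G) : ℕ → G := fun n => ω (n + 1)

/-- The step `X_{n+1}`, so that `step 0` is the first step `X₁`. -/
def step (n : ℕ) (ω : ℕ → G) : G := ω n

variable [Group G]

/-- The walk `S_0 = e`, `S_{n+1} = S_n X_{n+1}`. -/
def walk : ℕ → (ℕ → G) → G
  | 0, _ => 1
  | n + 1, ω => walk n ω * step n ω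

/-- The range `R_n = {S_0, …, S_n}`. -/
def range (n : ℕ) (ω : ℕ → G) : Set G := {g | ∃ i ≤ n, walk i ω = g}

/-- The total range `R_∞ = ⋃ n, R_n`. -/
def totalRange (ω : ℕ → G) : Set G := ⋃ n, range n ω

variable [MeasurableSpace G]

/-- The law `ℙ = μ^ℕ` of the sequence of steps. -/
def pathMeasure (μ : Measure G) [IsProbabilityMeasure μ] : Measure (ℕ → G) :=
  Measure.infinitePi (fun _ : ℕ => μ)

instance isProbabilityMeasure_pathMeasure (μ : Measure G) [IsProbabilityMeasure μ] :
    IsProbabilityMeasure (pathMeasure μ) :=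
  inferInstanceAs (IsProbabilityMeasure (Measure.infinitePi (fun _ : ℕ => μ)))

/-- `𝒢_n = σ((R_k, S_k) : k ≥ n)`. -/
@[reducible] def futureSigma (G : Type*) [Group G] [MeasurableSpace G] (n : ℕ) : MeasurableSpace (ℕ → G) :=
  ⨆ k ≥ n, MeasurableSpace.comap (fun ω : ℕ → G => (range k ω, walk k ω)) inferInstance

/-- `𝒢_∞ = ⋂ n, 𝒢_n`, the tail σ-algebra of `(R_n, S_n)`. -/
@[reducible] def tailSigma (G : Type*) [Group G] [MeasurableSpace G] : MeasurableSpace (ℕ → G) :=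
  ⨅ n, futureSigma G n

/-- `σ(R_∞)`. -/
@[reducible] def totalRangeSigma (G : Type*) [Group G] : MeasurableSpace (ℕ → G) :=
  MeasurableSpace.comap (fun ω : ℕ → G => totalRange ω) inferInstance

/-- The average entropy of the range `h_R(μ) = lim H(R_n) / n`. -/
def averageRangeEntropy (μ : Measure G) [IsProbabilityMeasure μ] : ℝ≥0∞ :=
  limUnder atTop (fun n : ℕ => entropy (pathMeasure μ) (range n) / (n : ℝ≥0∞))

/-- The element `x` is almost surely hit by the walk at some time `n ≥ 1`. -/
def HitAlmostSurely (μ : Measure G) [IsProbabilityMeasure μ] (x : G) : Prop :=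
  pathMeasure μ {ω | ∃ n ≥ 1, walk n ω = x} = 1

/-- The walk is recurrent: it almost surely returns to its starting point. -/
def Recurrent (μ : Measure G) [IsProbabilityMeasure μ] : Prop :=
  HitAlmostSurely μ 1

/-- The walk escapes to `-∞` without left jump: for some `a`, the step distribution is carried by
`{a⁻¹, e, a, a², …}` and has negative mean `∑_{i ≥ -1} i μ({a^i})`. (If `a` had finite order, the
series would diverge, so `a` identifies `G` with `ℤ` as soon as `supp μ` generates `G`.) -/
def EscapesWithoutLeftJump (μ : Measure G) : Prop :=
  ∃ a : G, (∀ g : G, μ {g} ≠ 0 → ∃ i : ℤ, -1 ≤ i ∧ g = a ^ i) ∧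
    Summable (fun i : {i : ℤ // -1 ≤ i} => ((i : ℤ) : ℝ) * μ.real {a ^ (i : ℤ)}) ∧
    ∑' i : {i : ℤ // -1 ≤ i}, ((i : ℤ) : ℝ) * μ.real {a ^ (i : ℤ)} < 0

end RangeEntropy

end

/-!
The limit exists because `H(R_n, S_n)` is subadditive in `n` (Fekete's lemma), while `S_n` adds at
most `ln (n + 1)` to the entropy of `R_n`, being one of at most `n + 1` points of it
(`RangeEntropy.exists_tendsto_entropy`). The equivalence is the cycle `1 → 2 → 3 → 4 → 1`.

`1 → 2`. Let `g ≠ 1` be a possible step and `F < 1` the probability that `g` is ever hit. For a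
finite set `A` not containing `g`, splitting according to the first step shows that the entropy of
`A ∪ R_m` exceeds the mean entropy of what remains after that step by at least `μ{g} (-ln F)`:
stepping by `g` makes the range contain `g`, which otherwise has probability at most `F`. Iterating,
`H(R_m)` is at least `μ{g} (-ln F)` times the expected number of times `k < m` at which `S_k g` is
a fresh point. A comparison of Green functions, by decomposition at the last exit from the origin,
bounds the probability of that being fresh from below, uniformly in `k`
(`RangeEntropy.measure_mem_past_le`). So `H(R_m)` grows linearly when no point is hit almost surely
(`RangeEntropy.exists_hitAlmostSurely_of_tendsto_zero`).

`2 → 3`. The points that `R_∞` contains almost surely form a submonoid `K`. For a transient walk,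
`K` consists of the powers of the element of `K \ {1}` that may be visited first; call it `a⁻¹`. As
after any possible step `g` the walk still has to visit `a⁻¹`, the steps are in `{a⁻¹, 1, a, …}`.
The law of large numbers then excludes a positive mean, and a zero mean would give recurrence
(`RangeEntropy.recurrent_or_escapes_of_hitAlmostSurely`).

`3 → 4`. Now `R_∞ \ K` is almost surely finite (`RangeEntropy.ae_finite_diff_surelyVisited`), so
`R_∞` has a discrete law and any event on which its value is fixed can be treated separately. There
a tail event is insensitive to the exchange of two initial pieces of the path: for a recurrent walk
the pieces are loops, otherwise the group is commutative. A zero-one law of Hewitt–Savage type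
(`RangeEntropy.measure_eq_zero_or_one_of_exchange`) gives
`RangeEntropy.eqMod_tailSigma_totalRangeSigma`. The two conditional entropies agree because the
difference of the pointwise surprisals is the coboundary of the surprisal of `R_∞`, which integrates
to zero although its terms may fail to be integrable (`RangeEntropy.condEntropy_symm_of_map_eq`).

`4 → 1`. Let `V` be the first step `X₁` together with the mark telling whether the walk ever returns
to its start, and `V_n` the same for the walk up to time `n`. Given `R_{n+1}` and `S_{n+1}`, the pair
`V_n` is what is needed to recover the range and position seen from the first step, so
`H(R_{n+1}, S_{n+1}) - H(R_n, S_n) ≤ H(X₁) - H(V_n | R_{n+1}, S_{n+1})`. By Lévy's downward theorem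
and Fatou's lemma the last term is asymptotically at least `H(V | R_∞)`, provided that `R_∞`
generates the tail (`RangeEntropy.condEntropy_returnMark_le_liminf`). The equality of the
conditional entropies means that `H(V | R_∞) = H(X₁)`, so the increments have non-positive
limit superior (`RangeEntropy.entropy_rate_nonpos`).
-/

namespace RangeEntropy

/-! ### Surprisal and the entropy of a measure -/

/-- The surprisal `-ln p` of a probability `p`, with the value `∞` at `p = 0`. It is meant for
`p ≤ 1` only. -/
noncomputable def surprisal (p : ℝ≥0∞) : ℝ≥0∞ :=
  if p = 0 then ∞ else ENNReal.ofReal (-Real.log p.toReal)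

lemma surprisal_zero : surprisal 0 = ∞ := if_pos rfl

lemma surprisal_one : surprisal 1 = 0 := by simp [surprisal]

lemma surprisal_ne_top {p : ℝ≥0∞} (hp : p ≠ 0) : surprisal p ≠ ∞ := by
  simp [surprisal, hp]

lemma measurable_surprisal : Measurable surprisal := by
  unfold surprisal
  exact Measurable.ite (measurableSet_singleton 0) measurable_const (by fun_prop)

lemma surprisal_anti {p q : ℝ≥0∞} (hpq : p ≤ q) (hq : q ≤ 1) : surprisal q ≤ surprisal p := by
  unfold surprisal
  rcases eq_or_ne p 0 with h | h
  · simp [h]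
  have hq0 : q ≠ 0 := fun h' => h (by simpa [h'] using hpq)
  have hqt : q ≠ ∞ := ne_top_of_le_ne_top ENNReal.one_ne_top hq
  rw [if_neg h, if_neg hq0]
  refine ENNReal.ofReal_le_ofReal (neg_le_neg (Real.log_le_log ?_ ?_))
  · exact ENNReal.toReal_pos h (ne_top_of_le_ne_top hqt hpq)
  · exact ENNReal.toReal_mono hqt hpq

lemma surprisal_pos {p : ℝ≥0∞} (hp : p < 1) : 0 < surprisal p := by
  unfold surprisal
  split_ifs with h
  · simp
  · rw [ENNReal.ofReal_pos, neg_pos]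
    have hpt : p ≠ ∞ := ne_top_of_lt hp
    refine Real.log_neg (ENNReal.toReal_pos h hpt) ?_
    rw [← ENNReal.toReal_one]
    exact (ENNReal.toReal_lt_toReal hpt ENNReal.one_ne_top).2 hp

lemma surprisal_mul {p q : ℝ≥0∞} (hp : p ≤ 1) (hq : q ≤ 1) :
    surprisal (p * q) = surprisal p + surprisal q := by
  rcases eq_or_ne p 0 with h | h
  · simp [h, surprisal_zero]
  rcases eq_or_ne q 0 with h' | h'
  · simp [h', surprisal_zero]
  have hpt : p ≠ ∞ := ne_top_of_le_ne_top ENNReal.one_ne_top hp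
  have hqt : q ≠ ∞ := ne_top_of_le_ne_top ENNReal.one_ne_top hq
  have hp1 : p.toReal ≤ 1 := by simpa using ENNReal.toReal_mono ENNReal.one_ne_top hp
  have hq1 : q.toReal ≤ 1 := by simpa using ENNReal.toReal_mono ENNReal.one_ne_top hq
  have hp0 := ENNReal.toReal_pos h hpt
  have hq0 := ENNReal.toReal_pos h' hqt
  rw [surprisal, surprisal, surprisal, if_neg h, if_neg h', if_neg (mul_ne_zero h h'),
    ← ENNReal.ofReal_add (by simpa using Real.log_nonpos hp0.le hp1)
      (by simpa using Real.log_nonpos hq0.le hq1), ENNReal.toReal_mul,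
    Real.log_mul hp0.ne' hq0.ne']
  congr 1
  ring

lemma surprisal_mul_self {p : ℝ≥0∞} (hp : p ≤ 1) :
    surprisal p * p = ENNReal.ofReal (Real.negMulLog p.toReal) := by
  rcases eq_or_ne p 0 with h | h
  · simp [h]
  have hpt : p ≠ ∞ := ne_top_of_le_ne_top ENNReal.one_ne_top hp
  have hp1 : p.toReal ≤ 1 := by simpa using ENNReal.toReal_mono ENNReal.one_ne_top hp
  rw [surprisal, if_neg h]
  conv_lhs => rw [← ENNReal.ofReal_toReal hpt]
  rw [← ENNReal.ofReal_mul, ENNReal.toReal_ofReal ENNReal.toReal_nonneg, Real.negMulLog]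
  · congr 1; ring
  · simpa using Real.log_nonpos ENNReal.toReal_nonneg (by simpa using hp1)

/-- The pointwise form of Gibbs' inequality, `p ln (q / p) ≤ q - p`. -/
lemma surprisal_mul_add_le {p q : ℝ≥0∞} (hp : p ≤ 1) (hq : q ≤ 1) :
    surprisal p * p + p ≤ surprisal q * p + q := by
  rcases eq_or_ne p 0 with h | h
  · simp [h]
  rcases eq_or_ne q 0 with h' | h'
  · simp [h', surprisal_zero, h]
  have hpt : p ≠ ∞ := ne_top_of_le_ne_top ENNReal.one_ne_top hp
  have hqt : q ≠ ∞ := ne_top_of_le_ne_top ENNReal.one_ne_top hq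
  have hp1 : p.toReal ≤ 1 := by simpa using ENNReal.toReal_mono ENNReal.one_ne_top hp
  have hq1 : q.toReal ≤ 1 := by simpa using ENNReal.toReal_mono ENNReal.one_ne_top hq
  have hp0 := ENNReal.toReal_pos h hpt
  have hq0 := ENNReal.toReal_pos h' hqt
  have hlp : 0 ≤ -Real.log p.toReal := by simpa using Real.log_nonpos hp0.le hp1
  have hlq : 0 ≤ -Real.log q.toReal := by simpa using Real.log_nonpos hq0.le hq1
  rw [surprisal, surprisal, if_neg h, if_neg h']
  nth_rewrite 2 3 4 [← ENNReal.ofReal_toReal hpt]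
  nth_rewrite 2 [← ENNReal.ofReal_toReal hqt]
  rw [← ENNReal.ofReal_mul hlp, ← ENNReal.ofReal_mul hlq, ← ENNReal.ofReal_add (by positivity)
    hp0.le, ← ENNReal.ofReal_add (by positivity) hq0.le]
  refine ENNReal.ofReal_le_ofReal ?_
  have key := Real.log_le_sub_one_of_pos (div_pos hq0 hp0)
  rw [Real.log_div hq0.ne' hp0.ne'] at key
  have := mul_le_mul_of_nonneg_right key hp0.le
  have e : (q.toReal / p.toReal - 1) * p.toReal = q.toReal - p.toReal := by
    field_simp
  nlinarith

/-- A measure is discrete when it is carried by a countable set. -/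
def IsDiscrete {E : Type*} [MeasurableSpace E] (ν : Measure E) : Prop :=
  ∃ C : Set E, C.Countable ∧ ν Cᶜ = 0

lemma isDiscrete_of_countable {E : Type*} [MeasurableSpace E] [Countable E] (ν : Measure E) :
    IsDiscrete ν := ⟨Set.univ, Set.countable_univ, by simp⟩

lemma IsDiscrete.ae_ne_zero {E : Type*} [MeasurableSpace E] {ν : Measure E} (h : IsDiscrete ν) :
    ∀ᵐ y ∂ν, ν {y} ≠ 0 := by
  obtain ⟨C, hC, hC0⟩ := h
  have h0 : ν (C ∩ {y | ν {y} = 0}) = 0 := by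
    rw [measure_null_iff_singleton (hC.mono Set.inter_subset_left)]
    exact fun y hy => hy.2
  have h1 : ∀ᵐ y ∂ν, y ∈ C := hC0
  have h2 : ∀ᵐ y ∂ν, y ∉ C ∩ {y | ν {y} = 0} := measure_eq_zero_iff_ae_notMem.1 h0
  filter_upwards [h1, h2] with y hy hy' h3 using hy' ⟨hy, h3⟩

section MeasureEntropy

variable {E : Type*} [MeasurableSpace E] [MeasurableSingletonClass E]

lemma countable_atoms (ν : Measure E) [IsFiniteMeasure ν] : {y | ν {y} ≠ 0}.Countable := by
  simpa [pos_iff_ne_zero] using Measure.countable_meas_pos_of_disjoint_iUnion (μ := ν)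
    (As := fun y : E => {y}) (fun y => measurableSet_singleton y)
    (fun a b hab => by simpa [Function.onFun] using hab)

/-- An integral against a discrete measure is a sum over its atoms; no measurability is needed. -/
lemma IsDiscrete.lintegral_eq {ν : Measure E} [IsFiniteMeasure ν] (h : IsDiscrete ν)
    (f : E → ℝ≥0∞) : ∫⁻ y, f y ∂ν = ∑' y, f y * ν {y} := by
  have h1 : ∀ᵐ y ∂ν, y ∈ {y | ν {y} ≠ 0} := h.ae_ne_zero
  rw [← Measure.restrict_eq_self_of_ae_mem h1, lintegral_countable _ (countable_atoms ν),
    Measure.restrict_eq_self_of_ae_mem h1]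
  refine tsum_subtype_eq_of_support_subset (f := fun y => f y * ν {y}) fun y hy => ?_
  exact right_ne_zero_of_mul hy

/-- The entropy is the mean surprisal, for discrete and for non-discrete measures alike. -/
lemma measureEntropy_eq_lintegral (ν : Measure E) [IsProbabilityMeasure ν] :
    measureEntropy ν = ∫⁻ y, surprisal (ν {y}) ∂ν := by
  unfold measureEntropy
  split_ifs with h
  · rw [IsDiscrete.lintegral_eq h]
    exact tsum_congr fun y => (surprisal_mul_self prob_le_one).symm
  · set C := {y | ν {y} ≠ 0} with hCdef
    have hC : C.Countable := countable_atoms ν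
    have h0 : ν Cᶜ ≠ 0 := fun h0 => h ⟨C, hC, h0⟩
    symm
    rw [eq_top_iff]
    calc ∞ = ∫⁻ _ in Cᶜ, ∞ ∂ν := by rw [setLIntegral_const, ENNReal.top_mul h0]
      _ = ∫⁻ y in Cᶜ, surprisal (ν {y}) ∂ν := by
        refine setLIntegral_congr_fun hC.measurableSet.compl fun y hy => ?_
        have : ν {y} = 0 := by simpa [hCdef] using hy
        simp [this, surprisal_zero]
      _ ≤ _ := setLIntegral_le_lintegral _ _

/-- **Gibbs' inequality**: the entropy is at most the mean surprisal for any subprobability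
weights. -/
lemma measureEntropy_le_lintegral_surprisal {ν : Measure E} [IsProbabilityMeasure ν]
    (h : IsDiscrete ν) {q : E → ℝ≥0∞} (hq : ∑' y, q y ≤ 1) :
    measureEntropy ν ≤ ∫⁻ y, surprisal (q y) ∂ν := by
  have hν : ∑' y, ν {y} = 1 := by
    have := h.lintegral_eq (fun _ => 1)
    simpa using this.symm
  rw [measureEntropy_eq_lintegral, h.lintegral_eq, h.lintegral_eq]
  have key : ∑' y, surprisal (ν {y}) * ν {y} + 1 ≤ ∑' y, surprisal (q y) * ν {y} + 1 := by
    calc ∑' y, surprisal (ν {y}) * ν {y} + 1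
        = ∑' y, (surprisal (ν {y}) * ν {y} + ν {y}) := by rw [ENNReal.tsum_add, hν]
      _ ≤ ∑' y, (surprisal (q y) * ν {y} + q y) := ENNReal.tsum_le_tsum fun y =>
          surprisal_mul_add_le prob_le_one ((ENNReal.le_tsum y).trans hq)
      _ ≤ ∑' y, surprisal (q y) * ν {y} + 1 := by rw [ENNReal.tsum_add]; gcongr
  exact (ENNReal.add_le_add_iff_right ENNReal.one_ne_top).1 key

end MeasureEntropy

lemma measurable_measure_singleton {E F : Type*} [MeasurableSpace E] [MeasurableSpace F]
    [MeasurableEq F] (κ : Kernel E F) [IsSFiniteKernel κ] :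
    Measurable fun p : E × F => κ p.1 {p.2} := by
  have h := Kernel.measurable_kernel_prodMk_left (κ := κ.prodMkRight F)
    (t := {t : (E × F) × F | t.1.2 = t.2}) (measurableSet_eq_fun (by fun_prop) (by fun_prop))
  convert h using 2 with p
  rw [Kernel.prodMkRight_apply]
  congr 1
  ext y
  simp [eq_comm]

lemma measurable_measure_singleton' {E : Type*} [MeasurableSpace E]
    [MeasurableEq E] (ν : Measure E) [SFinite ν] : Measurable fun y : E => ν {y} := by
  have h := measurable_measure_prodMk_left (ν := ν) (s := Set.diagonal E) measurableSet_diagonal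
  convert h using 3 with y
  ext z
  simp [eq_comm]

lemma compProd_singleton {E F : Type*} [MeasurableSpace E] [MeasurableSpace F]
    [MeasurableSingletonClass E] [MeasurableSingletonClass F] (ν : Measure E) [SFinite ν]
    (κ : Kernel E F) [IsSFiniteKernel κ] (p : E × F) :
    (ν ⊗ₘ κ) {p} = ν {p.1} * κ p.1 {p.2} := by
  rw [← Set.singleton_prod_singleton, Measure.compProd_apply_prod (measurableSet_singleton _)
    (measurableSet_singleton _), lintegral_singleton, mul_comm]

section ChainRule

variable {E F : Type*} [MeasurableSpace E] [MeasurableSpace F] [StandardBorelSpace E]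
  [StandardBorelSpace F]

/-- The chain rule `H(Y, W) = H(Y) + H(W | Y)` in terms of the law of `Y` and a conditional law. -/
lemma measureEntropy_compProd (ν : Measure E) [IsProbabilityMeasure ν] (κ : Kernel E F)
    [IsMarkovKernel κ] :
    measureEntropy (ν ⊗ₘ κ) = measureEntropy ν + ∫⁻ y, measureEntropy (κ y) ∂ν := by
  have hm := measurable_measure_singleton κ
  have hm' := measurable_measure_singleton' ν
  rw [measureEntropy_eq_lintegral, measureEntropy_eq_lintegral, Measure.lintegral_compProd
    (f := fun y => surprisal ((ν ⊗ₘ κ) {y}))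
    (measurable_surprisal.comp (measurable_measure_singleton' _)),
    ← lintegral_add_left (f := fun y => surprisal (ν {y})) (measurable_surprisal.comp hm')]
  refine lintegral_congr fun y => ?_
  rw [measureEntropy_eq_lintegral]
  simp_rw [compProd_singleton, surprisal_mul (prob_le_one (μ := ν)) (prob_le_one (μ := κ y))]
  rw [lintegral_add_left measurable_const]
  simp

end ChainRule

/-! ### Entropy and conditional entropy of random elements -/

lemma measurable_surprisal_singleton {E : Type*} [MeasurableSpace E] [MeasurableEq E]
    (ν : Measure E) [SFinite ν] : Measurable fun y : E => surprisal (ν {y}) :=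
  measurable_surprisal.comp (measurable_measure_singleton' ν)

lemma measureEntropy_map_of_injective {E F : Type*} [MeasurableSpace E] [MeasurableSpace F]
    [MeasurableEq F] [MeasurableSingletonClass E] [MeasurableSingletonClass F]
    (ν : Measure E) [IsProbabilityMeasure ν] {f : E → F} (hf : Measurable f)
    (hinj : Function.Injective f) : measureEntropy (ν.map f) = measureEntropy ν := by
  have := Measure.isProbabilityMeasure_map (μ := ν) hf.aemeasurable
  rw [measureEntropy_eq_lintegral, measureEntropy_eq_lintegral, lintegral_map
    (measurable_surprisal_singleton _) hf]
  refine lintegral_congr fun y => ?_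
  rw [Measure.map_apply hf (measurableSet_singleton _)]
  congr 2
  ext z
  simp [hinj.eq_iff]

lemma measureEntropy_dirac {E : Type*} [MeasurableSpace E] [MeasurableSingletonClass E] (x : E) :
    measureEntropy (Measure.dirac x) = 0 := by
  rw [measureEntropy_eq_lintegral, lintegral_dirac]
  simp [surprisal_one]

section RandomElements

variable {Ω E F D : Type*} [MeasurableSpace Ω] [MeasurableSpace E] [MeasurableSpace F]
  [MeasurableSpace D] [StandardBorelSpace E] [StandardBorelSpace F]
  {P : Measure Ω} [IsProbabilityMeasure P] {Y : Ω → E} {W : Ω → F} {Z : Ω → D}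

lemma entropy_eq_lintegral (hY : Measurable Y) :
    entropy P Y = ∫⁻ ω, surprisal (P.map Y {Y ω}) ∂P := by
  have := Measure.isProbabilityMeasure_map (μ := P) hY.aemeasurable
  rw [entropy, measureEntropy_eq_lintegral, lintegral_map
    (measurable_surprisal_singleton _) hY]

lemma entropy_le_of_determined (hY : Measurable Y) (hW : Measurable W)
    (h : ∀ ω ω', Y ω = Y ω' → W ω = W ω') : entropy P W ≤ entropy P Y := by
  rw [entropy_eq_lintegral hY, entropy_eq_lintegral hW]
  have := Measure.isProbabilityMeasure_map (μ := P) hW.aemeasurable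
  refine lintegral_mono fun ω => surprisal_anti ?_ prob_le_one
  rw [Measure.map_apply hY (measurableSet_singleton _),
    Measure.map_apply hW (measurableSet_singleton _)]
  exact measure_mono fun ω' h' => h _ _ h'

lemma entropy_prod_of_indepFun (hY : Measurable Y) (hW : Measurable W) (h : IndepFun Y W P) :
    entropy P (fun ω => (Y ω, W ω)) = entropy P Y + entropy P W := by
  have := Measure.isProbabilityMeasure_map (μ := P) hY.aemeasurable
  have := Measure.isProbabilityMeasure_map (μ := P) hW.aemeasurable
  rw [entropy, (indepFun_iff_map_prod_eq_prod_map_map hY.aemeasurable hW.aemeasurable).1 h,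
    ← Measure.compProd_const, measureEntropy_compProd]
  simp [entropy]

/-- The chain rule `H(Y, W) = H(Y) + H(W | Y)`. -/
lemma entropy_prod_eq_add_condEntropy [Nonempty F] (hY : Measurable Y) (hW : Measurable W) :
    entropy P (fun ω => (Y ω, W ω)) = entropy P Y + condEntropy P W Y := by
  have := Measure.isProbabilityMeasure_map (μ := P) hY.aemeasurable
  rw [entropy, ← compProd_map_condDistrib hW.aemeasurable, measureEntropy_compProd]
  rfl

lemma condEntropy_congr_kernel [Nonempty E] (hY : Measurable Y) {κ : Kernel D E}
    [IsMarkovKernel κ] (h : P.map (fun ω => (Z ω, Y ω)) = P.map Z ⊗ₘ κ) :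
    condEntropy P Y Z = ∫⁻ z, measureEntropy (κ z) ∂(P.map Z) := by
  refine lintegral_congr_ae ?_
  filter_upwards [condDistrib_ae_eq_of_measure_eq_compProd Z hY.aemeasurable h] with z hz
  rw [hz]

lemma measurable_measureEntropy_kernel (κ : Kernel D E) [IsMarkovKernel κ] :
    Measurable fun z => measureEntropy (κ z) := by
  simp_rw [measureEntropy_eq_lintegral]
  exact Measurable.lintegral_kernel_prod_right'
    (f := fun p : D × E => surprisal (κ p.1 {p.2}))
    (measurable_surprisal.comp (measurable_measure_singleton κ))

/-- The conditional chain rule `H(Y, W | Z) = H(Y | Z) + H(W | Z, Y)`. -/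
lemma condEntropy_prod [Nonempty E] [Nonempty F] (hY : Measurable Y) (hW : Measurable W)
    (hZ : Measurable Z) :
    condEntropy P (fun ω => (Y ω, W ω)) Z =
      condEntropy P Y Z + condEntropy P W (fun ω => (Z ω, Y ω)) := by
  have := Measure.isProbabilityMeasure_map (μ := P) hZ.aemeasurable
  set κ := condDistrib Y Z P
  set η := condDistrib W (fun ω => (Z ω, Y ω)) P
  have hκ : P.map Z ⊗ₘ κ = P.map (fun ω => (Z ω, Y ω)) :=
    compProd_map_condDistrib hY.aemeasurable
  have hη := compProd_map_condDistrib (μ := P) (X := fun ω => (Z ω, Y ω))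
    (mβ := inferInstance) hW.aemeasurable
  have h : P.map (fun ω => (Z ω, (Y ω, W ω))) = P.map Z ⊗ₘ (κ ⊗ₖ η) := by
    have h1 := Measure.compProd_assoc (μ := P.map Z) (κ := κ) (η := η)
    rw [hκ, hη] at h1
    have h2 := congrArg (Measure.map MeasurableEquiv.prodAssoc) h1
    rw [Measure.map_map (by fun_prop) (by fun_prop), Measure.map_map (by fun_prop)
      (by fun_prop)] at h2
    simp only [MeasurableEquiv.self_comp_symm, Measure.map_id] at h2
    rw [h2]
    rfl
  rw [condEntropy_congr_kernel (hY.prodMk hW) h]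
  simp_rw [Kernel.compProd_apply_eq_compProd_sectR, measureEntropy_compProd]
  rw [lintegral_add_left (measurable_measureEntropy_kernel κ)]
  congr 1
  rw [condEntropy, ← hκ, Measure.lintegral_compProd (measurable_measureEntropy_kernel η)]
  simp [Kernel.sectR_apply]

lemma condEntropy_of_indepFun [Nonempty E] (hY : Measurable Y) (hZ : Measurable Z)
    (h : IndepFun Z Y P) : condEntropy P Y Z = entropy P Y := by
  have := Measure.isProbabilityMeasure_map (μ := P) hZ.aemeasurable
  have := Measure.isProbabilityMeasure_map (μ := P) hY.aemeasurable
  have h' : P.map (fun ω => (Z ω, Y ω)) = P.map Z ⊗ₘ Kernel.const D (P.map Y) := by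
    rw [(indepFun_iff_map_prod_eq_prod_map_map hZ.aemeasurable hY.aemeasurable).1 h,
      Measure.compProd_const]
  rw [condEntropy_congr_kernel hY h']
  simp [entropy]

lemma condEntropy_comp_self [Nonempty E] (hZ : Measurable Z) {f : D → E} (hf : Measurable f) :
    condEntropy P (fun ω => f (Z ω)) Z = 0 := by
  rw [condEntropy_congr_kernel (Y := fun ω => f (Z ω)) (κ := Kernel.deterministic f hf)
    (hf.comp hZ)]
  · simp [Kernel.deterministic_apply, measureEntropy_dirac]
  · rw [Measure.compProd_deterministic, Measure.map_map (by fun_prop) hZ]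
    rfl

lemma condEntropy_comp_of_injective [Nonempty E] [Nonempty F] (hY : Measurable Y)
    {f : E → F} (hf : Measurable f) (hinj : Function.Injective f) :
    condEntropy P (fun ω => f (Y ω)) Z = condEntropy P Y Z := by
  refine lintegral_congr_ae ?_
  filter_upwards [condDistrib_comp Z hY.aemeasurable hf] with z hz
  have hz : condDistrib (fun ω => f (Y ω)) Z P z = _ := hz
  rw [hz, Kernel.map_apply _ hf, measureEntropy_map_of_injective _ hf hinj]

lemma condEntropy_swap_right {D' : Type*} [MeasurableSpace D'] {Z' : Ω → D'} [Nonempty E]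
    (hY : Measurable Y) (hZ : Measurable Z) (hZ' : Measurable Z') :
    condEntropy P Y (fun ω => (Z ω, Z' ω)) = condEntropy P Y (fun ω => (Z' ω, Z ω)) := by
  set κ := condDistrib Y (fun ω => (Z' ω, Z ω)) P
  have hκ : P.map (fun ω => (Z' ω, Z ω)) ⊗ₘ κ = _ := compProd_map_condDistrib hY.aemeasurable
  have hsw : P.map (fun ω => (Z ω, Z' ω)) = (P.map (fun ω => (Z' ω, Z ω))).map Prod.swap := by
    rw [Measure.map_map measurable_swap (by fun_prop)]
    rfl
  have h : P.map (fun ω => ((Z ω, Z' ω), Y ω)) =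
      P.map (fun ω => (Z ω, Z' ω)) ⊗ₘ κ.comap Prod.swap measurable_swap := by
    have : P.map (fun ω => ((Z ω, Z' ω), Y ω)) =
        (P.map (fun ω => ((Z' ω, Z ω), Y ω))).map (Prod.map Prod.swap id) := by
      rw [Measure.map_map (by fun_prop) (by fun_prop)]
      rfl
    rw [this, ← hκ]
    have := Measure.isProbabilityMeasure_map (μ := P) (hZ.prodMk hZ').aemeasurable
    have := Measure.isProbabilityMeasure_map (μ := P) (hZ'.prodMk hZ).aemeasurable
    ext s hs
    rw [Measure.map_apply (by fun_prop) hs, Measure.compProd_apply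
      ((by fun_prop : Measurable (Prod.map (Prod.swap (α := D') (β := D)) (id (α := E)))) hs),
      Measure.compProd_apply hs, hsw, lintegral_map
        (Kernel.measurable_kernel_prodMk_left hs) measurable_swap]
    simp only [Kernel.comap_apply, Prod.swap_swap]
    rfl
  rw [condEntropy_congr_kernel hY h, hsw, lintegral_map
    (measurable_measureEntropy_kernel _) measurable_swap]
  simp [Kernel.comap_apply, condEntropy, κ]

/-- Conditionally on `Z`, two random elements that determine each other have the same entropy. -/
lemma condEntropy_eq_of_determined [Nonempty E] [Nonempty F] (hY : Measurable Y)
    (hW : Measurable W) (hZ : Measurable Z) {f : D × E → F} {g : D × F → E} (hf : Measurable f)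
    (hg : Measurable g) (hfW : ∀ ω, W ω = f (Z ω, Y ω)) (hgY : ∀ ω, Y ω = g (Z ω, W ω)) :
    condEntropy P Y Z = condEntropy P W Z := by
  have h1 := condEntropy_prod (P := P) hY hW hZ
  have h2 := condEntropy_prod (P := P) hW hY hZ
  have h3 : condEntropy P W (fun ω => (Z ω, Y ω)) = 0 := by
    rw [funext hfW]; exact condEntropy_comp_self (hZ.prodMk hY) hf
  have h4 : condEntropy P Y (fun ω => (Z ω, W ω)) = 0 := by
    rw [funext hgY]; exact condEntropy_comp_self (hZ.prodMk hW) hg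
  have h5 : condEntropy P (fun ω => (W ω, Y ω)) Z = condEntropy P (fun ω => (Y ω, W ω)) Z :=
    condEntropy_comp_of_injective (hY.prodMk hW) measurable_swap Prod.swap_injective
  rw [h3, add_zero] at h1
  rw [h4, add_zero] at h2
  rw [← h1, ← h2, h5]

lemma condEntropy_eq_lintegral [Nonempty E] (hY : Measurable Y) (hZ : Measurable Z) :
    condEntropy P Y Z = ∫⁻ ω, surprisal (condDistrib Y Z P (Z ω) {Y ω}) ∂P := by
  have := Measure.isProbabilityMeasure_map (μ := P) hZ.aemeasurable
  have hm : Measurable fun p : D × E => surprisal (condDistrib Y Z P p.1 {p.2}) :=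
    measurable_surprisal.comp (measurable_measure_singleton _)
  simp_rw [condEntropy, measureEntropy_eq_lintegral]
  rw [← Measure.lintegral_compProd (f := fun p : D × E => surprisal (condDistrib Y Z P p.1 {p.2}))
    hm, compProd_map_condDistrib hY.aemeasurable, lintegral_map hm (hZ.prodMk hY)]

end RandomElements

/-! ### Stationarity and conditional entropy -/

/-- For a measure-preserving `θ` the positive and negative parts of the coboundary `f ∘ θ - f` have
the same integral, whether or not `f` is integrable. -/
lemma lintegral_coboundary_le {Ω : Type*} [MeasurableSpace Ω] {P : Measure Ω}
    [IsProbabilityMeasure P] {f f' : Ω → ℝ≥0∞} (hf : Measurable f) (hf' : Measurable f')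
    (hfin : ∀ᵐ ω ∂P, f' ω ≠ ∞) (hlaw : P.map f = P.map f') :
    ∫⁻ ω, (f' ω - f ω) ∂P ≤ ∫⁻ ω, (f ω - f' ω) ∂P := by
  -- truncation at level `k` makes both sides finite, where the identity is clear
  have htr : ∀ k : ℕ, ∫⁻ ω, (min (f' ω) k - min (f ω) k) ∂P ≤ ∫⁻ ω, (f ω - f' ω) ∂P := by
    intro k
    have hmin : Measurable fun x : ℝ≥0∞ => min x k := by fun_prop
    have heq : ∫⁻ ω, min (f ω) k ∂P = ∫⁻ ω, min (f' ω) k ∂P := by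
      rw [← lintegral_map hmin hf, ← lintegral_map hmin hf', hlaw]
    have hlt : ∫⁻ ω, min (f ω) k ∂P ≠ ∞ := by
      refine ne_top_of_le_ne_top (ENNReal.natCast_ne_top k) ?_
      calc ∫⁻ ω, min (f ω) k ∂P ≤ ∫⁻ _, (k : ℝ≥0∞) ∂P := lintegral_mono fun ω => min_le_right _ _
        _ = k := by simp
    have hsum : ∫⁻ ω, min (f ω) k ∂P + ∫⁻ ω, (min (f' ω) k - min (f ω) k) ∂P =
        ∫⁻ ω, min (f' ω) k ∂P + ∫⁻ ω, (min (f ω) k - min (f' ω) k) ∂P := by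
      rw [← lintegral_add_left (by fun_prop), ← lintegral_add_left (by fun_prop)]
      refine lintegral_congr fun ω => ?_
      rcases le_total (min (f ω) k) (min (f' ω) (k : ℝ≥0∞)) with h | h
      · rw [add_tsub_cancel_of_le h, tsub_eq_zero_of_le h, add_zero]
      · rw [add_tsub_cancel_of_le h, tsub_eq_zero_of_le h, add_zero]
    rw [← heq] at hsum
    rw [(ENNReal.add_right_inj hlt).1 hsum]
    refine lintegral_mono fun ω => ?_
    simp only
    rw [tsub_le_iff_right]
    rcases le_total (f' ω) (k : ℝ≥0∞) with h | h
    · rw [min_eq_left h]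
      exact (min_le_left _ _).trans le_tsub_add
    · rw [min_eq_right h]
      exact (min_le_right _ _).trans le_add_self
  have hlim : ∀ᵐ ω ∂P, f' ω - f ω ≤ liminf (fun k : ℕ => min (f' ω) k - min (f ω) k) atTop := by
    filter_upwards [hfin] with ω hω
    obtain ⟨n, hn⟩ := ENNReal.exists_nat_gt hω
    refine le_liminf_of_le (by isBoundedDefault) ?_
    filter_upwards [eventually_ge_atTop n] with k hk
    have : f' ω ≤ k := hn.le.trans (by exact_mod_cast hk)
    rw [min_eq_left this]
    exact tsub_le_tsub_left (min_le_left _ _) _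
  calc ∫⁻ ω, (f' ω - f ω) ∂P
      ≤ ∫⁻ ω, liminf (fun k : ℕ => min (f' ω) k - min (f ω) k) atTop ∂P := lintegral_mono_ae hlim
    _ ≤ liminf (fun k : ℕ => ∫⁻ ω, (min (f' ω) k - min (f ω) k) ∂P) atTop :=
      lintegral_liminf_le fun k => by fun_prop
    _ ≤ _ := by
      refine liminf_le_of_le (by isBoundedDefault) fun b hb => ?_
      obtain ⟨k, hk⟩ := hb.exists
      exact hk.trans (htr k)

/-- If `A` and `C` are discrete with the same law, then `H(A | C) = H(C | A)` as soon as the latter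
is finite, even if `H(C) = ∞`. -/
lemma condEntropy_symm_of_map_eq {Ω E : Type*} [MeasurableSpace Ω] [MeasurableSpace E]
    [StandardBorelSpace E] [Nonempty E] {P : Measure Ω} [IsProbabilityMeasure P] {A C : Ω → E}
    (hA : Measurable A) (hC : Measurable C) (hlaw : P.map C = P.map A)
    (hdis : IsDiscrete (P.map C)) (hfin : condEntropy P C A ≠ ∞) :
    condEntropy P A C = condEntropy P C A := by
  have := Measure.isProbabilityMeasure_map (μ := P) hC.aemeasurable
  have := Measure.isProbabilityMeasure_map (μ := P) hA.aemeasurable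
  set f : Ω → ℝ≥0∞ := fun ω => surprisal (P.map C {C ω})
  set f' : Ω → ℝ≥0∞ := fun ω => surprisal (P.map C {A ω})
  set u : Ω → ℝ≥0∞ := fun ω => surprisal (condDistrib A C P (C ω) {A ω})
  set v : Ω → ℝ≥0∞ := fun ω => surprisal (condDistrib C A P (A ω) {C ω})
  have hmeas : Measurable fun y : E => surprisal (P.map C {y}) :=
    measurable_surprisal_singleton _
  have hf : Measurable f := hmeas.comp hC
  have hf' : Measurable f' := hmeas.comp hA
  have hv : Measurable v := (measurable_surprisal.comp
    (measurable_measure_singleton (condDistrib C A P))).comp (hA.prodMk hC)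
  have hu : Measurable u := (measurable_surprisal.comp
    (measurable_measure_singleton (condDistrib A C P))).comp (hC.prodMk hA)
  have hff : P.map f = P.map f' := by
    have h1 := Measure.map_map (μ := P) hmeas hC
    have h2 := Measure.map_map (μ := P) hmeas hA
    rw [← hlaw] at h2
    exact h1.symm.trans h2
  have hf_fin : ∀ᵐ ω ∂P, f ω ≠ ∞ := by
    filter_upwards [ae_of_ae_map hC.aemeasurable hdis.ae_ne_zero] with ω hω
      using surprisal_ne_top hω
  have hf'_fin : ∀ᵐ ω ∂P, f' ω ≠ ∞ := by
    have := hdis.ae_ne_zero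
    nth_rewrite 2 [hlaw] at this
    filter_upwards [ae_of_ae_map hA.aemeasurable this] with ω hω using surprisal_ne_top hω
  have hid : ∀ ω, f ω + u ω = f' ω + v ω := by
    intro ω
    simp only [f, f', u, v]
    have h1 := compProd_singleton (P.map C) (condDistrib A C P) (C ω, A ω)
    have h2 := compProd_singleton (P.map A) (condDistrib C A P) (A ω, C ω)
    rw [compProd_map_condDistrib hA.aemeasurable] at h1
    rw [compProd_map_condDistrib hC.aemeasurable, ← hlaw] at h2
    rw [← surprisal_mul prob_le_one prob_le_one, ← surprisal_mul prob_le_one prob_le_one, ← h1,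
      ← h2, Measure.map_apply (by fun_prop) (measurableSet_singleton _),
      Measure.map_apply (by fun_prop) (measurableSet_singleton _)]
    congr 2
    ext ω'
    simp [and_comm]
  have hle : ∫⁻ ω, (f ω - f' ω) ∂P = ∫⁻ ω, (f' ω - f ω) ∂P :=
    le_antisymm (lintegral_coboundary_le hf' hf hf_fin hff.symm)
      (lintegral_coboundary_le hf hf' hf'_fin hff)
  rw [condEntropy_eq_lintegral hC hA] at hfin
  have hne : ∫⁻ ω, (f ω - f' ω) ∂P ≠ ∞ := by
    refine ne_top_of_le_ne_top hfin (lintegral_mono fun ω => ?_)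
    simp only
    rw [tsub_le_iff_left]
    exact (le_self_add).trans (hid ω).le
  have hsum : ∫⁻ ω, u ω ∂P + ∫⁻ ω, (f ω - f' ω) ∂P = ∫⁻ ω, v ω ∂P + ∫⁻ ω, (f' ω - f ω) ∂P := by
    rw [← lintegral_add_left hu, ← lintegral_add_left hv]
    refine lintegral_congr_ae ?_
    filter_upwards [hf_fin, hf'_fin] with ω h1 h2
    rcases le_total (f ω) (f' ω) with h | h
    · rw [tsub_eq_zero_of_le h, add_zero]
      refine (ENNReal.add_right_inj h1).1 ?_
      rw [hid ω, add_left_comm, add_tsub_cancel_of_le h, add_comm]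
    · rw [tsub_eq_zero_of_le h, add_zero]
      refine (ENNReal.add_right_inj h2).1 ?_
      rw [← hid ω, add_left_comm, add_tsub_cancel_of_le h, add_comm]
  rw [← hle] at hsum
  rw [condEntropy_eq_lintegral hA hC, condEntropy_eq_lintegral hC hA]
  exact (ENNReal.add_left_inj hne).1 hsum

/-! ### The product structure of the path space -/

section PathSpace

variable {G : Type*}

lemma shift_iterate_apply (n : ℕ) (ω : ℕ → G) (k : ℕ) : shift^[n] ω k = ω (n + k) := by
  induction n generalizing ω with
  | zero => simp
  | succ n ih => rw [Function.iterate_succ_apply, ih]; simp only [shift]; congr 1; omega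

variable [MeasurableSpace G]

lemma measurable_shift : Measurable (shift : (ℕ → G) → ℕ → G) :=
  measurable_pi_lambda _ fun n => measurable_pi_apply (n + 1)

/-- Reindexing the steps by an injection preserves the law. -/
lemma measurePreserving_reindex (μ : Measure G) [IsProbabilityMeasure μ] {σ : ℕ → ℕ}
    (hσ : Function.Injective σ) :
    MeasurePreserving (fun (ω : ℕ → G) i => ω (σ i)) (pathMeasure μ) (pathMeasure μ) := by
  have hm : Measurable fun (ω : ℕ → G) i => ω (σ i) :=
    measurable_pi_lambda _ fun i => measurable_pi_apply (σ i)
  refine ⟨hm, ?_⟩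
  have h : iIndepFun (fun i (ω : ℕ → G) => ω (σ i)) (pathMeasure μ) :=
    .precomp hσ <| iIndepFun_infinitePi (P := fun _ : ℕ => μ) (X := fun x ω => ω) <| by fun_prop
  rw [iIndepFun_iff_map_fun_eq_infinitePi_map (by fun_prop)] at h
  rw [h, pathMeasure]
  congr with i : 1
  exact Measure.infinitePi_map_eval _ (σ i)

lemma measurePreserving_shift (μ : Measure G) [IsProbabilityMeasure μ] :
    MeasurePreserving shift (pathMeasure μ) (pathMeasure μ) :=
  measurePreserving_reindex μ (σ := fun n => n + 1) (add_left_injective 1)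

lemma measurePreserving_shift_iterate (μ : Measure G) [IsProbabilityMeasure μ] (n : ℕ) :
    MeasurePreserving shift^[n] (pathMeasure μ) (pathMeasure μ) :=
  (measurePreserving_shift μ).iterate n

lemma pathMeasure_map_eval (μ : Measure G) [IsProbabilityMeasure μ] (n : ℕ) :
    (pathMeasure μ).map (fun ω => ω n) = μ :=
  Measure.infinitePi_map_eval (fun _ : ℕ => μ) n

lemma indepFun_of_disjoint (μ : Measure G) [IsProbabilityMeasure μ] {S T : Set ℕ}
    (hST : Disjoint S T) :
    IndepFun (fun (ω : ℕ → G) (i : S) => ω i) (fun ω (i : T) => ω i) (pathMeasure μ) := by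
  have h : iIndep (fun i : ℕ => MeasurableSpace.comap (fun ω : ℕ → G => ω i) inferInstance)
      (pathMeasure μ) :=
    iIndepFun_infinitePi (P := fun _ : ℕ => μ) (X := fun x ω => ω) (by fun_prop)
  have h2 := indep_iSup_of_disjoint (fun i => (measurable_pi_apply i).comap_le) h hST
  have hpi : ∀ S : Set ℕ, MeasurableSpace.comap (fun (ω : ℕ → G) (i : S) => ω i) inferInstance =
      ⨆ i ∈ S, MeasurableSpace.comap (fun ω : ℕ → G => ω i) inferInstance := by
    intro S
    simp only [MeasurableSpace.pi, MeasurableSpace.comap_iSup, MeasurableSpace.comap_comp]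
    rw [iSup_subtype]
    rfl
  rw [IndepFun_iff_Indep, hpi, hpi]
  exact h2

end PathSpace

section Walk

variable {G : Type*} [Group G]

lemma walk_zero (ω : ℕ → G) : walk 0 ω = 1 := rfl

lemma walk_succ (n : ℕ) (ω : ℕ → G) : walk (n + 1) ω = walk n ω * ω n := rfl

lemma walk_one (ω : ℕ → G) : walk 1 ω = ω 0 := by simp [walk_succ, walk_zero]

lemma walk_add (m n : ℕ) (ω : ℕ → G) : walk (m + n) ω = walk m ω * walk n (shift^[m] ω) := by
  induction n with
  | zero => simp [walk_zero]
  | succ n ih => rw [← add_assoc, walk_succ, ih, walk_succ, shift_iterate_apply, mul_assoc]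

lemma walk_succ' (n : ℕ) (ω : ℕ → G) : walk (n + 1) ω = ω 0 * walk n (shift ω) := by
  rw [add_comm, walk_add, walk_one]; rfl

lemma dependsOn_walk {m n : ℕ} (h : m ≤ n) :
    DependsOn (walk m : (ℕ → G) → G) (Set.Iio n) := by
  intro ω ω' hω
  induction m with
  | zero => rfl
  | succ m ih => rw [walk_succ, walk_succ, ih (by omega), hω m (by simpa using h)]

lemma dependsOn_range {m n : ℕ} (h : m ≤ n) :
    DependsOn (range m : (ℕ → G) → Set G) (Set.Iio n) := by
  intro ω ω' hω
  ext g
  refine exists_congr fun i => and_congr_right fun hi => ?_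
  rw [dependsOn_walk (hi.trans h) hω]

lemma mem_range {n : ℕ} {ω : ℕ → G} {g : G} : g ∈ range n ω ↔ ∃ i ≤ n, walk i ω = g := Iff.rfl

lemma walk_mem_range {i n : ℕ} (h : i ≤ n) (ω : ℕ → G) : walk i ω ∈ range n ω := ⟨i, h, rfl⟩

lemma mem_totalRange {ω : ℕ → G} {g : G} : g ∈ totalRange ω ↔ ∃ i, walk i ω = g := by
  simp only [totalRange, Set.mem_iUnion, mem_range]
  exact ⟨fun ⟨_, i, _, h⟩ => ⟨i, h⟩, fun ⟨i, h⟩ => ⟨i, i, le_rfl, h⟩⟩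

lemma range_mono (ω : ℕ → G) : Monotone fun n => range n ω :=
  fun _ _ h _ ⟨i, hi, e⟩ => ⟨i, hi.trans h, e⟩

lemma range_subset_totalRange (n : ℕ) (ω : ℕ → G) : range n ω ⊆ totalRange ω :=
  Set.subset_iUnion (fun n => range n ω) n

lemma range_eq_image (n : ℕ) (ω : ℕ → G) :
    range n ω = (fun i => walk i ω) '' (Finset.range (n + 1) : Set ℕ) := by
  ext g
  simp [mem_range]

lemma finite_range (n : ℕ) (ω : ℕ → G) : (range n ω).Finite := by
  rw [range_eq_image]
  exact (Finset.finite_toSet _).image _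

lemma ncard_range_le (n : ℕ) (ω : ℕ → G) : (range n ω).ncard ≤ n + 1 := by
  rw [range_eq_image]
  refine (Set.ncard_image_le (Finset.finite_toSet _)).trans ?_
  simp

lemma mem_range_add {m n : ℕ} {ω : ℕ → G} {g : G} :
    g ∈ range (m + n) ω ↔ g ∈ range m ω ∨ (walk m ω)⁻¹ * g ∈ range n (shift^[m] ω) := by
  simp only [mem_range]
  constructor
  · rintro ⟨i, hi, rfl⟩
    rcases le_total i m with h | h
    · exact Or.inl ⟨i, h, rfl⟩
    · obtain ⟨k, rfl⟩ := Nat.exists_eq_add_of_le h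
      exact Or.inr ⟨k, by omega, by rw [walk_add]; group⟩
  · rintro (⟨i, hi, h⟩ | ⟨i, hi, h⟩)
    · exact ⟨i, by omega, h⟩
    · exact ⟨m + i, by omega, by rw [walk_add, h]; group⟩

lemma mem_range_zero {ω : ℕ → G} {g : G} : g ∈ range 0 ω ↔ g = 1 := by
  simp [mem_range, walk_zero, eq_comm]

lemma mem_range_succ {n : ℕ} {ω : ℕ → G} {g : G} :
    g ∈ range (n + 1) ω ↔ g = 1 ∨ (ω 0)⁻¹ * g ∈ range n (shift ω) := by
  simp only [mem_range]
  constructor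
  · rintro ⟨i, hi, rfl⟩
    rcases i with _ | i
    · exact Or.inl rfl
    · exact Or.inr ⟨i, by omega, by rw [walk_succ']; group⟩
  · rintro (rfl | ⟨i, hi, h⟩)
    · exact ⟨0, by omega, rfl⟩
    · exact ⟨i + 1, by omega, by rw [walk_succ', h]; group⟩

lemma mem_totalRange_shift {ω : ℕ → G} {g : G} :
    g ∈ totalRange ω ↔ g = 1 ∨ (ω 0)⁻¹ * g ∈ totalRange (shift ω) := by
  simp only [totalRange, Set.mem_iUnion]
  constructor
  · rintro ⟨n, h⟩
    exact (mem_range_succ.1 (range_mono ω (Nat.le_succ n) h)).imp_right fun h => ⟨n, h⟩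
  · rintro (rfl | ⟨n, h⟩)
    · exact ⟨0, 0, le_rfl, rfl⟩
    · exact ⟨n + 1, mem_range_succ.2 (Or.inr h)⟩

end Walk

lemma exists_eq_comp_restrict {G α : Type*} [Nonempty G] {s : Set ℕ} {Y : (ℕ → G) → α}
    (hY : DependsOn Y s) : ∃ φ : (s → G) → α, Y = fun ω => φ fun i => ω i := by
  have : Nonempty α := ⟨Y fun _ => Classical.arbitrary G⟩
  exact dependsOn_iff_exists_comp.1 hY

lemma measurable_setOf_mem {G Ω : Type*} [MeasurableSpace Ω] {A : Ω → Set G} (hA : Measurable A)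
    (g : G) : MeasurableSet {ω | g ∈ A ω} :=
  measurableSet_setOfPred.2 ((measurable_set_mem g).comp hA)

section Discrete

variable {G : Type*} [Group G] [Countable G] [MeasurableSpace G] [DiscreteMeasurableSpace G]

/-- Functions of finitely many steps are measurable, since `G` is countable and discrete. -/
lemma measurable_of_dependsOn {α : Type*} [MeasurableSpace α] {s : Set ℕ} (hs : s.Finite)
    {Y : (ℕ → G) → α} (hY : DependsOn Y s) : Measurable Y := by
  have := hs.to_subtype
  obtain ⟨φ, rfl⟩ := exists_eq_comp_restrict hY
  exact (measurable_of_countable φ).comp (by fun_prop)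

/-- The Markov property at a deterministic time. -/
lemma indepFun_shift {α : Type*} [MeasurableSpace α] (μ : Measure G) [IsProbabilityMeasure μ]
    {n : ℕ} {Y : (ℕ → G) → α} (hY : DependsOn Y (Set.Iio n)) :
    IndepFun Y shift^[n] (pathMeasure μ) := by
  obtain ⟨φ, rfl⟩ := exists_eq_comp_restrict hY
  have : (shift^[n] : (ℕ → G) → ℕ → G) =
      fun ω => (fun (f : Set.Ici n → G) k => f ⟨n + k, by simp⟩) fun i => ω i := by
    ext ω k; rw [shift_iterate_apply]
  rw [this]
  refine (indepFun_of_disjoint μ (S := Set.Iio n) (T := Set.Ici n) ?_).comp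
    (measurable_of_countable φ) (measurable_pi_lambda _ fun k => measurable_pi_apply _)
  rw [Set.disjoint_left]
  intro a ha hb
  exact absurd (Set.mem_Iio.1 ha) (not_lt.2 (Set.mem_Ici.1 hb))

lemma measure_inter_shift (μ : Measure G) [IsProbabilityMeasure μ] {n : ℕ} {B Q : Set (ℕ → G)}
    (hB : DependsOn (fun ω => ω ∈ B) (Set.Iio n)) (hQ : MeasurableSet Q) :
    pathMeasure μ (B ∩ shift^[n] ⁻¹' Q) = pathMeasure μ B * pathMeasure μ Q := by
  have h := (indepFun_shift μ hB).measure_inter_preimage_eq_mul {True} Q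
    (measurableSet_singleton _) hQ
  rw [(measurePreserving_shift_iterate μ n).measure_preimage hQ.nullMeasurableSet] at h
  have : (fun ω => ω ∈ B) ⁻¹' {True} = B := by ext; simp
  rwa [this] at h

lemma pathMeasure_map_pair (μ : Measure G) [IsProbabilityMeasure μ] :
    (pathMeasure μ).map (fun ω => (ω 0, shift ω)) = μ.prod (pathMeasure μ) := by
  have h : IndepFun (fun ω : ℕ → G => ω 0) shift (pathMeasure μ) :=
    indepFun_shift μ (n := 1) (Y := fun ω => ω 0) (fun ω ω' h => h 0 (by simp))
  rw [(indepFun_iff_map_prod_eq_prod_map_map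
    (measurable_pi_apply 0).aemeasurable measurable_shift.aemeasurable).1 h,
    (measurePreserving_shift μ).map_eq, pathMeasure_map_eval]

lemma measurable_walk (n : ℕ) : Measurable (walk n : (ℕ → G) → G) :=
  measurable_of_dependsOn (Set.finite_Iio n) (dependsOn_walk le_rfl)

lemma measurable_range (n : ℕ) : Measurable (range n : (ℕ → G) → Set G) :=
  measurable_of_dependsOn (Set.finite_Iio n) (dependsOn_range le_rfl)

lemma measurable_totalRange : Measurable (totalRange : (ℕ → G) → Set G) := by
  rw [measurable_set_iff]
  intro g
  simp only [totalRange, Set.mem_iUnion]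
  exact Measurable.exists fun n => (measurable_set_mem g).comp (measurable_range n)

end Discrete

/-! ### Existence of the average range entropy -/

lemma countable_setOf_finite {G : Type*} [Countable G] : {A : Set G | A.Finite}.Countable :=
  (Set.countable_ofPred_finite_subset (Set.countable_univ (α := G))).mono
    fun A hA => And.intro hA (Set.subset_univ A)

/-- The pair `(R_n, S_n)` of the range and the position. -/
def rangeWalk {G : Type*} [Group G] (n : ℕ) (ω : ℕ → G) : Set G × G := (range n ω, walk n ω)

lemma dependsOn_rangeWalk {G : Type*} [Group G] {m n : ℕ} (h : m ≤ n) :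
    DependsOn (rangeWalk m : (ℕ → G) → Set G × G) (Set.Iio n) := fun _ _ hω =>
  Prod.ext (dependsOn_range h hω) (dependsOn_walk h hω)

lemma isDiscrete_map {Ω E : Type*} [MeasurableSpace Ω] [MeasurableSpace E]
    [MeasurableSingletonClass E] {P : Measure Ω} {Y : Ω → E} (hY : Measurable Y) {C : Set E}
    (hC : C.Countable) (h : ∀ᵐ ω ∂P, Y ω ∈ C) : IsDiscrete (P.map Y) := by
  refine ⟨C, hC, ?_⟩
  rw [Measure.map_apply hY hC.measurableSet.compl]
  exact h

lemma entropy_comp_of_measurePreserving {Ω E : Type*} [MeasurableSpace Ω] [MeasurableSpace E]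
    {P : Measure Ω} {Y : Ω → E} (hY : Measurable Y) {θ : Ω → Ω} (hθ : MeasurePreserving θ P P) :
    entropy P (fun ω => Y (θ ω)) = entropy P Y := by
  rw [entropy, entropy, ← hθ.map_eq, Measure.map_map hY hθ.measurable, hθ.map_eq]
  rfl

section

variable {G : Type*} [Group G] [Countable G] [MeasurableSpace G] [DiscreteMeasurableSpace G]
  (μ : Measure G) [IsProbabilityMeasure μ]

lemma measurable_rangeWalk (n : ℕ) : Measurable (rangeWalk n : (ℕ → G) → Set G × G) :=
  (measurable_range n).prodMk (measurable_walk n)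

/-- Subadditivity: the pair at time `m + n` is a function of the pair at time `m` and of an
independent copy of the pair at time `n`. This fails for the range alone. -/
lemma entropy_rangeWalk_add_le (m n : ℕ) :
    entropy (pathMeasure μ) (rangeWalk (m + n)) ≤
      entropy (pathMeasure μ) (rangeWalk m) + entropy (pathMeasure μ) (rangeWalk n) := by
  have hm := measurable_rangeWalk (G := G) m
  have hs := measurePreserving_shift_iterate μ m
  have hn : Measurable fun ω : ℕ → G => rangeWalk n (shift^[m] ω) :=
    (measurable_rangeWalk n).comp hs.measurable
  rw [← entropy_comp_of_measurePreserving (measurable_rangeWalk n) hs,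
    ← entropy_prod_of_indepFun hm hn ((indepFun_shift μ (dependsOn_rangeWalk le_rfl)).comp
      measurable_id (measurable_rangeWalk n))]
  refine entropy_le_of_determined (hm.prodMk hn) (measurable_rangeWalk _) fun ω ω' h => ?_
  simp only [rangeWalk, Prod.mk.injEq] at h ⊢
  obtain ⟨⟨h1, h2⟩, h3, h4⟩ := h
  refine ⟨?_, by rw [walk_add, walk_add, h2, h4]⟩
  ext g
  rw [mem_range_add, mem_range_add, h1, h2, h3]

lemma entropy_const {Ω E : Type*} [MeasurableSpace Ω] [MeasurableSpace E]
    [MeasurableSingletonClass E] (P : Measure Ω) [IsProbabilityMeasure P] (c : E) :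
    entropy P (fun _ => c) = 0 := by
  rw [entropy, Measure.map_const, measure_univ, one_smul, measureEntropy_dirac]

lemma entropy_rangeWalk_le (n : ℕ) :
    entropy (pathMeasure μ) (rangeWalk n) ≤ n * entropy (pathMeasure μ) (step 0) := by
  induction n with
  | zero =>
    have : (rangeWalk 0 : (ℕ → G) → Set G × G) = fun _ => ({1}, 1) := by
      ext ω : 1
      refine Prod.ext ?_ rfl
      ext g
      simp [rangeWalk, mem_range_zero]
    rw [this, entropy_const]
    simp
  | succ n ih =>
    refine (entropy_rangeWalk_add_le μ n 1).trans ?_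
    push_cast
    rw [add_mul, one_mul]
    gcongr
    refine entropy_le_of_determined (measurable_pi_apply 0) (measurable_rangeWalk 1)
      fun ω ω' h => dependsOn_rangeWalk le_rfl fun i hi => ?_
    have hi : i < 1 := hi
    obtain rfl : i = 0 := by omega
    exact h

lemma entropy_range_le_entropy_rangeWalk (n : ℕ) :
    entropy (pathMeasure μ) (range n) ≤ entropy (pathMeasure μ) (rangeWalk n) :=
  entropy_le_of_determined (measurable_rangeWalk n) (measurable_range n)
    fun _ _ h => congrArg Prod.fst h

/-- Given the range, the position is one of at most `n + 1` points. -/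
lemma entropy_rangeWalk_le_entropy_range_add (n : ℕ) :
    entropy (pathMeasure μ) (rangeWalk n) ≤
      entropy (pathMeasure μ) (range n) + surprisal ((n + 1 : ℕ) : ℝ≥0∞)⁻¹ := by
  classical
  set P := pathMeasure μ
  have hP1 := Measure.isProbabilityMeasure_map (μ := P) (measurable_range n).aemeasurable
  have hP2 := Measure.isProbabilityMeasure_map (μ := P) (measurable_rangeWalk n).aemeasurable
  have hd1 : IsDiscrete (P.map (range n)) := isDiscrete_map (measurable_range n)
    countable_setOf_finite (ae_of_all _ fun ω => finite_range n ω)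
  have hd2 : IsDiscrete (P.map (rangeWalk n)) := isDiscrete_map (measurable_rangeWalk n)
    (countable_setOf_finite.prod (Set.countable_univ (α := G)))
    (ae_of_all _ fun ω => ⟨finite_range n ω, Set.mem_univ _⟩)
  have hinv : (((n + 1 : ℕ) : ℝ≥0∞))⁻¹ ≤ 1 := by
    rw [ENNReal.inv_le_one]; exact_mod_cast Nat.succ_le_succ (Nat.zero_le n)
  set q : Set G × G → ℝ≥0∞ := fun p =>
    P.map (range n) {p.1} * (((n + 1 : ℕ) : ℝ≥0∞)⁻¹ * p.1.indicator 1 p.2)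
  have hq : ∑' p, q p ≤ 1 := by
    have hν : ∑' A, P.map (range n) {A} = 1 := by
      simpa using (hd1.lintegral_eq (fun _ => 1)).symm
    rw [ENNReal.tsum_prod', ← hν]
    refine ENNReal.tsum_le_tsum fun A => ?_
    simp only [q]
    rw [ENNReal.tsum_mul_left, ENNReal.tsum_mul_left]
    rcases eq_or_ne (P.map (range n) {A}) 0 with h | h
    · simp [h]
    have hA : ∃ ω, range n ω = A := by
      by_contra hA
      push Not at hA
      refine h ?_
      rw [Measure.map_apply (measurable_range n) (measurableSet_singleton _)]
      convert measure_empty (μ := P)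
      ext ω
      simpa using hA ω
    obtain ⟨ω, hω⟩ := hA
    have hfin : A.Finite := hω ▸ finite_range n ω
    have hcard : ∑' g, A.indicator (1 : G → ℝ≥0∞) g ≤ ((n + 1 : ℕ) : ℝ≥0∞) := by
      rw [← tsum_subtype]
      have := hfin.fintype
      rw [tsum_fintype]
      simp only [Pi.one_apply, Finset.sum_const, Finset.card_univ, nsmul_eq_mul, mul_one]
      rw [← Set.toFinset_card, ← Set.ncard_eq_toFinset_card' A]
      exact_mod_cast hω ▸ ncard_range_le n ω
    calc P.map (range n) {A} * (((n + 1 : ℕ) : ℝ≥0∞)⁻¹ * ∑' g, A.indicator (1 : G → ℝ≥0∞) g)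
        ≤ P.map (range n) {A} * 1 := by
          gcongr
          refine (mul_le_mul_right hcard _).trans ?_
          exact ENNReal.inv_mul_le_one _
      _ = _ := mul_one _
  calc entropy P (rangeWalk n) ≤ ∫⁻ p, surprisal (q p) ∂(P.map (rangeWalk n)) :=
        measureEntropy_le_lintegral_surprisal hd2 hq
    _ ≤ ∫⁻ ω, surprisal (q (rangeWalk n ω)) ∂P := lintegral_map_le _ _
    _ = ∫⁻ ω, (surprisal (P.map (range n) {range n ω}) + surprisal ((n + 1 : ℕ) : ℝ≥0∞)⁻¹) ∂P := by
        refine lintegral_congr fun ω => ?_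
        simp only [q, rangeWalk]
        rw [Set.indicator_of_mem (walk_mem_range le_rfl ω), Pi.one_apply, mul_one,
          surprisal_mul prob_le_one hinv]
    _ = _ := by
        rw [lintegral_add_right _ measurable_const, ← entropy_eq_lintegral (measurable_range n)]
        simp

variable {μ} in
lemma entropy_rangeWalk_ne_top (hfin : entropy (pathMeasure μ) (step 0) < ∞) (n : ℕ) :
    entropy (pathMeasure μ) (rangeWalk n) ≠ ∞ :=
  ne_top_of_le_ne_top (ENNReal.mul_ne_top (ENNReal.natCast_ne_top n) hfin.ne)
    (entropy_rangeWalk_le μ n)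

variable {μ} in
/-- The entropies of the range and of the pair `(R_n, S_n)` have the same linear growth rate, which
exists by Fekete's lemma for the latter. -/
lemma exists_tendsto_entropy (hfin : entropy (pathMeasure μ) (step 0) < ∞) :
    ∃ L : ℝ, 0 ≤ L ∧
      Tendsto (fun n : ℕ => (entropy (pathMeasure μ) (rangeWalk n)).toReal / n) atTop (𝓝 L) ∧
      Tendsto (fun n : ℕ => entropy (pathMeasure μ) (range n) / (n : ℝ≥0∞)) atTop
        (𝓝 (ENNReal.ofReal L)) := by
  set P := pathMeasure μ
  set u : ℕ → ℝ := fun n => (entropy P (rangeWalk n)).toReal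
  have hY := entropy_rangeWalk_ne_top hfin
  have hR : ∀ n, entropy P (range n) ≠ ∞ := fun n =>
    ne_top_of_le_ne_top (hY n) (entropy_range_le_entropy_rangeWalk μ n)
  have hsub : Subadditive u := fun m n => by
    rw [← ENNReal.toReal_add (hY m) (hY n)]
    exact ENNReal.toReal_mono (ENNReal.add_ne_top.2 ⟨hY m, hY n⟩) (entropy_rangeWalk_add_le μ m n)
  have hlim := hsub.tendsto_lim ⟨0, by rintro _ ⟨n, rfl⟩; positivity⟩
  refine ⟨hsub.lim, ge_of_tendsto' hlim fun n => by positivity, hlim, ?_⟩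
  have hlog : Tendsto (fun n : ℕ => Real.log (n + 1) / n) atTop (𝓝 0) := by
    have h1 : Tendsto (fun n : ℕ => Real.log ((n : ℝ) + 1) / ((n : ℝ) + 1)) atTop (𝓝 0) := by
      have := (Real.isLittleO_log_id_atTop.tendsto_div_nhds_zero).comp
        (tendsto_natCast_atTop_atTop.comp (tendsto_add_atTop_nat 1))
      refine this.congr fun n => ?_
      simp
    have h2 : Tendsto (fun n : ℕ => ((n : ℝ) + 1) / n) atTop (𝓝 1) := by
      have := (tendsto_const_nhds (x := (1 : ℝ))).add
        (tendsto_const_div_atTop_nhds_zero_nat (1 : ℝ))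
      rw [add_zero] at this
      refine this.congr' ?_
      filter_upwards [eventually_gt_atTop 0] with n hn
      field_simp
    have h3 := h1.mul h2
    rw [zero_mul] at h3
    refine h3.congr' ?_
    filter_upwards [eventually_gt_atTop 0] with n hn
    field_simp
  have hr : Tendsto (fun n : ℕ => (entropy P (range n)).toReal / n) atTop (𝓝 hsub.lim) := by
    have h1 := hlim.sub hlog
    rw [sub_zero] at h1
    refine tendsto_of_tendsto_of_tendsto_of_le_of_le h1 hlim (fun n => ?_) fun n => ?_
    · simp only [← sub_div]
      gcongr
      have h2 := entropy_rangeWalk_le_entropy_range_add μ n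
      have hs : surprisal ((n + 1 : ℕ) : ℝ≥0∞)⁻¹ = ENNReal.ofReal (Real.log (n + 1)) := by
        rw [surprisal, if_neg (by simp)]
        rw [ENNReal.toReal_inv, Real.log_inv, neg_neg, ENNReal.toReal_natCast, Nat.cast_add_one]
      rw [hs] at h2
      have h3 := ENNReal.toReal_mono (ENNReal.add_ne_top.2 ⟨hR n, ENNReal.ofReal_ne_top⟩) h2
      rw [ENNReal.toReal_add (hR n) ENNReal.ofReal_ne_top, ENNReal.toReal_ofReal
        (Real.log_nonneg (by linarith [Nat.cast_nonneg (α := ℝ) n]))] at h3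
      simp only [u]
      linarith
    · simp only [u]
      gcongr
      · exact hY n
      · exact entropy_range_le_entropy_rangeWalk μ n
  refine (ENNReal.tendsto_ofReal hr).congr' ?_
  filter_upwards [eventually_gt_atTop 0] with n hn
  rw [ENNReal.ofReal_div_of_pos (by exact_mod_cast hn), ENNReal.ofReal_toReal (hR n),
    ENNReal.ofReal_natCast]

end

/-! ### Almost surely visited points -/

section Visits

variable {G : Type*} [Group G] [Countable G] [MeasurableSpace G] [DiscreteMeasurableSpace G]
  (μ : Measure G) [IsProbabilityMeasure μ]

/-- The set of points which almost surely belong to the range of the walk (time `0` included). -/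
def surelyVisited : Set G := {g | ∀ᵐ ω ∂(pathMeasure μ), g ∈ totalRange ω}

variable {μ}

omit [Group G] [Countable G] [DiscreteMeasurableSpace G] in
lemma ae_forall_shift {p : (ℕ → G) → Prop} (h : ∀ᵐ ω ∂(pathMeasure μ), p ω) :
    ∀ᵐ ω ∂(pathMeasure μ), ∀ m, p (shift^[m] ω) :=
  ae_all_iff.2 fun m => (measurePreserving_shift_iterate μ m).quasiMeasurePreserving.ae h

lemma measurableSet_walk_eq (n : ℕ) (g : G) : MeasurableSet {ω : ℕ → G | walk n ω = g} :=
  measurable_walk n (measurableSet_singleton g)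

lemma hitAlmostSurely_iff {x : G} :
    HitAlmostSurely μ x ↔ ∀ᵐ ω ∂(pathMeasure μ), ∃ n ≥ 1, walk n ω = x := by
  have : MeasurableSet {ω : ℕ → G | ∃ n ≥ 1, walk n ω = x} := by
    have : {ω : ℕ → G | ∃ n ≥ 1, walk n ω = x} = ⋃ n, ⋃ (_ : n ≥ 1), {ω | walk n ω = x} := by
      ext; simp
    rw [this]
    exact MeasurableSet.iUnion fun n => MeasurableSet.iUnion fun _ => measurableSet_walk_eq n x
  rw [HitAlmostSurely, ← mem_ae_iff_prob_eq_one this]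
  rfl

omit [Countable G] [DiscreteMeasurableSpace G] in
lemma one_mem_surelyVisited : (1 : G) ∈ surelyVisited μ :=
  ae_of_all _ fun _ => mem_totalRange.2 ⟨0, rfl⟩

omit [Countable G] [DiscreteMeasurableSpace G] in
lemma mul_mem_surelyVisited {u v : G} (hu : u ∈ surelyVisited μ) (hv : v ∈ surelyVisited μ) :
    u * v ∈ surelyVisited μ := by
  filter_upwards [hu, ae_forall_shift hv] with ω h1 h2
  obtain ⟨m, rfl⟩ := mem_totalRange.1 h1
  obtain ⟨n, rfl⟩ := mem_totalRange.1 (h2 m)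
  exact mem_totalRange.2 ⟨m + n, walk_add m n ω⟩

omit [Countable G] [DiscreteMeasurableSpace G] in
lemma pow_mem_surelyVisited {u : G} (hu : u ∈ surelyVisited μ) (n : ℕ) :
    u ^ n ∈ surelyVisited μ := by
  induction n with
  | zero => simpa using one_mem_surelyVisited
  | succ n ih => rw [pow_succ]; exact mul_mem_surelyVisited ih hu

lemma mem_surelyVisited_iff_of_ne_one {x : G} (hx : x ≠ 1) :
    x ∈ surelyVisited μ ↔ HitAlmostSurely μ x := by
  rw [hitAlmostSurely_iff]
  refine eventually_congr (ae_of_all _ fun ω => mem_totalRange.trans ⟨?_, ?_⟩)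
  · rintro ⟨n, rfl⟩
    refine ⟨n, Nat.one_le_iff_ne_zero.2 ?_, rfl⟩
    rintro rfl
    exact hx rfl
  · rintro ⟨n, -, h⟩
    exact ⟨n, h⟩

/-- If, on an event of positive probability decided by time `m`, the walk is at `u` at time `m` and
almost surely visits `v` afterwards, then `u⁻¹ * v` is almost surely visited from the origin. -/
lemma inv_mul_mem_surelyVisited {m : ℕ} {B : Set (ℕ → G)}
    (hB : DependsOn (fun ω => ω ∈ B) (Set.Iio m)) (hB0 : pathMeasure μ B ≠ 0) {u v : G}
    (hu : ∀ ω ∈ B, walk m ω = u)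
    (hv : ∀ᵐ ω ∂(pathMeasure μ), ω ∈ B → ∃ n ≥ m, walk n ω = v) :
    u⁻¹ * v ∈ surelyVisited μ := by
  have hQ : MeasurableSet {ω : ℕ → G | u⁻¹ * v ∉ totalRange ω} :=
    (measurable_setOf_mem measurable_totalRange _).compl
  have h := measure_inter_shift μ hB hQ
  have h0 : pathMeasure μ (B ∩ shift^[m] ⁻¹' {ω : ℕ → G | u⁻¹ * v ∉ totalRange ω}) = 0 := by
    rw [measure_eq_zero_iff_ae_notMem]
    filter_upwards [hv] with ω hω hmem
    obtain ⟨n, hn, rfl⟩ := hω hmem.1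
    obtain ⟨k, rfl⟩ := Nat.exists_eq_add_of_le hn
    refine hmem.2 (mem_totalRange.2 ⟨k, ?_⟩)
    rw [walk_add, hu ω hmem.1]
    group
  rw [h0] at h
  exact (mul_eq_zero.1 h.symm).resolve_left hB0

omit [Countable G] [MeasurableSpace G] [DiscreteMeasurableSpace G] in
lemma dependsOn_walk_eq (m : ℕ) (u : G) :
    DependsOn (fun ω : ℕ → G => ω ∈ {ω | walk m ω = u}) (Set.Iio m) := fun _ _ hω => by
  simp only [Set.mem_ofPred_eq]
  rw [dependsOn_walk le_rfl hω]

omit [Countable G] [DiscreteMeasurableSpace G] in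
lemma exists_measure_walk_ne_zero {g : G} (hg : g ∈ surelyVisited μ) :
    ∃ m, pathMeasure μ {ω | walk m ω = g} ≠ 0 := by
  by_contra h
  push Not at h
  have h1 : ∀ᵐ ω ∂(pathMeasure μ), ∀ m, walk m ω ≠ g :=
    ae_all_iff.2 fun m => measure_eq_zero_iff_ae_notMem.1 (h m)
  obtain ⟨ω, h2, h3⟩ := (h1.and hg).exists
  obtain ⟨m, hm⟩ := mem_totalRange.1 h3
  exact h2 m hm

lemma measure_walk_one (g : G) : pathMeasure μ {ω | walk 1 ω = g} = μ {g} := by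
  conv_rhs => rw [← pathMeasure_map_eval μ 0]
  rw [Measure.map_apply (measurable_pi_apply 0) (measurableSet_singleton g)]
  congr 1
  ext ω
  simp [walk_one]

/-! ### Recurrence -/

lemma Recurrent.ae_returns (h : Recurrent μ) :
    ∀ᵐ ω ∂(pathMeasure μ), ∀ m, ∃ n ≥ m, walk n ω = 1 := by
  filter_upwards [ae_forall_shift (hitAlmostSurely_iff.1 h)] with ω hω m
  induction m with
  | zero => exact ⟨0, le_rfl, rfl⟩
  | succ m ih =>
    obtain ⟨n, hn, e⟩ := ih
    obtain ⟨k, hk, e'⟩ := hω n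
    exact ⟨n + k, by omega, by rw [walk_add, e, e', one_mul]⟩

/-- A recurrent walk almost surely visits every point. -/
lemma Recurrent.surelyVisited_eq_univ (h : Recurrent μ)
    (hgen : Subgroup.closure {g : G | μ {g} ≠ 0} = ⊤) : surelyVisited μ = Set.univ := by
  have key : ∀ (u : G) (m : ℕ), pathMeasure μ {ω | walk m ω = u} ≠ 0 → u⁻¹ ∈ surelyVisited μ := by
    intro u m hm
    have := inv_mul_mem_surelyVisited (μ := μ) (dependsOn_walk_eq m u) hm (u := u) (v := 1)
      (fun ω hω => hω) (h.ae_returns.mono fun ω hω _ => hω m)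
    simpa using this
  have hinv : ∀ g ∈ surelyVisited μ, g⁻¹ ∈ surelyVisited μ := fun g hg => by
    obtain ⟨m, hm⟩ := exists_measure_walk_ne_zero hg
    exact key g m hm
  refine Set.eq_univ_of_forall fun g => ?_
  have hg : g ∈ Subgroup.closure {g : G | μ {g} ≠ 0} := hgen ▸ Subgroup.mem_top g
  induction hg using Subgroup.closure_induction with
  | mem x hx => simpa using hinv _ (key x 1 (by rwa [measure_walk_one]))
  | one => exact one_mem_surelyVisited
  | mul x y _ _ hx hy => exact mul_mem_surelyVisited hx hy
  | inv x _ hx => exact hinv x hx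

lemma recurrent_of_mem_of_inv_mem {u : G} (hu1 : u ≠ 1) (hu : u ∈ surelyVisited μ)
    (hu' : u⁻¹ ∈ surelyVisited μ) : Recurrent μ := by
  refine hitAlmostSurely_iff.2 ?_
  filter_upwards [hu, ae_forall_shift hu'] with ω h1 h2
  obtain ⟨m, hm⟩ := mem_totalRange.1 h1
  obtain ⟨n, hn⟩ := mem_totalRange.1 (h2 m)
  refine ⟨m + n, ?_, by rw [walk_add, hm, hn, mul_inv_cancel]⟩
  rcases m with _ | m
  · exact absurd hm.symm hu1
  · omega

/-! ### Green functions -/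

/-- The total mass of a Cauchy product is the product of the total masses. -/
lemma tsum_sum_antidiagonal (f g : ℕ → ℝ≥0∞) :
    ∑' n, ∑ p ∈ Finset.HasAntidiagonal.antidiagonal n, f p.1 * g p.2 = (∑' n, f n) * ∑' n, g n := by
  have h1 : ∀ n, ∑ p ∈ Finset.HasAntidiagonal.antidiagonal n, f p.1 * g p.2 =
      ∑' p : Finset.HasAntidiagonal.antidiagonal n, f p.1.1 * g p.1.2 := fun n =>
    (Finset.tsum_subtype' _ (fun p : ℕ × ℕ => f p.1 * g p.2)).symm
  have h2 := ENNReal.tsum_sigma' (β := fun n : ℕ => Finset.HasAntidiagonal.antidiagonal n)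
    (fun x => f x.2.1.1 * g x.2.1.2)
  have h3 := Finset.HasAntidiagonal.sigmaAntidiagonalEquivProd.tsum_eq
    (fun p : ℕ × ℕ => f p.1 * g p.2)
  simp_rw [h1]
  rw [← ENNReal.tsum_mul_right]
  simp_rw [← ENNReal.tsum_mul_left]
  rw [← ENNReal.tsum_prod (f := fun a b => f a * g b), ← h3]
  exact h2.symm

/-- The event that the walk visits `h` at time `n` for the first time after time `0`. -/
def firstHit (h : G) (n : ℕ) : Set (ℕ → G) := {ω | walk n ω = h ∧ ∀ i, 1 ≤ i → i < n → walk i ω ≠ h}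

/-- The event that the walk is at `h` at time `n` and does not return to the origin up to then. -/
def lastExit (h : G) (n : ℕ) : Set (ℕ → G) := {ω | walk n ω = h ∧ ∀ i, 1 ≤ i → i ≤ n → walk i ω ≠ 1}

omit [Countable G] [MeasurableSpace G] [DiscreteMeasurableSpace G] in
lemma dependsOn_firstHit (h : G) (n : ℕ) :
    DependsOn (fun ω : ℕ → G => ω ∈ firstHit h n) (Set.Iio n) := fun ω ω' hω => by
  simp only [firstHit, Set.mem_ofPred_eq]
  rw [dependsOn_walk le_rfl hω]
  refine congrArg _ (forall_congr fun i => forall_congr fun _ => forall_congr fun hi => ?_)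
  rw [dependsOn_walk hi.le hω]

omit [Countable G] [MeasurableSpace G] [DiscreteMeasurableSpace G] in
lemma dependsOn_lastExit (h : G) (n : ℕ) :
    DependsOn (fun ω : ℕ → G => ω ∈ lastExit h n) (Set.Iio n) := fun ω ω' hω => by
  simp only [lastExit, Set.mem_ofPred_eq]
  rw [dependsOn_walk le_rfl hω]
  refine congrArg _ (forall_congr fun i => forall_congr fun _ => forall_congr fun hi => ?_)
  rw [dependsOn_walk hi hω]

lemma measurableSet_of_dependsOn {n : ℕ} {B : Set (ℕ → G)}
    (hB : DependsOn (fun ω => ω ∈ B) (Set.Iio n)) : MeasurableSet B :=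
  measurableSet_setOfPred.2 (measurable_of_dependsOn (Set.finite_Iio n) hB)

/-- First-entrance decomposition. -/
lemma measure_walk_succ_le (h : G) (n : ℕ) :
    pathMeasure μ {ω | walk (n + 1) ω = h} ≤ ∑ p ∈ Finset.HasAntidiagonal.antidiagonal n,
      pathMeasure μ (firstHit h (p.1 + 1)) * pathMeasure μ {ω | walk p.2 ω = 1} := by
  simp_rw [← measure_inter_shift μ (dependsOn_firstHit h _) (measurableSet_walk_eq _ _)]
  refine (measure_mono fun ω (hω : walk (n + 1) ω = h) => ?_).trans
    (measure_biUnion_finset_le _ _)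
  classical
  have hex : ∃ k, walk (k + 1) ω = h := ⟨n, hω⟩
  have hle : Nat.find hex ≤ n := Nat.find_min' hex hω
  simp only [Set.mem_iUnion]
  refine ⟨(Nat.find hex, n - Nat.find hex), by simp; omega, ⟨Nat.find_spec hex, ?_⟩, ?_⟩
  · intro i hi hi'
    obtain ⟨i, rfl⟩ := Nat.exists_eq_add_of_le' hi
    exact Nat.find_min hex (by simpa using hi')
  · have h1 := walk_add (Nat.find hex + 1) (n - Nat.find hex) ω
    rw [Nat.find_spec hex, show Nat.find hex + 1 + (n - Nat.find hex) = n + 1 by omega, hω] at h1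
    exact (mul_eq_left.1 h1.symm)

/-- Last-exit decomposition. -/
lemma sum_lastExit_le (h : G) (n : ℕ) :
    ∑ p ∈ Finset.HasAntidiagonal.antidiagonal n, pathMeasure μ {ω | walk p.1 ω = 1} *
      pathMeasure μ (lastExit h p.2) ≤ pathMeasure μ {ω | walk n ω = h} := by
  simp_rw [← measure_inter_shift μ (dependsOn_walk_eq _ _)
    (measurableSet_of_dependsOn (dependsOn_lastExit h _))]
  rw [← measure_biUnion_finset]
  · refine measure_mono fun ω hω => ?_
    simp only [Set.mem_iUnion] at hω
    obtain ⟨⟨j, k⟩, hjk, h1, h2, -⟩ := hω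
    rw [Finset.HasAntidiagonal.mem_antidiagonal] at hjk
    subst hjk
    have h1 : walk j ω = 1 := h1
    have h2 : walk k (shift^[j] ω) = h := h2
    simp [walk_add, h1, h2]
  · -- two such times `j < j'` are incompatible: the walk is at the origin at time `j'`
    have key : ∀ p ∈ Finset.HasAntidiagonal.antidiagonal n,
        ∀ q ∈ Finset.HasAntidiagonal.antidiagonal n, p.1 < q.1 →
        Disjoint ({ω : ℕ → G | walk p.1 ω = 1} ∩ shift^[p.1] ⁻¹' lastExit h p.2)
          ({ω | walk q.1 ω = 1} ∩ shift^[q.1] ⁻¹' lastExit h q.2) := by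
      intro p hp q hq hlt
      rw [Set.disjoint_left]
      rintro ω ⟨h1, -, h2⟩ ⟨h3, -⟩
      have h1 : walk p.1 ω = 1 := h1
      have h3 : walk q.1 ω = 1 := h3
      rw [Finset.HasAntidiagonal.mem_antidiagonal] at hp hq
      refine h2 (q.1 - p.1) (by omega) (by omega) ?_
      have := walk_add p.1 (q.1 - p.1) ω
      rwa [show p.1 + (q.1 - p.1) = q.1 by omega, h1, h3, one_mul, eq_comm] at this
    intro p hp q hq hpq
    rcases lt_trichotomy p.1 q.1 with hlt | heq | hlt
    · exact key p hp q hq hlt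
    · refine absurd (Prod.ext heq ?_) hpq
      simp only [Finset.mem_coe, Finset.HasAntidiagonal.mem_antidiagonal] at hp hq
      omega
    · exact (key q hq p hp hlt).symm
  · rintro ⟨j, k⟩ -
    exact (measurableSet_walk_eq _ _).inter (measurable_shift.iterate j
      (measurableSet_of_dependsOn (dependsOn_lastExit h _)))

lemma tsum_firstHit (h : G) :
    ∑' n, pathMeasure μ (firstHit h (n + 1)) = pathMeasure μ {ω | ∃ n ≥ 1, walk n ω = h} := by
  rw [← measure_iUnion]
  · congr 1
    ext ω
    simp only [Set.mem_iUnion, Set.mem_ofPred_eq]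
    constructor
    · rintro ⟨n, hn, -⟩
      exact ⟨n + 1, by omega, hn⟩
    · rintro ⟨n, hn, e⟩
      classical
      obtain ⟨n, rfl⟩ := Nat.exists_eq_add_of_le' hn
      have hex : ∃ k, walk (k + 1) ω = h := ⟨n, e⟩
      refine ⟨Nat.find hex, Nat.find_spec hex, fun i hi hi' => ?_⟩
      obtain ⟨i, rfl⟩ := Nat.exists_eq_add_of_le' hi
      exact Nat.find_min hex (by simpa using hi')
  · have key : ∀ m n, m < n →
        Disjoint (firstHit h (m + 1) : Set (ℕ → G)) (firstHit h (n + 1)) := by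
      intro m n hmn
      rw [Set.disjoint_left]
      rintro ω ⟨h1, -⟩ ⟨-, h2⟩
      exact h2 (m + 1) (by omega) (by omega) h1
    intro m n hmn
    rcases lt_or_gt_of_ne hmn with hlt | hlt
    · exact key m n hlt
    · exact (key n m hlt).symm
  · exact fun n => measurableSet_of_dependsOn (dependsOn_firstHit h _)

/-- The Green function of a walk that is not recurrent is finite. -/
lemma tsum_return_ne_top (hrec : ¬ Recurrent μ) :
    ∑' n, pathMeasure μ {ω | walk n ω = 1} ≠ ∞ := by
  set p : ℕ → ℝ≥0∞ := fun n => pathMeasure μ {ω | walk n ω = 1}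
  set f := pathMeasure μ {ω | ∃ n ≥ 1, walk n ω = 1}
  have hf : f < 1 := lt_of_le_of_ne prob_le_one hrec
  have hfin : ∀ N, ∑ n ∈ Finset.range N, p n ≠ ∞ := fun N =>
    ENNReal.sum_ne_top.2 fun n _ => measure_ne_top _ _
  have hN : ∀ N, ∑ n ∈ Finset.range N, p n ≤ 1 + f * ∑ n ∈ Finset.range N, p n := by
    intro N
    rcases N with _ | N
    · simp
    have h0 : p 0 ≤ 1 := prob_le_one
    have hs := Finset.sum_range_succ' p N
    rw [add_comm _ (p 0)] at hs
    nth_rewrite 1 [hs]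
    refine add_le_add h0 ?_
    set q : ℕ → ℝ≥0∞ := fun n => if n < N + 1 then p n else 0
    have hq : ∑' n, q n = ∑ n ∈ Finset.range (N + 1), p n := by
      rw [tsum_eq_sum (s := Finset.range (N + 1))]
      · exact Finset.sum_congr rfl fun n hn => if_pos (Finset.mem_range.1 hn)
      · exact fun n hn => if_neg fun h => hn (Finset.mem_range.2 h)
    rw [← hq]
    simp only [f]
    rw [← tsum_firstHit, ← tsum_sum_antidiagonal (fun n => pathMeasure μ (firstHit 1 (n + 1)))]
    refine le_trans ?_ (ENNReal.sum_le_tsum (Finset.range N))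
    refine Finset.sum_le_sum fun n hn => (measure_walk_succ_le 1 n).trans ?_
    refine Finset.sum_le_sum fun r hr => ?_
    have h2 : r.2 < N + 1 := by
      have := Finset.HasAntidiagonal.mem_antidiagonal.1 hr
      have := Finset.mem_range.1 hn
      omega
    simp only [q, if_pos h2]
    exact le_rfl
  have hbound : ∀ N, ∑ n ∈ Finset.range N, p n ≤ (1 - f)⁻¹ := by
    intro N
    have h1 : (1 - f) * ∑ n ∈ Finset.range N, p n ≤ 1 := by
      rw [ENNReal.sub_mul (fun _ _ => hfin N), one_mul, tsub_le_iff_right]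
      exact hN N
    have h0 : 1 - f ≠ 0 := (tsub_pos_of_lt hf).ne'
    rw [ENNReal.le_inv_iff_mul_le, mul_comm]
    exact h1
  refine ne_top_of_le_ne_top (b := (1 - f)⁻¹) ?_ ?_
  · exact ENNReal.inv_ne_top.2 (tsub_pos_of_lt hf).ne'
  · exact ENNReal.tsum_le_of_sum_range_le hbound

/-- Last exits from the origin are controlled by first entrances, by comparing the two
decompositions of the Green function. -/
lemma tsum_lastExit_le (hrec : ¬ Recurrent μ) {h : G} (hh : h ≠ 1) :
    ∑' n, pathMeasure μ (lastExit h n) ≤ pathMeasure μ {ω | ∃ n ≥ 1, walk n ω = h} := by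
  set g := ∑' n, pathMeasure μ {ω | walk n ω = 1}
  have hg : g ≠ ∞ := tsum_return_ne_top hrec
  have hg0 : g ≠ 0 := by
    have : pathMeasure μ {ω : ℕ → G | walk 0 ω = 1} ≤ g := ENNReal.le_tsum 0
    intro h0
    rw [h0] at this
    simp [walk_zero] at this
  have h1 : g * ∑' n, pathMeasure μ (lastExit h n) ≤ ∑' n, pathMeasure μ {ω | walk n ω = h} := by
    simp only [g]
    rw [← tsum_sum_antidiagonal]
    exact ENNReal.tsum_le_tsum fun n => sum_lastExit_le h n
  have h2 : ∑' n, pathMeasure μ {ω | walk n ω = h} ≤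
      pathMeasure μ {ω | ∃ n ≥ 1, walk n ω = h} * g := by
    rw [tsum_eq_zero_add' ENNReal.summable]
    have : pathMeasure μ {ω : ℕ → G | walk 0 ω = h} = 0 := by
      simp [walk_zero, hh.symm]
    rw [this, zero_add, ← tsum_firstHit, ← tsum_sum_antidiagonal]
    exact ENNReal.tsum_le_tsum fun n => measure_walk_succ_le h n
  have h3 := h1.trans h2
  rw [mul_comm g] at h3
  exact (ENNReal.mul_le_mul_iff_left hg0 hg).1 h3

/-- The probability that `S_k * g` has been visited before time `k` is at most the probability that
`g⁻¹` is ever hit. -/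
lemma measure_mem_past_le (hrec : ¬ Recurrent μ) {g : G} (hg : g ≠ 1) (k : ℕ) :
    pathMeasure μ {ω | ∃ j < k, walk j ω = walk k ω * g} ≤
      pathMeasure μ {ω | ∃ n ≥ 1, walk n ω = g⁻¹} := by
  refine le_trans ?_ (tsum_lastExit_le hrec (inv_ne_one.2 hg))
  calc pathMeasure μ {ω | ∃ j < k, walk j ω = walk k ω * g}
      ≤ ∑ j ∈ Finset.range k, pathMeasure μ (shift^[j] ⁻¹' lastExit g⁻¹ (k - j)) := by
        refine (measure_mono fun ω hω => ?_).trans (measure_biUnion_finset_le _ _)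
        simp only [Set.mem_iUnion]
        classical
        have hω : ∃ j < k, walk j ω = walk k ω * g := hω
        obtain ⟨j₀, hj₀, e₀⟩ := hω
        -- the last such time
        set j := Nat.findGreatest (fun j => walk j ω = walk k ω * g) (k - 1)
        have hj : walk j ω = walk k ω * g :=
          Nat.findGreatest_spec (P := fun j => walk j ω = walk k ω * g) (by omega : j₀ ≤ k - 1) e₀
        have hjk : j < k := by
          have : j ≤ k - 1 := Nat.findGreatest_le _
          omega
        have hmax : ∀ i, j < i → i ≤ k → walk i ω ≠ walk j ω := by
          intro i hi hik e
          rcases hik.eq_or_lt with rfl | hik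
          · rw [e] at hj
            exact hg (mul_eq_left.1 hj.symm)
          · exact Nat.findGreatest_is_greatest (P := fun j => walk j ω = walk k ω * g) hi
              (by omega) (e.trans hj)
        refine ⟨j, Finset.mem_range.2 hjk, ?_, ?_⟩
        · have := walk_add j (k - j) ω
          rw [show j + (k - j) = k by omega, hj, mul_assoc] at this
          exact (eq_inv_of_mul_eq_one_right (mul_eq_left.1 this.symm))
        · intro i hi hik e
          refine hmax (j + i) (by omega) (by omega) ?_
          rw [walk_add, e, mul_one]
    _ = ∑ j ∈ Finset.range k, pathMeasure μ (lastExit g⁻¹ (k - j)) := by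
        refine Finset.sum_congr rfl fun j _ => ?_
        exact (measurePreserving_shift_iterate μ j).measure_preimage
          (measurableSet_of_dependsOn (dependsOn_lastExit _ _)).nullMeasurableSet
    _ = ∑ j ∈ Finset.range k, pathMeasure μ (lastExit g⁻¹ (j + 1)) := by
        rw [← Finset.sum_range_reflect]
        refine Finset.sum_congr rfl fun j hj => ?_
        have := Finset.mem_range.1 hj
        rw [show k - (k - 1 - j) = j + 1 by omega]
    _ ≤ ∑' n, pathMeasure μ (lastExit g⁻¹ (n + 1)) := ENNReal.sum_le_tsum _
    _ ≤ _ := by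
        rw [tsum_eq_zero_add' (f := fun n => pathMeasure μ (lastExit g⁻¹ n)) ENNReal.summable]
        exact le_add_self

end Visits

/-! ### Transient walks with an almost surely visited point -/

section Generator

variable {G : Type*} [Group G] [Countable G] [MeasurableSpace G] [DiscreteMeasurableSpace G]
  {μ : Measure G} [IsProbabilityMeasure μ]

/-- The first almost surely visited point other than the origin that the walk meets precedes all
others. -/
lemma exists_first_surelyVisited {x : G} (hx : x ∈ surelyVisited μ) (hx1 : x ≠ 1) :
    ∃ z ∈ surelyVisited μ, z ≠ 1 ∧ ∀ v ∈ surelyVisited μ, v ≠ 1 → z⁻¹ * v ∈ surelyVisited μ := by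
  set K := surelyVisited μ
  let B : ℕ → G → Set (ℕ → G) := fun m z =>
    {ω | walk m ω = z ∧ ∀ j < m, ¬(walk j ω ∈ K ∧ walk j ω ≠ 1)}
  have hB : ∀ m z, DependsOn (fun ω => ω ∈ B m z) (Set.Iio m) := fun m z ω ω' hω => by
    simp only [B, Set.mem_ofPred_eq]
    rw [dependsOn_walk le_rfl hω]
    refine congrArg _ (forall_congr fun j => forall_congr fun hj => ?_)
    rw [dependsOn_walk hj.le hω]
  obtain ⟨m, z, hzK, hz1, hmz⟩ : ∃ m, ∃ z ∈ K, z ≠ 1 ∧ pathMeasure μ (B m z) ≠ 0 := by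
    by_contra hcon
    push Not at hcon
    have h1 : ∀ᵐ ω ∂(pathMeasure μ), ∀ m, ∀ z, z ∈ K → z ≠ 1 → ω ∉ B m z := by
      refine ae_all_iff.2 fun m => ae_all_iff.2 fun z => ?_
      by_cases hz : z ∈ K ∧ z ≠ 1
      · filter_upwards [measure_eq_zero_iff_ae_notMem.1 (hcon m z hz.1 hz.2)] with ω hω _ _
          using hω
      · exact ae_of_all _ fun ω h1 h2 => absurd ⟨h1, h2⟩ hz
    obtain ⟨ω, h2, h3⟩ := (h1.and hx).exists
    classical
    obtain ⟨n, hn⟩ := mem_totalRange.1 h3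
    have hex : ∃ n, walk n ω ∈ K ∧ walk n ω ≠ 1 := ⟨n, hn ▸ hx, hn ▸ hx1⟩
    exact h2 (Nat.find hex) _ (Nat.find_spec hex).1 (Nat.find_spec hex).2
      ⟨rfl, fun j hj => Nat.find_min hex hj⟩
  refine ⟨z, hzK, hz1, fun v hv hv1 => inv_mul_mem_surelyVisited (hB m z) hmz (fun ω h => h.1) ?_⟩
  filter_upwards [hv] with ω hω hmem
  obtain ⟨n, hn⟩ := mem_totalRange.1 hω
  refine ⟨n, ?_, hn⟩
  by_contra hlt
  exact hmem.2 n (not_le.1 hlt) ⟨hn ▸ hv, hn ▸ hv1⟩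

/-- For a walk that is not recurrent, the almost surely visited points are powers of `z`, if
left division by `z` maps those other than `1` to such points: otherwise `v`, `z⁻¹ v`,
`z⁻² v`, … are all almost surely visited, so that all the powers of `z` are visited before `v`. -/
lemma surelyVisited_eq_powers (hrec : ¬ Recurrent μ) {z : G} (hz : z ∈ surelyVisited μ)
    (hz1 : z ≠ 1) (hmin : ∀ v ∈ surelyVisited μ, v ≠ 1 → z⁻¹ * v ∈ surelyVisited μ) {v : G}
    (hv : v ∈ surelyVisited μ) : ∃ n : ℕ, v = z ^ n := by
  have hanti : ∀ u, u ∈ surelyVisited μ → u⁻¹ ∈ surelyVisited μ → u = 1 := fun u h1 h2 => by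
    by_contra h
    exact hrec (recurrent_of_mem_of_inv_mem h h1 h2)
  by_contra hne
  push Not at hne
  have hmem : ∀ n : ℕ, (z ^ n)⁻¹ * v ∈ surelyVisited μ := by
    intro n
    induction n with
    | zero => simpa using hv
    | succ n ih =>
      have := hmin _ ih fun h => hne n (inv_mul_eq_one.1 h).symm
      rwa [← mul_assoc, ← mul_inv_rev, ← pow_succ] at this
  -- every power of `z` is visited before `v`
  have hbefore : ∀ᵐ ω ∂(pathMeasure μ), ∀ n : ℕ, ∀ m, walk m ω = v → ∃ j < m, walk j ω = z ^ n := by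
    refine ae_all_iff.2 fun n => ae_all_iff.2 fun m => ?_
    let B : Set (ℕ → G) := {ω | walk m ω = v ∧ ∀ j < m, walk j ω ≠ z ^ n}
    have hB : DependsOn (fun ω => ω ∈ B) (Set.Iio m) := fun ω ω' hω => by
      simp only [B, Set.mem_ofPred_eq]
      rw [dependsOn_walk le_rfl hω]
      refine congrArg _ (forall_congr fun j => forall_congr fun hj => ?_)
      rw [dependsOn_walk hj.le hω]
    have hB0 : pathMeasure μ B = 0 := by
      by_contra hB0
      have h1 : v⁻¹ * z ^ n ∈ surelyVisited μ := by
        refine inv_mul_mem_surelyVisited hB hB0 (fun ω h => h.1) ?_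
        filter_upwards [pow_mem_surelyVisited hz n] with ω hω hωB
        obtain ⟨k, hk⟩ := mem_totalRange.1 hω
        exact ⟨k, not_lt.1 fun hlt => hωB.2 k hlt hk, hk⟩
      have h2 := hanti _ (hmem n) (by rwa [mul_inv_rev, inv_inv])
      exact hne n (inv_mul_eq_one.1 h2).symm
    filter_upwards [measure_eq_zero_iff_ae_notMem.1 hB0] with ω hω hv'
    by_contra hcon
    push Not at hcon
    exact hω ⟨hv', hcon⟩
  have hinj : Function.Injective fun n : ℕ => z ^ n := by
    rw [injective_pow_iff_not_isOfFinOrder]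
    intro hfin
    obtain ⟨n, hn, h1⟩ := isOfFinOrder_iff_pow_eq_one.1 hfin
    refine hz1 (hanti z hz ?_)
    have : z⁻¹ = z ^ (n - 1) := by
      rw [inv_eq_iff_mul_eq_one, ← pow_succ', Nat.sub_add_cancel hn, h1]
    rw [this]
    exact pow_mem_surelyVisited hz _
  obtain ⟨ω, h1, h2⟩ := (hbefore.and hv).exists
  obtain ⟨m, hm⟩ := mem_totalRange.1 h2
  have hsub : Set.range (fun n : ℕ => z ^ n) ⊆ (fun j => walk j ω) '' (Set.Iio m) := by
    rintro _ ⟨n, rfl⟩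
    obtain ⟨j, hj, e⟩ := h1 n m hm
    exact ⟨j, hj, e⟩
  exact Set.infinite_range_of_injective hinj (((Set.finite_Iio m).image _).subset hsub)

/-- If a walk that is not recurrent almost surely hits some point, then the step distribution is
carried by `{a⁻¹, 1, a, a², …}` for an element `a` of infinite order, all of whose negative powers
are almost surely visited. -/
lemma exists_generator (hrec : ¬ Recurrent μ) {x : G} (hx : HitAlmostSurely μ x) :
    ∃ a : G, Function.Injective (fun i : ℤ => a ^ i) ∧
      (∀ g : G, μ {g} ≠ 0 → ∃ i : ℤ, -1 ≤ i ∧ g = a ^ i) ∧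
      ∀ n : ℕ, a ^ (-(n : ℤ)) ∈ surelyVisited μ := by
  have hx1 : x ≠ 1 := by rintro rfl; exact hrec hx
  obtain ⟨z, hz, hz1, hmin⟩ :=
    exists_first_surelyVisited ((mem_surelyVisited_iff_of_ne_one hx1).2 hx) hx1
  have hpow := fun v hv => surelyVisited_eq_powers hrec hz hz1 hmin (v := v) hv
  refine ⟨z⁻¹, ?_, fun g hg => ?_, fun n => by simpa using pow_mem_surelyVisited hz n⟩
  · rw [injective_zpow_iff_not_isOfFinOrder, isOfFinOrder_inv_iff]
    intro hfin
    obtain ⟨n, hn, h1⟩ := isOfFinOrder_iff_pow_eq_one.1 hfin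
    refine hrec (recurrent_of_mem_of_inv_mem hz1 hz ?_)
    have : z⁻¹ = z ^ (n - 1) := by
      rw [inv_eq_iff_mul_eq_one, ← pow_succ', Nat.sub_add_cancel hn, h1]
    rw [this]
    exact pow_mem_surelyVisited hz _
  · have h1 : g⁻¹ * z ∈ surelyVisited μ := by
      refine inv_mul_mem_surelyVisited (dependsOn_walk_eq 1 g) (by rwa [measure_walk_one])
        (fun ω h => h) ?_
      filter_upwards [hitAlmostSurely_iff.1 ((mem_surelyVisited_iff_of_ne_one hz1).1 hz)]
        with ω hω _ using hω
    obtain ⟨n, hn⟩ := hpow _ h1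
    refine ⟨n - 1, by omega, ?_⟩
    rw [inv_mul_eq_iff_eq_mul, eq_comm, ← eq_mul_inv_iff_mul_eq] at hn
    rw [hn, inv_zpow', neg_sub, zpow_sub, zpow_one, zpow_natCast]

end Generator

/-! ### Walks on an infinite cyclic group -/

lemma integrable_iff_summable_of_countable {X : Type*} [Countable X] [MeasurableSpace X]
    [DiscreteMeasurableSpace X] {μ : Measure X} [IsFiniteMeasure μ] {f : X → ℝ} :
    Integrable f μ ↔ Summable fun x => μ.real {x} * f x := by
  have h1 : ∀ x, ‖f x‖ₑ * μ {x} = ((‖μ.real {x} * f x‖₊ : NNReal) : ℝ≥0∞) := by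
    intro x
    rw [nnnorm_mul, ENNReal.coe_mul, mul_comm, ← enorm_eq_nnnorm, ← enorm_eq_nnnorm,
      Real.enorm_of_nonneg measureReal_nonneg, ofReal_measureReal]
  rw [Integrable, HasFiniteIntegral, lintegral_countable', lt_top_iff_ne_top]
  simp_rw [h1]
  rw [ENNReal.tsum_coe_ne_top_iff_summable,
    and_iff_right (measurable_of_countable f).aestronglyMeasurable]
  rw [← NNReal.summable_coe]
  exact summable_norm_iff

section StrongLaw

variable {G : Type*} [Countable G] [MeasurableSpace G] [DiscreteMeasurableSpace G]
  {μ : Measure G} [IsProbabilityMeasure μ]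

/-- The strong law of large numbers for functions of the steps. -/
lemma ae_tendsto_average {f : G → ℝ} (hf : Integrable f μ) :
    ∀ᵐ ω ∂(pathMeasure μ),
      Tendsto (fun n : ℕ => (∑ i ∈ Finset.range n, f (ω i)) / n) atTop (𝓝 (∫ g, f g ∂μ)) := by
  have hfm : Measurable f := measurable_of_countable f
  have hmean : ∫ g, f g ∂μ = ∫ ω : ℕ → G, f (ω 0) ∂(pathMeasure μ) := by
    conv_lhs => rw [← pathMeasure_map_eval μ 0]
    rw [integral_map (measurable_pi_apply 0).aemeasurable hfm.aestronglyMeasurable]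
  rw [hmean]
  have hmp : ∀ i, MeasurePreserving (fun ω : ℕ → G => ω i) (pathMeasure μ) μ := fun i =>
    ⟨measurable_pi_apply i, pathMeasure_map_eval μ i⟩
  refine strong_law_ae_real (fun i (ω : ℕ → G) => f (ω i)) ?_ ?_ ?_
  · exact (hmp 0).integrable_comp_of_integrable hf
  · intro i j hij
    have h : iIndepFun (fun i (ω : ℕ → G) => ω i) (pathMeasure μ) :=
      iIndepFun_infinitePi (P := fun _ : ℕ => μ) (X := fun x ω => ω) (by fun_prop)
    exact (h.indepFun hij).comp hfm hfm
  · intro i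
    refine ⟨(hfm.comp (measurable_pi_apply i)).aemeasurable,
      (hfm.comp (measurable_pi_apply 0)).aemeasurable, ?_⟩
    have := Measure.map_map (μ := pathMeasure μ) hfm (measurable_pi_apply (X := fun _ => G) i)
    have h0 := Measure.map_map (μ := pathMeasure μ) hfm (measurable_pi_apply (X := fun _ => G) 0)
    exact this.symm.trans ((congrArg _ ((hmp i).map_eq.trans (hmp 0).map_eq.symm)).trans h0)

lemma ae_tendsto_sum_atTop {f : G → ℝ} (hf : Integrable f μ) (hpos : 0 < ∫ g, f g ∂μ) :
    ∀ᵐ ω ∂(pathMeasure μ), Tendsto (fun n : ℕ => ∑ i ∈ Finset.range n, f (ω i)) atTop atTop := by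
  filter_upwards [ae_tendsto_average hf] with ω hω
  have h := hω.pos_mul_atTop hpos tendsto_natCast_atTop_atTop
  refine h.congr' ?_
  filter_upwards [eventually_gt_atTop 0] with n hn
  field_simp

omit [DiscreteMeasurableSpace G] in
lemma ae_forall_step_ne_zero :
    ∀ᵐ ω ∂(pathMeasure μ), ∀ i, μ {ω i} ≠ 0 := by
  refine ae_all_iff.2 fun i => ?_
  have h := (isDiscrete_of_countable μ).ae_ne_zero
  nth_rewrite 2 [← pathMeasure_map_eval μ i] at h
  exact ae_of_ae_map (measurable_pi_apply i).aemeasurable h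

end StrongLaw

section Cyclic

variable {G : Type*} [Group G] [Countable G] [MeasurableSpace G] [DiscreteMeasurableSpace G]
  {μ : Measure G} [IsProbabilityMeasure μ] {a : G} {e : G → ℤ}

omit [Countable G] [MeasurableSpace G] [DiscreteMeasurableSpace G] in
lemma exponent_zpow (he : ∀ g, a ^ e g = g) (hinj : Function.Injective fun i : ℤ => a ^ i)
    (i : ℤ) : e (a ^ i) = i := hinj (he _)

omit [Countable G] [MeasurableSpace G] [DiscreteMeasurableSpace G] in
lemma exponent_mul (he : ∀ g, a ^ e g = g) (hinj : Function.Injective fun i : ℤ => a ^ i)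
    (g h : G) : e (g * h) = e g + e h :=
  hinj (by simp only [zpow_add, he])

omit [Countable G] [MeasurableSpace G] [DiscreteMeasurableSpace G] in
lemma exponent_walk (he : ∀ g, a ^ e g = g) (hinj : Function.Injective fun i : ℤ => a ^ i)
    (n : ℕ) (ω : ℕ → G) : e (walk n ω) = ∑ i ∈ Finset.range n, e (ω i) := by
  induction n with
  | zero => simpa [walk_zero] using exponent_zpow he hinj 0
  | succ n ih => rw [walk_succ, exponent_mul he hinj, ih, Finset.sum_range_succ]

omit [Countable G] [DiscreteMeasurableSpace G] [IsProbabilityMeasure μ] in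
/-- An element whose powers carry the support of a generating step distribution generates. -/
lemma exists_exponent (hgen : Subgroup.closure {g : G | μ {g} ≠ 0} = ⊤)
    (hsupp : ∀ g : G, μ {g} ≠ 0 → ∃ i : ℤ, -1 ≤ i ∧ g = a ^ i) :
    ∃ e : G → ℤ, ∀ g, a ^ e g = g := by
  have h : ∀ g : G, ∃ i : ℤ, a ^ i = g := by
    intro g
    have hg : g ∈ Subgroup.closure {g : G | μ {g} ≠ 0} := hgen ▸ Subgroup.mem_top g
    have hle : Subgroup.closure {g : G | μ {g} ≠ 0} ≤ Subgroup.zpowers a := by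
      rw [Subgroup.closure_le]
      intro g hg
      obtain ⟨i, -, rfl⟩ := hsupp g hg
      exact ⟨i, rfl⟩
    exact hle hg
  exact ⟨fun g => (h g).choose, fun g => (h g).choose_spec⟩

/-- The mean displacement in the form of the series over the exponents `i ≥ -1` and in the form of
an integral. -/
lemma summable_iff_integrable_exponent (he : ∀ g, a ^ e g = g)
    (hinj : Function.Injective fun i : ℤ => a ^ i) (hsupp : ∀ g : G, μ {g} ≠ 0 → -1 ≤ e g) :
    (Summable (fun i : {i : ℤ // -1 ≤ i} => ((i : ℤ) : ℝ) * μ.real {a ^ (i : ℤ)}) ↔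
      Integrable (fun g => (e g : ℝ)) μ) ∧
    (Integrable (fun g => (e g : ℝ)) μ →
      ∑' i : {i : ℤ // -1 ≤ i}, ((i : ℤ) : ℝ) * μ.real {a ^ (i : ℤ)} = ∫ g, (e g : ℝ) ∂μ) := by
  set φ : {i : ℤ // -1 ≤ i} → G := fun i => a ^ (i : ℤ)
  have hφ : Function.Injective φ := fun i j h => Subtype.ext (hinj h)
  have hcomp : (fun i : {i : ℤ // -1 ≤ i} => ((i : ℤ) : ℝ) * μ.real {a ^ (i : ℤ)}) =
      (fun g => μ.real {g} * (e g : ℝ)) ∘ φ := by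
    ext i
    simp only [Function.comp_apply, φ]
    rw [exponent_zpow he hinj, mul_comm]
  have hzero : ∀ g, g ∉ Set.range φ → μ.real {g} * (e g : ℝ) = 0 := by
    intro g hg
    have : μ {g} = 0 := by
      by_contra h0
      exact hg ⟨⟨e g, hsupp g h0⟩, he g⟩
    simp [Measure.real, this]
  refine ⟨?_, fun hint => ?_⟩
  · rw [integrable_iff_summable_of_countable, hcomp, hφ.summable_iff hzero]
  · rw [hcomp, integral_countable hint]
    simp only [smul_eq_mul]
    exact hφ.tsum_eq fun g hg => by
      by_contra h
      exact hg (hzero g h)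

/-- If some function below the exponent has positive mean then the walk drifts to `+∞`, so that it
cannot visit all negative powers. -/
lemma integral_nonpos_of_surelyVisited (he : ∀ g, a ^ e g = g)
    (hinj : Function.Injective fun i : ℤ => a ^ i)
    (hneg : ∀ n : ℕ, a ^ (-(n : ℤ)) ∈ surelyVisited μ) {f : G → ℝ} (hf : Integrable f μ)
    (hle : ∀ g, f g ≤ e g) : ∫ g, f g ∂μ ≤ 0 := by
  by_contra! hpos
  obtain ⟨ω, h1, h2⟩ := ((ae_tendsto_sum_atTop hf hpos).and (ae_all_iff.2 hneg)).exists
  have h3 : Tendsto (fun n => (e (walk n ω) : ℝ)) atTop atTop := by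
    refine tendsto_atTop_mono (fun n => ?_) h1
    rw [exponent_walk he hinj]
    push_cast
    exact Finset.sum_le_sum fun i _ => hle _
  obtain ⟨N, hN⟩ := (h3.eventually_ge_atTop 0).exists_forall_of_atTop
  -- the exponents up to time `N` are bounded below
  obtain ⟨b, hb⟩ : ∃ b : ℤ, ∀ n < N, b ≤ e (walk n ω) := by
    obtain ⟨b, hb⟩ := ((Set.finite_Iio N).image fun n => e (walk n ω)).bddBelow
    exact ⟨b, fun n hn => hb ⟨n, hn, rfl⟩⟩
  obtain ⟨k, hk⟩ := mem_totalRange.1 (h2 (b.natAbs + 1))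
  have hek : e (walk k ω) = -((b.natAbs + 1 : ℕ) : ℤ) := by rw [hk, exponent_zpow he hinj]
  rcases lt_or_ge k N with hkN | hkN
  · have := hb k hkN
    omega
  · have := hN k hkN
    have : (0 : ℤ) ≤ e (walk k ω) := by exact_mod_cast this
    omega

/-- If all negative powers of `a` are almost surely visited, the mean displacement is finite: each
truncation of the steps makes the mean nonpositive, and the steps are bounded below. -/
lemma integrable_exponent (he : ∀ g, a ^ e g = g)
    (hinj : Function.Injective fun i : ℤ => a ^ i) (hsupp : ∀ g : G, μ {g} ≠ 0 → -1 ≤ e g)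
    (hneg : ∀ n : ℕ, a ^ (-(n : ℤ)) ∈ surelyVisited μ) : Integrable (fun g => (e g : ℝ)) μ := by
  have hae : ∀ᵐ g ∂μ, -1 ≤ e g :=
    (isDiscrete_of_countable μ).ae_ne_zero.mono fun g hg => hsupp g hg
  have hmeas : ∀ f : G → ℝ≥0∞, Measurable f := fun f => measurable_of_countable f
  -- truncating the exponent at level `M` gives integrable functions of nonpositive mean
  have hM : ∀ M : ℕ, ∫⁻ g, ENNReal.ofReal (min (e g : ℝ) M + 1) ∂μ ≤ 1 := by
    intro M
    have hbound : ∀ᵐ g ∂μ, ‖min (e g : ℝ) M‖ ≤ M + 1 := by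
      filter_upwards [hae] with g hg
      have h1 : (-1 : ℝ) ≤ e g := by exact_mod_cast hg
      rw [Real.norm_eq_abs, abs_le]
      have hM0 : (0 : ℝ) ≤ M := Nat.cast_nonneg M
      exact ⟨le_min (by linarith) (by linarith), (min_le_right _ _).trans (by linarith)⟩
    have hint : Integrable (fun g => min (e g : ℝ) M) μ :=
      Integrable.of_bound (measurable_of_countable _).aestronglyMeasurable _ hbound
    have h0 := integral_nonpos_of_surelyVisited he hinj hneg hint fun g => min_le_left _ _
    rw [← ofReal_integral_eq_lintegral_ofReal (f := fun g => min (e g : ℝ) M + 1)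
      (hint.add (integrable_const 1))]
    · rw [← ENNReal.ofReal_one]
      refine ENNReal.ofReal_le_ofReal ?_
      rw [integral_add hint (integrable_const 1)]
      simpa using h0
    · filter_upwards [hae] with g hg
      have h1 : (-1 : ℝ) ≤ e g := by exact_mod_cast hg
      have hM0 : (0 : ℝ) ≤ M := Nat.cast_nonneg M
      have : -1 ≤ min (e g : ℝ) M := le_min h1 (by linarith)
      simp only [Pi.zero_apply]
      linarith
  have hsup : ∫⁻ g, ENNReal.ofReal ((e g : ℝ) + 1) ∂μ ≤ 1 := by
    have hmono : Monotone fun (M : ℕ) (g : G) => ENNReal.ofReal (min (e g : ℝ) M + 1) := by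
      intro M N hMN g
      refine ENNReal.ofReal_le_ofReal ?_
      have : (M : ℝ) ≤ N := by exact_mod_cast hMN
      have := min_le_min (le_refl (e g : ℝ)) this
      linarith
    have h1 := lintegral_iSup (μ := μ) (fun M => hmeas _) hmono
    calc ∫⁻ g, ENNReal.ofReal ((e g : ℝ) + 1) ∂μ
        ≤ ∫⁻ g, ⨆ M : ℕ, ENNReal.ofReal (min (e g : ℝ) M + 1) ∂μ := by
          refine lintegral_mono fun g => ?_
          obtain ⟨M, hM⟩ := exists_nat_ge (e g : ℝ)
          refine le_iSup_of_le M ?_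
          rw [min_eq_left hM]
      _ ≤ 1 := by rw [h1]; exact iSup_le hM
  have hint : Integrable (fun g => (e g : ℝ) + 1) μ := by
    refine ⟨(measurable_of_countable _).aestronglyMeasurable, ?_⟩
    rw [hasFiniteIntegral_iff_ofReal]
    · exact hsup.trans_lt ENNReal.one_lt_top
    · filter_upwards [hae] with g hg
      have h1 : (-1 : ℝ) ≤ e g := by exact_mod_cast hg
      simp only [Pi.zero_apply]
      linarith
  exact (hint.sub (integrable_const 1)).congr (ae_of_all _ fun g => by simp)

/-- A walk on `ℤ` with `S_n / n → 0` is recurrent: otherwise its range would grow linearly. -/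
lemma recurrent_of_ae_tendsto_zero (he : ∀ g, a ^ e g = g)
    (h0 : ∀ᵐ ω ∂(pathMeasure μ), Tendsto (fun n : ℕ => (e (walk n ω) : ℝ) / n) atTop (𝓝 0)) :
    Recurrent μ := by
  set P := pathMeasure μ
  set F : ℕ → (ℕ → G) → ℝ := fun n ω => (range n ω).ncard / (n + 1)
  have hFbound : ∀ n ω, F n ω ≤ 1 := fun n ω => by
    rw [div_le_one (by positivity)]
    exact_mod_cast ncard_range_le n ω
  have hF0 : ∀ n ω, 0 ≤ F n ω := fun n ω => by positivity
  have hFmeas : ∀ n, Measurable (F n) := fun n =>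
    measurable_of_dependsOn (Set.finite_Iio n) fun ω ω' hω => by
      simp only [F]; rw [dependsOn_range le_rfl hω]
  have hFlim : ∀ᵐ ω ∂P, Tendsto (fun n => F n ω) atTop (𝓝 0) := by
    filter_upwards [h0] with ω hω
    rw [Metric.tendsto_atTop]
    intro ε hε
    rw [Metric.tendsto_atTop] at hω
    obtain ⟨N₀, hN₀⟩ := hω (ε / 8) (by positivity)
    set N := N₀ + 1
    -- all exponents up to time `n` are at most `C + n ε / 8` in absolute value
    obtain ⟨C, hC⟩ : ∃ C : ℝ, ∀ n < N, |(e (walk n ω) : ℝ)| ≤ C := by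
      obtain ⟨C, hC⟩ := ((Set.finite_Iio N).image fun n => |(e (walk n ω) : ℝ)|).bddAbove
      exact ⟨C, fun n hn => hC ⟨n, hn, rfl⟩⟩
    obtain ⟨M, hM⟩ := exists_nat_gt (8 * (|C| + 1) / ε)
    refine ⟨M, fun n hn => ?_⟩
    have hnM : 8 * (|C| + 1) / ε < n := hM.trans_le (by exact_mod_cast hn)
    have hnC : |C| + 1 < n * ε / 8 := by
      rw [div_lt_iff₀ hε] at hnM; linarith
    have hbd : ∀ k ≤ n, |(e (walk k ω) : ℝ)| ≤ n * ε / 8 + |C| := by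
      intro k hk
      rcases lt_or_ge k N with hkN | hkN
      · have := (hC k hkN).trans (le_abs_self C)
        have : 0 ≤ n * ε / 8 := by positivity
        linarith
      · have hk0 : 0 < k := by omega
        have h1 := hN₀ k (by omega)
        rw [Real.dist_eq, sub_zero, abs_div, Nat.abs_cast, div_lt_iff₀ (by exact_mod_cast hk0)]
          at h1
        have h2 : (k : ℝ) ≤ n := by exact_mod_cast hk
        have h3 : ε / 8 * k ≤ n * ε / 8 := by nlinarith
        have := abs_nonneg C
        linarith
    set m : ℕ := ⌈n * ε / 8 + |C|⌉₊
    have hsub : range n ω ⊆ (fun i : ℤ => a ^ i) '' (Finset.Icc (-(m : ℤ)) m : Set ℤ) := by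
      rintro g ⟨k, hk, rfl⟩
      refine ⟨e (walk k ω), ?_, he _⟩
      have h1 := (hbd k hk).trans (Nat.le_ceil _)
      rw [Finset.coe_Icc, Set.mem_Icc, ← abs_le]
      exact_mod_cast h1
    have hcard : (range n ω).ncard ≤ 2 * m + 1 := by
      refine (Set.ncard_le_ncard hsub ((Finset.finite_toSet _).image _)).trans ?_
      refine (Set.ncard_image_le (Finset.finite_toSet _)).trans ?_
      rw [Set.ncard_coe_finset, Int.card_Icc]
      omega
    have hcard' : ((range n ω).ncard : ℝ) ≤ 2 * m + 1 := by exact_mod_cast hcard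
    have hm : (m : ℝ) < n * ε / 8 + |C| + 1 := Nat.ceil_lt_add_one (by positivity)
    rw [Real.dist_eq, sub_zero, abs_of_nonneg (hF0 n ω)]
    simp only [F]
    rw [div_lt_iff₀ (by positivity)]
    have := abs_nonneg C
    nlinarith
  have hint : Tendsto (fun n => ∫ ω, F n ω ∂P) atTop (𝓝 0) := by
    have := tendsto_integral_of_dominated_convergence (μ := P) (fun _ => (1 : ℝ))
      (fun n => (hFmeas n).aestronglyMeasurable) (integrable_const 1)
      (fun n => ae_of_all _ fun ω => by
        rw [Real.norm_eq_abs, abs_of_nonneg (hF0 n ω)]; exact hFbound n ω) hFlim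
    simpa using this
  -- the times at which the current point is left forever inject into the range
  by_contra hrec
  set D : Set (ℕ → G) := {ω | ∀ n ≥ 1, walk n ω ≠ 1}
  have hD : MeasurableSet D := by
    have : D = ⋂ n, ⋂ (_ : n ≥ 1), {ω | walk n ω = 1}ᶜ := by ext; simp [D]
    rw [this]
    exact MeasurableSet.iInter fun n => MeasurableSet.iInter fun _ =>
      (measurableSet_walk_eq n 1).compl
  have hD0 : 0 < P.real D := by
    refine ENNReal.toReal_pos (fun h => ?_) (measure_ne_top _ _)
    refine hrec (hitAlmostSurely_iff.2 ?_)
    filter_upwards [measure_eq_zero_iff_ae_notMem.1 h] with ω hω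
    simpa [D] using hω
  have hlow : ∀ n, P.real D ≤ ∫ ω, F n ω ∂P := by
    intro n
    have h1 : ∀ ω, (∑ k ∈ Finset.range (n + 1), (shift^[k] ⁻¹' D).indicator (1 : (ℕ → G) → ℝ) ω) ≤
        (range n ω).ncard := by
      intro ω
      classical
      simp only [Set.indicator_apply, Pi.one_apply]
      rw [Finset.sum_ite, Finset.sum_const_zero, add_zero, Finset.sum_const, nsmul_eq_mul, mul_one]
      have hinjOn : Set.InjOn (fun k => walk k ω)
          ((Finset.range (n + 1)).filter fun k => ω ∈ shift^[k] ⁻¹' D : Set ℕ) := by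
        have key : ∀ j k, shift^[j] ω ∈ D → j < k → walk j ω ≠ walk k ω := by
          intro j k hj hjk heq
          obtain ⟨l, rfl⟩ := Nat.exists_eq_add_of_lt hjk
          refine hj (l + 1) (by omega) ?_
          rw [add_assoc, walk_add] at heq
          exact (mul_eq_left.1 heq.symm)
        intro j hj k hk heq
        simp only [Finset.coe_filter, Set.mem_ofPred_eq] at hj hk
        by_contra hne
        rcases lt_or_gt_of_ne hne with hlt | hlt
        · exact key j k hj.2 hlt heq
        · exact key k j hk.2 hlt heq.symm
      rw [← Set.ncard_coe_finset, ← hinjOn.ncard_image]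
      refine Nat.cast_le.2 (Set.ncard_le_ncard ?_ (finite_range n ω))
      rintro _ ⟨k, hk, rfl⟩
      simp only [Finset.coe_filter, Set.mem_ofPred_eq, Finset.mem_range] at hk
      exact walk_mem_range (by omega) ω
    have hint' : ∀ k, Integrable ((shift^[k] ⁻¹' D).indicator (1 : (ℕ → G) → ℝ)) P := fun k =>
      (integrable_const 1).indicator (measurable_shift.iterate k hD)
    have hFint : Integrable (F n) P := Integrable.of_bound (hFmeas n).aestronglyMeasurable 1
      (ae_of_all _ fun ω => by
        rw [Real.norm_eq_abs, abs_of_nonneg (hF0 n ω)]; exact hFbound n ω)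
    have h2 : ∫ ω, (∑ k ∈ Finset.range (n + 1),
        (shift^[k] ⁻¹' D).indicator (1 : (ℕ → G) → ℝ) ω) ∂P = (n + 1) * P.real D := by
      rw [integral_finsetSum _ fun k _ => hint' k]
      have : ∀ k ∈ Finset.range (n + 1),
          ∫ ω, (shift^[k] ⁻¹' D).indicator (1 : (ℕ → G) → ℝ) ω ∂P = P.real D := by
        intro k _
        rw [integral_indicator_one (measurable_shift.iterate k hD)]
        simp only [Measure.real]
        rw [(measurePreserving_shift_iterate μ k).measure_preimage hD.nullMeasurableSet]
      rw [Finset.sum_congr rfl this]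
      simp
    have h3 : (n + 1 : ℝ) * P.real D ≤ ∫ ω, (n + 1) * F n ω ∂P := by
      rw [← h2]
      refine integral_mono (integrable_finsetSum _ fun k _ => hint' k) (hFint.const_mul _)
        fun ω => ?_
      refine (h1 ω).trans_eq ?_
      simp only [F]
      field_simp
    rw [integral_const_mul] at h3
    exact le_of_mul_le_mul_left h3 (by positivity)
  exact absurd (ge_of_tendsto' hint hlow) (not_le.2 hD0)

/-- A walk that is not recurrent and almost surely hits some point escapes to `-∞` without left
jump. -/
theorem recurrent_or_escapes_of_hitAlmostSurely (hgen : Subgroup.closure {g : G | μ {g} ≠ 0} = ⊤)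
    {x : G} (hx : HitAlmostSurely μ x) : Recurrent μ ∨ EscapesWithoutLeftJump μ := by
  refine or_iff_not_imp_left.2 fun hrec => ?_
  obtain ⟨a, hinj, hsupp, hneg⟩ := exists_generator hrec hx
  obtain ⟨e, he⟩ := exists_exponent hgen hsupp
  have hsupp' : ∀ g : G, μ {g} ≠ 0 → -1 ≤ e g := fun g hg => by
    obtain ⟨i, hi, rfl⟩ := hsupp g hg
    rwa [exponent_zpow he hinj]
  have hint := integrable_exponent he hinj hsupp' hneg
  obtain ⟨h1, h2⟩ := summable_iff_integrable_exponent he hinj hsupp'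
  refine ⟨a, hsupp, h1.2 hint, ?_⟩
  rw [h2 hint]
  refine lt_of_le_of_ne (integral_nonpos_of_surelyVisited he hinj hneg hint fun g => le_rfl) ?_
  intro hzero
  refine hrec (recurrent_of_ae_tendsto_zero he ?_)
  filter_upwards [ae_tendsto_average hint] with ω hω
  rw [hzero] at hω
  refine hω.congr fun n => ?_
  rw [exponent_walk he hinj]
  push_cast
  rfl

/-- The points that are visited but not almost surely visited are finite in number, if the walk is
recurrent (there are none) or escapes to `-∞` without left jump (they are positive). -/
theorem ae_finite_diff_surelyVisited (hgen : Subgroup.closure {g : G | μ {g} ≠ 0} = ⊤)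
    (h : Recurrent μ ∨ EscapesWithoutLeftJump μ) :
    ∀ᵐ ω ∂(pathMeasure μ), (totalRange ω \ surelyVisited μ).Finite := by
  rcases h with h | ⟨a, hsupp, hsum, hneg⟩
  · rw [h.surelyVisited_eq_univ hgen]
    simp
  -- `a` has infinite order, as the series of the means converges
  have hinj : Function.Injective fun i : ℤ => a ^ i := by
    rw [injective_zpow_iff_not_isOfFinOrder]
    intro hfin
    obtain ⟨n, hn, h1⟩ := isOfFinOrder_iff_pow_eq_one.1 hfin
    obtain ⟨g, hg⟩ := (isDiscrete_of_countable μ).ae_ne_zero.exists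
    obtain ⟨i, hi, rfl⟩ := hsupp g hg
    have hper : ∀ k : ℕ, a ^ (i + n * k : ℤ) = a ^ i := fun k => by
      rw [zpow_add, zpow_mul, zpow_natCast, zpow_natCast, h1, one_pow, mul_one]
    set ψ : ℕ → {i : ℤ // -1 ≤ i} := fun k => ⟨i + n * k, by
      have : (0 : ℤ) ≤ n * k := by positivity
      linarith⟩
    have hψ : Function.Injective ψ := by
      intro k l hkl
      have h2 : i + n * k = i + n * l := congrArg Subtype.val hkl
      have h3 : (n : ℤ) * k = n * l := by linarith
      exact_mod_cast mul_left_cancel₀ (by exact_mod_cast hn.ne' : (n : ℤ) ≠ 0) h3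
    have hlim := hsum.tendsto_cofinite_zero.comp hψ.tendsto_cofinite
    rw [Nat.cofinite_eq_atTop] at hlim
    have hc : 0 < μ.real {a ^ i} := ENNReal.toReal_pos hg (measure_ne_top _ _)
    refine not_tendsto_nhds_of_tendsto_atTop ?_ _ hlim
    have hlin : Tendsto (fun k : ℕ => ((k : ℝ) - 1) * μ.real {a ^ i}) atTop atTop :=
      (tendsto_atTop_add_const_right _ (-1) tendsto_natCast_atTop_atTop).atTop_mul_const hc
    refine tendsto_atTop_mono (fun k => ?_) hlin
    simp only [Function.comp_apply, ψ, hper]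
    refine mul_le_mul_of_nonneg_right ?_ hc.le
    push_cast
    have h2 : (-1 : ℝ) ≤ i := by exact_mod_cast hi
    have h3 : (1 : ℝ) ≤ n := by exact_mod_cast hn
    have h4 : (0 : ℝ) ≤ k := Nat.cast_nonneg k
    nlinarith
  obtain ⟨e, he⟩ := exists_exponent hgen hsupp
  have hsupp' : ∀ g : G, μ {g} ≠ 0 → -1 ≤ e g := fun g hg => by
    obtain ⟨i, hi, rfl⟩ := hsupp g hg
    rwa [exponent_zpow he hinj]
  obtain ⟨h1, h2⟩ := summable_iff_integrable_exponent he hinj hsupp'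
  have hint := h1.1 hsum
  rw [h2 hint] at hneg
  have hdrift : ∀ᵐ ω ∂(pathMeasure μ), Tendsto (fun n => e (walk n ω)) atTop atBot := by
    have hpos : 0 < ∫ g, -(e g : ℝ) ∂μ := by rw [integral_neg]; linarith
    filter_upwards [ae_tendsto_sum_atTop hint.neg hpos] with ω hω
    rw [← tendsto_intCast_atBot_iff (R := ℝ)]
    rw [← tendsto_neg_atTop_iff]
    refine hω.congr fun n => ?_
    rw [exponent_walk he hinj]
    push_cast
    simp
  -- a walk without left jump visits every point on its way down
  have hvisit : ∀ n : ℕ, a ^ (-(n : ℤ)) ∈ surelyVisited μ := by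
    intro n
    filter_upwards [hdrift, ae_forall_step_ne_zero (μ := μ)] with ω h1 h2
    classical
    have hex : ∃ k, e (walk k ω) ≤ -n := (h1.eventually_le_atBot (-n : ℤ)).exists
    refine mem_totalRange.2 ⟨Nat.find hex, ?_⟩
    rw [← he (walk (Nat.find hex) ω)]
    congr 1
    refine le_antisymm (Nat.find_spec hex) ?_
    rcases hk : Nat.find hex with _ | k
    · have : e (walk 0 ω) = 0 := by simpa [walk_zero] using exponent_zpow he hinj 0
      omega
    · have h3 := Nat.find_min hex (m := k) (by omega)
      have h4 := hsupp' _ (h2 k)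
      rw [walk_succ, exponent_mul he hinj]
      omega
  filter_upwards [hdrift] with ω hω
  obtain ⟨N, hN⟩ := (hω.eventually_le_atBot 0).exists_forall_of_atTop
  refine ((Set.finite_Iio N).image fun n => walk n ω).subset ?_
  rintro g ⟨hg, hgK⟩
  obtain ⟨k, rfl⟩ := mem_totalRange.1 hg
  refine ⟨k, ?_, rfl⟩
  by_contra hkN
  have h3 := hN k (not_lt.1 hkN)
  refine hgK ?_
  have h4 := hvisit (e (walk k ω)).natAbs
  rwa [show -((e (walk k ω)).natAbs : ℤ) = e (walk k ω) by omega, he] at h4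

end Cyclic

/-! ### A linear lower bound for the entropy of the range -/

section LowerBound

variable {G : Type*} [Group G] [Countable G] [MeasurableSpace G] [DiscreteMeasurableSpace G]
  {μ : Measure G} [IsProbabilityMeasure μ]

/-- Conditioning on the first step. -/
lemma lintegral_first_step {f : G → (ℕ → G) → ℝ≥0∞} (hf : ∀ x, Measurable (f x)) :
    ∫⁻ ω, f (ω 0) (shift ω) ∂(pathMeasure μ) = ∫⁻ x, ∫⁻ ω, f x ω ∂(pathMeasure μ) ∂μ := by
  have hf' : Measurable (Function.uncurry f) := measurable_from_prod_countable_right hf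
  have h := lintegral_prod (μ := μ) (ν := pathMeasure μ) (Function.uncurry f) hf'.aemeasurable
  rw [← pathMeasure_map_pair,
    lintegral_map hf' ((measurable_pi_apply 0).prodMk measurable_shift)] at h
  exact h

/-- The translate by `x⁻¹` of `A ∪ {1}`: the set `A` together with the starting point, seen from
the position after a first step `x`. -/
def translate (x : G) (A : Set G) : Set G := {y | x * y ∈ A ∨ x * y = 1}

omit [Countable G] [MeasurableSpace G] [DiscreteMeasurableSpace G] in
lemma finite_translate (x : G) {A : Set G} (hA : A.Finite) : (translate x A).Finite := by
  refine ((hA.union (Set.finite_singleton 1)).preimage (f := fun y => x * y)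
    (mul_right_injective x).injOn).subset fun y hy => ?_
  simpa [translate, or_comm] using hy

omit [Countable G] [MeasurableSpace G] [DiscreteMeasurableSpace G] in
lemma union_range_succ (A : Set G) (m : ℕ) (ω : ℕ → G) (y : G) :
    y ∈ A ∪ range (m + 1) ω ↔ (ω 0)⁻¹ * y ∈ translate (ω 0) A ∪ range m (shift ω) := by
  simp only [Set.mem_union, mem_range_succ, translate, Set.mem_ofPred_eq, mul_inv_cancel_left]
  tauto

lemma measurable_union_range (A : Set G) (m : ℕ) :
    Measurable fun ω : ℕ → G => A ∪ range m ω :=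
  measurable_of_dependsOn (Set.finite_Iio m) fun ω ω' hω => by rw [dependsOn_range le_rfl hω]

/-- One step of the entropy of `A ∪ R_m`: conditioning on the first step loses at least the
information on that step contained in the event that `g` is visited. -/
lemma entropy_union_range_succ_ge {g : G} (hg : μ {g} ≠ 0) (hg1 : g ≠ 1) {A : Set G}
    (hA : A.Finite) (m : ℕ) [Decidable (g ∈ A)] :
    ∫⁻ x, entropy (pathMeasure μ) (fun ω => translate x A ∪ range m ω) ∂μ +
      (if g ∈ A then 0 else μ {g} * surprisal (pathMeasure μ {ω | ∃ n ≥ 1, walk n ω = g})) ≤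
    entropy (pathMeasure μ) (fun ω => A ∪ range (m + 1) ω) := by
  set P := pathMeasure μ
  set F := P {ω | ∃ n ≥ 1, walk n ω = g}
  set Y : (ℕ → G) → Set G := fun ω => A ∪ range (m + 1) ω
  set Φ : G → (ℕ → G) → Set G := fun x ω => {y | x⁻¹ * y ∈ translate x A ∪ range m ω}
  have hYΦ : ∀ ω, Y ω = Φ (ω 0) (shift ω) := fun ω => Set.ext fun y => union_range_succ A m ω y
  have hY : Measurable Y := measurable_union_range A (m + 1)
  have hΦ : ∀ x, Measurable (Φ x) := fun x =>
    measurable_of_dependsOn (Set.finite_Iio m) fun ω ω' hω => by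
      simp only [Φ]; rw [dependsOn_range le_rfl hω]
  have hΦfin : ∀ x ω, (Φ x ω).Finite := fun x ω =>
    ((finite_translate x hA).union (finite_range m ω)).preimage (f := fun y => x⁻¹ * y)
      (mul_right_injective x⁻¹).injOn
  set ν := P.map Y
  have hν : IsProbabilityMeasure ν := Measure.isProbabilityMeasure_map hY.aemeasurable
  have hνd : IsDiscrete ν := isDiscrete_map hY countable_setOf_finite
    (ae_of_all _ fun ω => hA.union (finite_range _ ω))
  have hΦd : ∀ x, IsDiscrete (P.map (Φ x)) := fun x => isDiscrete_map (hΦ x)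
    countable_setOf_finite (ae_of_all _ (hΦfin x))
  have hΦp : ∀ x, IsProbabilityMeasure (P.map (Φ x)) := fun x =>
    Measure.isProbabilityMeasure_map (hΦ x).aemeasurable
  have hmeas := measurable_surprisal_singleton ν
  have hent : entropy P Y = ∫⁻ x, ∫⁻ ω, surprisal (ν {Φ x ω}) ∂P ∂μ := by
    rw [entropy_eq_lintegral hY, ← lintegral_first_step
      (f := fun x ω => surprisal (ν {Φ x ω})) fun x => hmeas.comp (hΦ x)]
    exact lintegral_congr fun ω => by rw [hYΦ]
  have hsum : ∑' y, ν {y} = 1 := by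
    simpa using (hνd.lintegral_eq (fun _ => 1)).symm
  have hle : ∀ x, entropy P (Φ x) ≤ ∫⁻ ω, surprisal (ν {Φ x ω}) ∂P := fun x =>
    (measureEntropy_le_lintegral_surprisal (hΦd x) hsum.le).trans (lintegral_map_le _ _)
  -- for the first step `g`, the point `g` is visited for sure
  have hleg (hgA : g ∉ A) : entropy P (Φ g) + surprisal F ≤ ∫⁻ ω, surprisal (ν {Φ g ω}) ∂P := by
    set s := ν {y | g ∈ y}
    have hsm : MeasurableSet {y : Set G | g ∈ y} := measurableSet_setOfPred.2 (measurable_set_mem g)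
    have hs1 : s ≤ 1 := prob_le_one
    have hsY : s = P {ω | g ∈ Y ω} := Measure.map_apply hY hsm
    have hs0 : s ≠ 0 := by
      intro h0
      refine hg ?_
      rw [← measure_walk_one, ← le_zero_iff, ← h0, hsY]
      refine measure_mono fun ω hω => Or.inr ⟨1, by omega, hω⟩
    have hsF : s ≤ F := by
      rw [hsY]
      refine measure_mono fun ω hω => ?_
      obtain ⟨n, -, hn⟩ := (hω : g ∈ A ∪ range (m + 1) ω).resolve_left hgA
      refine ⟨n, Nat.one_le_iff_ne_zero.2 ?_, hn⟩
      rintro rfl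
      exact hg1 hn.symm
    set q : Set G → ℝ≥0∞ := fun y => s⁻¹ * ({y : Set G | g ∈ y}.indicator 1 y * ν {y})
    have hq : ∑' y, q y ≤ 1 := by
      rw [ENNReal.tsum_mul_left, ← hνd.lintegral_eq, lintegral_indicator_one hsm]
      exact ENNReal.inv_mul_le_one _
    have hgΦ : ∀ ω, g ∈ Φ g ω := fun ω => by
      simp only [Φ, Set.mem_ofPred_eq, inv_mul_cancel]
      exact Or.inr ⟨0, Nat.zero_le _, rfl⟩
    have hqν : ∀ ω, surprisal (q (Φ g ω)) + surprisal s = surprisal (ν {Φ g ω}) := by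
      intro ω
      have hst : s ≠ ∞ := ne_top_of_le_ne_top ENNReal.one_ne_top hs1
      have hq1 : q (Φ g ω) ≤ 1 := (ENNReal.le_tsum _).trans hq
      rw [← surprisal_mul hq1 hs1]
      have hi : {y : Set G | g ∈ y}.indicator (1 : Set G → ℝ≥0∞) (Φ g ω) = 1 :=
        Set.indicator_of_mem (s := {y : Set G | g ∈ y}) (hgΦ ω) 1
      simp only [q]
      rw [hi, one_mul, mul_comm, ← mul_assoc,
        ENNReal.mul_inv_cancel hs0 hst, one_mul]
    calc entropy P (Φ g) + surprisal F
        ≤ ∫⁻ ω, surprisal (q (Φ g ω)) ∂P + surprisal s := add_le_add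
          ((measureEntropy_le_lintegral_surprisal (hΦd g) hq).trans (lintegral_map_le _ _))
          (surprisal_anti hsF prob_le_one)
      _ = ∫⁻ ω, surprisal (ν {Φ g ω}) ∂P := by
          simp_rw [← hqν]
          rw [lintegral_add_right _ measurable_const]
          simp
  have htr : ∀ x, entropy P (fun ω => translate x A ∪ range m ω) ≤ entropy P (Φ x) := fun x => by
    refine entropy_le_of_determined (hΦ x) (measurable_union_range _ _) fun ω ω' h => ?_
    ext y
    have := Set.ext_iff.1 h (x * y)
    simpa only [Φ, Set.mem_ofPred_eq, inv_mul_cancel_left] using this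
  rw [hent]
  split_ifs with hgA
  · rw [add_zero]
    exact lintegral_mono fun x => (htr x).trans (hle x)
  calc ∫⁻ x, entropy P (fun ω => translate x A ∪ range m ω) ∂μ + μ {g} * surprisal F
      ≤ ∫⁻ x, entropy P (Φ x) ∂μ + ∫⁻ x, ({g} : Set G).indicator (fun _ => surprisal F) x ∂μ := by
        refine add_le_add (lintegral_mono htr) ?_
        rw [lintegral_indicator_const (measurableSet_singleton g), mul_comm]
    _ = ∫⁻ x, (entropy P (Φ x) + ({g} : Set G).indicator (fun _ => surprisal F) x) ∂μ :=
        (lintegral_add_left (measurable_of_countable _) _).symm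
    _ ≤ _ := by
        refine lintegral_mono fun x => ?_
        simp only
        by_cases hx : x = g
        · subst hx
          simpa using hleg hgA
        · rw [Set.indicator_of_notMem (by simpa using hx), add_zero]
          exact hle x

/-- At time `k`, the point `S_k g` is neither in `A` nor among the earlier positions. -/
def freshEvent (g : G) (k : ℕ) (A : Set G) : Set (ℕ → G) :=
  {ω | walk k ω * g ∉ A ∧ ∀ j < k, walk j ω ≠ walk k ω * g}

lemma measurableSet_freshEvent (g : G) (k : ℕ) (A : Set G) :
    MeasurableSet (freshEvent g k A) := by
  refine measurableSet_setOfPred.2 (measurable_of_dependsOn (Set.finite_Iio k) fun ω ω' hω => ?_)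
  have h : ∀ j ≤ k, walk j ω = walk j ω' := fun j hj => dependsOn_walk hj hω
  rw [h k le_rfl]
  refine propext (and_congr_right fun _ => forall₂_congr fun j hj => by rw [h j hj.le])

lemma measure_freshEvent_succ (g : G) (k : ℕ) (A : Set G) :
    pathMeasure μ (freshEvent g (k + 1) A) =
      ∫⁻ x, pathMeasure μ (freshEvent g k (translate x A)) ∂μ := by
  have h := lintegral_first_step (μ := μ)
    (f := fun x => (freshEvent g k (translate x A)).indicator 1)
    fun x => measurable_one.indicator (measurableSet_freshEvent g k _)
  simp_rw [lintegral_indicator_one (measurableSet_freshEvent g k _)] at h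
  rw [← h, ← lintegral_indicator_one (measurableSet_freshEvent g (k + 1) A)]
  refine lintegral_congr fun ω => ?_
  have : ω ∈ freshEvent g (k + 1) A ↔ shift ω ∈ freshEvent g k (translate (ω 0) A) := by
    simp only [freshEvent, translate, Set.mem_ofPred_eq, walk_succ' k, not_or, mul_assoc]
    refine ⟨fun ⟨h1, h2⟩ => ⟨⟨h1, ?_⟩, fun j hj => ?_⟩, fun ⟨⟨h1, h2⟩, h3⟩ => ⟨h1, fun j hj => ?_⟩⟩
    · exact (h2 0 (by omega)).symm
    · have := h2 (j + 1) (by omega)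
      rw [walk_succ'] at this
      exact fun h => this (by rw [h])
    · rcases j with _ | j
      · exact fun h => h2 h.symm
      · rw [walk_succ']
        exact fun h => h3 j (by omega) (mul_left_cancel h)
  by_cases hω : ω ∈ freshEvent g (k + 1) A
  · rw [Set.indicator_of_mem hω, Set.indicator_of_mem (this.1 hω)]; rfl
  · rw [Set.indicator_of_notMem hω, Set.indicator_of_notMem (mt this.2 hω)]

/-- Iteration of `entropy_union_range_succ_ge` over the first `m` steps. -/
lemma sum_freshEvent_le_entropy {g : G} (hg : μ {g} ≠ 0) (hg1 : g ≠ 1) (m : ℕ) {A : Set G}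
    (hA : A.Finite) :
    μ {g} * surprisal (pathMeasure μ {ω | ∃ n ≥ 1, walk n ω = g}) *
        ∑ k ∈ Finset.range m, pathMeasure μ (freshEvent g k A) ≤
      entropy (pathMeasure μ) (fun ω => A ∪ range m ω) := by
  classical
  induction m generalizing A with
  | zero => simp
  | succ m ih =>
    refine le_trans ?_ (entropy_union_range_succ_ge hg hg1 hA m)
    rw [Finset.sum_range_succ', mul_add]
    refine add_le_add ?_ ?_
    · simp_rw [measure_freshEvent_succ]
      rw [← lintegral_finsetSum _ fun k _ => measurable_of_countable _,
        ← lintegral_const_mul _ (measurable_of_countable _)]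
      exact lintegral_mono fun x => ih (finite_translate x hA)
    · split_ifs with h
      · simp [freshEvent, walk_zero, h]
      · exact (mul_le_mul_right prob_le_one _).trans (mul_one _).le

/-- If no point is almost surely visited, the entropy of the range grows linearly: a positive
proportion of the times `k` is such that `S_k g` has not been visited before time `k`, and
each of them gives a fixed amount of information when the walk steps by `g`. -/
lemma exists_hitAlmostSurely_of_tendsto_zero
    (hpos : 0 < entropy (pathMeasure μ) (step 0))
    (h0 : Tendsto (fun n : ℕ => entropy (pathMeasure μ) (range n) / (n : ℝ≥0∞)) atTop (𝓝 0)) :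
    ∃ x : G, HitAlmostSurely μ x := by
  by_contra! hno
  obtain ⟨g, hg, hg1⟩ : ∃ g, μ {g} ≠ 0 ∧ g ≠ 1 := by
    by_contra! hall
    have hae : ∀ᵐ x ∂μ, x = 1 := by
      rw [ae_iff, measure_null_iff_singleton (Set.to_countable _)]
      exact fun x hx => by_contra fun h => hx (hall x h)
    refine hpos.ne' ?_
    have hμ : μ = Measure.dirac 1 := by
      have := Measure.map_congr (mβ := inferInstance) (μ := μ) (f := id) (g := fun _ => (1 : G)) hae
      rwa [Measure.map_id, Measure.map_const, measure_univ, one_smul] at this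
    change measureEntropy ((pathMeasure μ).map fun ω => ω 0) = 0
    rw [pathMeasure_map_eval, hμ, measureEntropy_dirac]
  set P := pathMeasure μ
  set c := μ {g} * surprisal (P {ω | ∃ n ≥ 1, walk n ω = g})
  set F := P {ω | ∃ n ≥ 1, walk n ω = g⁻¹}
  have hc : c ≠ 0 := mul_ne_zero hg (surprisal_pos (lt_of_le_of_ne prob_le_one (hno g))).ne'
  have hF : 1 - F ≠ 0 := (tsub_pos_of_lt (lt_of_le_of_ne prob_le_one (hno g⁻¹))).ne'
  have hD : ∀ k, 1 - F ≤ P (freshEvent g k ∅) := fun k => by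
    have h1 : (freshEvent g k ∅)ᶜ = {ω | ∃ j < k, walk j ω = walk k ω * g} := by
      ext ω
      simp [freshEvent]
    rw [← compl_compl (freshEvent g k ∅),
      prob_compl_eq_one_sub (measurableSet_freshEvent g k ∅).compl, h1]
    exact tsub_le_tsub_left (measure_mem_past_le (hno 1) hg1 k) 1
  have hle : ∀ᶠ m : ℕ in atTop, c * (1 - F) ≤ entropy P (range m) / (m : ℝ≥0∞) := by
    filter_upwards [eventually_gt_atTop 0] with m hm
    rw [ENNReal.le_div_iff_mul_le (Or.inl (by positivity)) (Or.inl (by simp))]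
    have h := sum_freshEvent_le_entropy hg hg1 m (A := ∅) Set.finite_empty
    simp only [Set.empty_union] at h
    refine le_trans ?_ h
    rw [mul_assoc]
    refine mul_le_mul_right ?_ _
    have := Finset.card_nsmul_le_sum (Finset.range m) (fun k => P (freshEvent g k ∅)) _
      fun k _ => hD k
    rwa [Finset.card_range, nsmul_eq_mul, mul_comm] at this
  have := ge_of_tendsto h0 hle
  exact mul_ne_zero hc hF (le_zero_iff.1 this)

end LowerBound

/-! ### A zero-one law of Hewitt-Savage type -/

section Splice

variable {G : Type*}

/-- The path `ω` up to time `l`, followed by the path `ω'`. -/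
def splice (l : ℕ) (ω ω' : ℕ → G) : ℕ → G := fun k => if k < l then ω k else ω' (k - l)

lemma splice_of_lt {l k : ℕ} (h : k < l) (ω ω' : ℕ → G) : splice l ω ω' k = ω k := if_pos h

lemma shift_splice (l : ℕ) (ω ω' : ℕ → G) : shift^[l] (splice l ω ω') = ω' := by
  ext k
  rw [shift_iterate_apply]
  simp [splice]

variable [MeasurableSpace G]

lemma measurable_splice (l : ℕ) :
    Measurable fun p : (ℕ → G) × (ℕ → G) => splice l p.1 p.2 := by
  refine measurable_pi_lambda _ fun k => ?_
  by_cases h : k < l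
  · simp only [splice, h, if_true]
    fun_prop
  · simp only [splice, h, if_false]
    fun_prop

variable (μ : Measure G) [IsProbabilityMeasure μ]

lemma measurePreserving_splice (l : ℕ) :
    MeasurePreserving (fun p : (ℕ → G) × (ℕ → G) => splice l p.1 p.2)
      ((pathMeasure μ).prod (pathMeasure μ)) (pathMeasure μ) := by
  refine ⟨measurable_splice l, ?_⟩
  -- the two paths are realized by the even and the odd steps of one path
  have he : Function.Injective fun i : ℕ => 2 * i := fun i j h => by simpa using h
  have ho : Function.Injective fun i : ℕ => 2 * i + 1 := fun i j h => by simpa using h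
  have hme := measurePreserving_reindex μ he
  have hmo := measurePreserving_reindex μ ho
  have hind : IndepFun (fun (ω : ℕ → G) i => ω (2 * i)) (fun ω i => ω (2 * i + 1))
      (pathMeasure μ) :=
    (indepFun_of_disjoint μ (S := {i | Even i}) (T := {i | ¬ Even i})
      (Set.disjoint_left.2 fun i h h' => h' h)).comp
      (φ := fun (f : {i : ℕ | Even i} → G) (i : ℕ) => f ⟨2 * i, by simp⟩)
      (ψ := fun (f : {i : ℕ | ¬ Even i} → G) (i : ℕ) => f ⟨2 * i + 1, by simp⟩)
      (measurable_pi_lambda _ fun i => measurable_pi_apply _)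
      (measurable_pi_lambda _ fun i => measurable_pi_apply _)
  have hpair := (indepFun_iff_map_prod_eq_prod_map_map hme.measurable.aemeasurable
    hmo.measurable.aemeasurable).1 hind
  rw [hme.map_eq, hmo.map_eq] at hpair
  rw [← hpair, Measure.map_map (measurable_splice l) (hme.measurable.prodMk hmo.measurable)]
  have hσ : Function.Injective fun k : ℕ => if k < l then 2 * k else 2 * (k - l) + 1 := by
    intro i j h
    simp only at h
    split_ifs at h <;> omega
  have h := (measurePreserving_reindex μ hσ).map_eq
  convert h using 2
  ext ω k
  simp only [Function.comp_apply, splice]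
  split_ifs <;> rfl

end Splice

lemma measure_eq_tsum_inter_fiber {Ω : Type*} [MeasurableSpace Ω] (P : Measure Ω) {τ : Ω → ℕ}
    (hτ : Measurable τ) {s : Set Ω} (hs : MeasurableSet s) :
    P s = ∑' l, P ({ω | τ ω = l} ∩ s) := by
  rw [← measure_iUnion]
  · congr 1
    ext ω
    simp
  · intro i j hij
    exact Set.disjoint_left.2 fun ω h h' => hij (h.1.symm.trans h'.1)
  · exact fun l => (hτ (measurableSet_singleton l)).inter hs

lemma measurePreserving_exchange {Ω : Type*} [MeasurableSpace Ω] (P : Measure Ω) [SFinite P] :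
    MeasurePreserving (fun p : Ω × Ω × Ω => (p.2.1, p.1, p.2.2))
      (P.prod (P.prod P)) (P.prod (P.prod P)) :=
  ((measurePreserving_prodAssoc P P P).comp
    ((Measure.measurePreserving_swap (μ := P) (ν := P)).prod (MeasurePreserving.id P))).comp
    ((measurePreserving_prodAssoc P P P).symm _)

section ZeroOne

variable {G : Type*} [Group G] [Countable G] [MeasurableSpace G] [DiscreteMeasurableSpace G]
  (μ : Measure G) [IsProbabilityMeasure μ]

/-- A stopping time that is almost surely at least `n`. Values below `n` are allowed on a null set
and serve to encode an infinite time. -/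
structure IsSplittingTime (n : ℕ) (τ : (ℕ → G) → ℕ) : Prop where
  measurable : Measurable τ
  dependsOn : ∀ l ≥ n, DependsOn (fun ω => τ ω = l) (Set.Iio l)
  ae_le : ∀ᵐ ω ∂(pathMeasure μ), n ≤ τ ω

variable {μ}

omit [Group G] [Countable G] [DiscreteMeasurableSpace G] in
/-- The strong Markov property: a path followed up to a stopping time and continued by an
independent path has the original law. -/
lemma IsSplittingTime.measurePreserving_splice {n : ℕ} {τ : (ℕ → G) → ℕ}
    (h : IsSplittingTime μ n τ) :
    MeasurePreserving (fun p : (ℕ → G) × (ℕ → G) => splice (τ p.1) p.1 p.2)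
      ((pathMeasure μ).prod (pathMeasure μ)) (pathMeasure μ) := by
  have hm : Measurable fun p : (ℕ → G) × (ℕ → G) => splice (τ p.1) p.1 p.2 := by
    have h1 : Measurable (Function.uncurry fun (l : ℕ) (p : (ℕ → G) × (ℕ → G)) =>
        splice l p.1 p.2) := measurable_from_prod_countable_right measurable_splice
    exact h1.comp ((h.measurable.comp measurable_fst).prodMk measurable_id)
  refine ⟨hm, Measure.ext fun Q hQ => ?_⟩
  set P := pathMeasure μ
  rw [Measure.map_apply hm hQ, measure_eq_tsum_inter_fiber P h.measurable hQ,
    measure_eq_tsum_inter_fiber _ (h.measurable.comp measurable_fst) (hm hQ)]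
  refine tsum_congr fun l => ?_
  rcases lt_or_ge l n with hl | hl
  · have h0 : P {ω | τ ω = l} = 0 :=
      measure_mono_null (fun ω (hω : τ ω = l) => not_le.2 (hω ▸ hl)) (ae_iff.1 h.ae_le)
    rw [measure_mono_null Set.inter_subset_left h0]
    refine measure_mono_null Set.inter_subset_left ?_
    exact (Measure.quasiMeasurePreserving_fst (μ := P) (ν := P)).preimage_null h0
  · have hQl : MeasurableSet ({ω | τ ω = l} ∩ Q) :=
      (h.measurable (measurableSet_singleton l)).inter hQ
    rw [← (RangeEntropy.measurePreserving_splice μ l).measure_preimage hQl.nullMeasurableSet]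
    congr 1
    ext p
    have hd : (τ (splice l p.1 p.2) = l) = (τ p.1 = l) :=
      h.dependsOn l hl fun k hk => splice_of_lt hk _ _
    simp only [Set.mem_inter_iff, Set.mem_ofPred_eq, Function.comp_apply, Set.mem_preimage, hd]
    exact and_congr_right fun e => by rw [e]

lemma exists_dependsOn_measure_symmDiff_lt {D : Set (ℕ → G)} (hD : MeasurableSet D) {ε : ℝ≥0∞}
    (hε : 0 < ε) : ∃ (n : ℕ) (C : Set (ℕ → G)), DependsOn (fun ω => ω ∈ C) (Set.Iio n) ∧
      MeasurableSet C ∧ pathMeasure μ (symmDiff C D) < ε := by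
  obtain ⟨C, hC, h⟩ := exists_measure_symmDiff_lt_of_generateFrom_isSetRing
    (μ := pathMeasure μ) (isSetRing_measurableCylinders (α := fun _ : ℕ => G))
    ⟨{Set.univ}, Set.countable_singleton _,
      by simpa using univ_mem_measurableCylinders (fun _ : ℕ => G), by simp⟩
    (generateFrom_measurableCylinders (α := fun _ : ℕ => G)).symm hD hε
  obtain ⟨s, S, -, rfl⟩ := (mem_measurableCylinders _).1 hC
  have hd : DependsOn (fun ω => ω ∈ cylinder (α := fun _ : ℕ => G) s S)
      (Set.Iio (s.sup id + 1)) := by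
    intro ω ω' hω
    simp only [mem_cylinder]
    have : s.restrict ω = s.restrict ω' := by
      ext i
      exact hω i (Nat.lt_succ_of_le (Finset.le_sup (f := id) i.2))
    rw [this]
  exact ⟨_, _, hd, measurableSet_setOfPred.2 (measurable_of_dependsOn (Set.finite_Iio _) hd), h⟩

/-- An event that is invariant under the exchange of two independent initial pieces of the path,
stopped at arbitrarily large times, has probability `0` or `1`: it is approximated by an event
about the first piece, and as well by the same event about the second piece. -/
theorem measure_eq_zero_or_one_of_exchange {D : Set (ℕ → G)} (hD : MeasurableSet D)
    (h : ∀ n, ∃ τ, IsSplittingTime μ (n + 1) τ ∧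
      ∀ᵐ p ∂((pathMeasure μ).prod ((pathMeasure μ).prod (pathMeasure μ))),
        (splice (τ p.1) p.1 (splice (τ p.2.1) p.2.1 p.2.2) ∈ D ↔
          splice (τ p.2.1) p.2.1 (splice (τ p.1) p.1 p.2.2) ∈ D)) :
    pathMeasure μ D = 0 ∨ pathMeasure μ D = 1 := by
  set P := pathMeasure μ
  set Q := P.prod (P.prod P)
  have key : ∀ ε : ℝ, 0 < ε → |P.real D - P.real D ^ 2| ≤ 4 * ε := by
    intro ε hε
    obtain ⟨n, C, hCd, hC, hCD⟩ := exists_dependsOn_measure_symmDiff_lt (μ := μ) hD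
      (ENNReal.ofReal_pos.2 hε)
    have hCD' : P.real (symmDiff C D) ≤ ε := ENNReal.toReal_le_of_le_ofReal hε.le hCD.le
    obtain ⟨τ, hτ, hinv⟩ := h n
    set Z : (ℕ → G) × (ℕ → G) × (ℕ → G) → ℕ → G :=
      fun p => splice (τ p.1) p.1 (splice (τ p.2.1) p.2.1 p.2.2)
    set Z' : (ℕ → G) × (ℕ → G) × (ℕ → G) → ℕ → G :=
      fun p => splice (τ p.2.1) p.2.1 (splice (τ p.1) p.1 p.2.2)
    have hZ : MeasurePreserving Z Q P :=
      hτ.measurePreserving_splice.comp ((MeasurePreserving.id P).prod hτ.measurePreserving_splice)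
    have hsw := measurePreserving_exchange P
    have hZ' : MeasurePreserving Z' Q P := hZ.comp hsw
    set E : Set ((ℕ → G) × (ℕ → G) × (ℕ → G)) := {p | p.1 ∈ C}
    set E' : Set ((ℕ → G) × (ℕ → G) × (ℕ → G)) := {p | p.2.1 ∈ C}
    have hfst : ∀ᵐ p ∂Q, n < τ p.1 :=
      (Measure.quasiMeasurePreserving_fst (μ := P) (ν := P.prod P)).ae hτ.ae_le
    have hZE : Z ⁻¹' C =ᵐ[Q] E := by
      filter_upwards [hfst] with p hp
      exact hCd fun k (hk : k < n) => splice_of_lt (hk.trans hp) _ _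
    have hZE' : Z' ⁻¹' C =ᵐ[Q] E' := by
      filter_upwards [hsw.quasiMeasurePreserving.ae hfst] with p hp
      exact hCd fun k (hk : k < n) => splice_of_lt (hk.trans hp) _ _
    have hDD : Z' ⁻¹' D =ᵐ[Q] Z ⁻¹' D := by
      filter_upwards [hinv] with p hp
      exact propext hp.symm
    have h1 : Q.real (symmDiff E (Z ⁻¹' D)) ≤ ε := by
      rw [← measureReal_congr (hZE.symmDiff (ae_eq_refl (Z ⁻¹' D))), ← Set.preimage_symmDiff,
        measureReal_def, hZ.measure_preimage (hC.symmDiff hD).nullMeasurableSet]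
      exact hCD'
    have h2 : Q.real (symmDiff E' (Z ⁻¹' D)) ≤ ε := by
      rw [← measureReal_congr (hZE'.symmDiff hDD), ← Set.preimage_symmDiff,
        measureReal_def, hZ'.measure_preimage (hC.symmDiff hD).nullMeasurableSet]
      exact hCD'
    have h3 : Q.real (symmDiff (E ∩ E') (Z ⁻¹' D)) ≤ 2 * ε := by
      have hsub : symmDiff (E ∩ E') (Z ⁻¹' D) ⊆
          symmDiff E (Z ⁻¹' D) ∪ symmDiff E' (Z ⁻¹' D) := by
        intro p
        simp only [Set.mem_symmDiff, Set.mem_inter_iff, Set.mem_union]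
        tauto
      refine (measureReal_mono hsub).trans ((measureReal_union_le _ _).trans ?_)
      linarith
    have hEE : Q.real (E ∩ E') = P.real C ^ 2 := by
      have : E ∩ E' = C ×ˢ (C ×ˢ Set.univ) := by
        ext p
        simp [E, E']
      rw [this, measureReal_prod_prod, measureReal_prod_prod]
      simp [sq]
    have hZD : Q.real (Z ⁻¹' D) = P.real D := by
      rw [measureReal_def, hZ.measure_preimage hD.nullMeasurableSet]; rfl
    have hEm : MeasurableSet E := measurable_fst hC
    have hEm' : MeasurableSet E' := (measurable_fst.comp measurable_snd) hC
    have h4 := (abs_measureReal_sub_le_measureReal_symmDiff (μ := Q)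
      (hEm.inter hEm').nullMeasurableSet (hZ.measurable hD).nullMeasurableSet).trans h3
    have h5 := (abs_measureReal_sub_le_measureReal_symmDiff (μ := P) hC.nullMeasurableSet
      hD.nullMeasurableSet).trans hCD'
    rw [hEE, hZD] at h4
    have hc0 : 0 ≤ P.real C := measureReal_nonneg
    have hc1 : P.real C ≤ 1 := measureReal_le_one
    have hd0 : 0 ≤ P.real D := measureReal_nonneg
    have hd1 : P.real D ≤ 1 := measureReal_le_one
    rw [abs_le] at h4 h5 ⊢
    constructor <;> nlinarith
  have h0 : |P.real D - P.real D ^ 2| ≤ 0 := by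
    refine le_of_forall_pos_le_add fun ε hε => ?_
    have := key (ε / 4) (by positivity)
    linarith
  have h1 : P.real D * (1 - P.real D) = 0 := by
    have := abs_nonpos_iff.1 h0
    linarith
  rcases mul_eq_zero.1 h1 with h | h
  · exact Or.inl ((measureReal_eq_zero_iff (by finiteness)).1 h)
  · refine Or.inr ?_
    have h : P.real D = 1 := by linarith
    rw [← ofReal_measureReal (μ := P) (s := D), h, ENNReal.ofReal_one]

end ZeroOne

/-! ### The tail of the walk and of its range -/

section Tail

variable {G : Type*} [Group G]

lemma eventually_subset_range {F : Set G} (hF : F.Finite) {ω : ℕ → G} (h : F ⊆ totalRange ω) :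
    ∀ᶠ m in atTop, F ⊆ range m ω := by
  refine (eventually_all_finite hF).2 fun g hg => ?_
  obtain ⟨i, hi⟩ := mem_totalRange.1 (h hg)
  filter_upwards [eventually_ge_atTop i] with m hm
  exact ⟨i, hm, hi⟩

/-- If two walks coincide from time `N` on and both visit `K`, their ranges eventually have the same
trace on `K`. -/
lemma eventually_range_inter_eq {K : Set G} {ω ω' : ℕ → G} {N : ℕ}
    (hw : ∀ k, walk (N + k) ω = walk (N + k) ω') (h : K ⊆ totalRange ω)
    (h' : K ⊆ totalRange ω') : ∀ᶠ m in atTop, range m ω ∩ K = range m ω' ∩ K := by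
  have key : ∀ {ω ω' : ℕ → G}, (∀ k, walk (N + k) ω = walk (N + k) ω') → K ⊆ totalRange ω' →
      ∀ᶠ m in atTop, range m ω ∩ K ⊆ range m ω' ∩ K := by
    intro ω ω' hw h'
    filter_upwards [eventually_subset_range ((finite_range N ω).inter_of_left K)
      (Set.inter_subset_right.trans h')] with m hm
    rintro g ⟨⟨i, hi, rfl⟩, hg⟩
    refine ⟨?_, hg⟩
    rcases le_total i N with hiN | hiN
    · exact hm ⟨walk_mem_range hiN ω, hg⟩
    · obtain ⟨k, rfl⟩ := Nat.exists_eq_add_of_le hiN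
      rw [hw]
      exact walk_mem_range hi ω'
  filter_upwards [key hw h', key (fun k => (hw k).symm) h] with m h1 h2
  exact h1.antisymm h2

/-- The pair `(R_n, S_n)`, with the part of `R_n` outside `K` replaced by that of `B`. -/
def adjustedRangeWalk (K B : Set G) (n : ℕ) (ω : ℕ → G) : Set G × G :=
  (range n ω ∩ K ∪ B \ K, walk n ω)

lemma eventually_adjustedRangeWalk_eq {K B : Set G} {ω : ℕ → G} (hB : totalRange ω = B)
    (hfin : (B \ K).Finite) : ∀ᶠ m in atTop, adjustedRangeWalk K B m ω = rangeWalk m ω := by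
  filter_upwards [eventually_subset_range hfin (Set.sdiff_subset.trans hB.ge)] with m hm
  refine Prod.ext ?_ rfl
  refine Set.Subset.antisymm (Set.union_subset Set.inter_subset_left hm) fun g hg => ?_
  by_cases hK : g ∈ K
  · exact Or.inl ⟨hg, hK⟩
  · exact Or.inr ⟨hB ▸ range_subset_totalRange m ω hg, hK⟩

/-- The walk along two pieces of path does not depend on the order of the pieces, if these have
commuting increments. -/
lemma walk_splice_comm {l l' : ℕ} {ω ω' ω'' : ℕ → G} (h : Commute (walk l ω) (walk l' ω'))
    (k : ℕ) : walk (l + l' + k) (splice l ω (splice l' ω' ω'')) =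
      walk (l + l' + k) (splice l' ω' (splice l ω ω'')) := by
  have hs : ∀ (l : ℕ) (ω ω' : ℕ → G), walk l (splice l ω ω') = walk l ω := fun l ω ω' =>
    dependsOn_walk le_rfl fun k hk => splice_of_lt hk _ _
  rw [add_assoc, walk_add, shift_splice, hs, walk_add, shift_splice, hs]
  rw [← add_assoc, add_comm l l', add_assoc, walk_add, shift_splice, hs, walk_add, shift_splice, hs,
    ← mul_assoc, ← mul_assoc, h.eq]

variable [Countable G] [MeasurableSpace G] [DiscreteMeasurableSpace G]
  {μ : Measure G} [IsProbabilityMeasure μ]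

omit [Countable G] [DiscreteMeasurableSpace G] [IsProbabilityMeasure μ] in
lemma commute_of_escapes (hgen : Subgroup.closure {g : G | μ {g} ≠ 0} = ⊤)
    (h : EscapesWithoutLeftJump μ) (x y : G) : Commute x y := by
  obtain ⟨a, hsupp, -, -⟩ := h
  have htop : (⊤ : Subgroup G) ≤ Subgroup.zpowers a := by
    rw [← hgen, Subgroup.closure_le]
    intro g hg
    obtain ⟨i, -, rfl⟩ := hsupp g hg
    exact Subgroup.zpow_mem_zpowers a i
  obtain ⟨i, rfl⟩ := Subgroup.mem_zpowers_iff.1 (htop (Subgroup.mem_top x))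
  obtain ⟨j, rfl⟩ := Subgroup.mem_zpowers_iff.1 (htop (Subgroup.mem_top y))
  exact (Commute.refl a).zpow_zpow i j

/-- There are arbitrarily large stopping times at which independent copies of the walk commute:
return times to the starting point for a recurrent walk, any deterministic times if the group is
abelian. -/
lemma exists_isSplittingTime_commute (hgen : Subgroup.closure {g : G | μ {g} ≠ 0} = ⊤)
    (h : Recurrent μ ∨ EscapesWithoutLeftJump μ) (n : ℕ) :
    ∃ τ, IsSplittingTime μ (n + 1) τ ∧ ∀ᵐ ω ∂(pathMeasure μ), ∀ ω',
      Commute (walk (τ ω) ω) (walk (τ ω') ω') := by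
  classical
  rcases h with h | h
  · set τ : (ℕ → G) → ℕ := fun ω =>
      if h : ∃ l ≥ n + 1, walk l ω = 1 then Nat.find h else 0
    have hτ : ∀ l ≥ n + 1, ∀ ω, τ ω = l ↔ walk l ω = 1 ∧ ∀ j < l, n + 1 ≤ j → walk j ω ≠ 1 := by
      intro l hl ω
      simp only [τ]
      split_ifs with hex
      · rw [Nat.find_eq_iff]
        simp only [not_and, ge_iff_le]
        exact ⟨fun h => ⟨h.1.2, h.2⟩, fun h => ⟨⟨hl, h.1⟩, h.2⟩⟩
      · refine ⟨fun h0 => by omega, fun h => absurd ⟨l, hl, h.1⟩ hex⟩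
    have hd : ∀ l ≥ n + 1, DependsOn (fun ω => τ ω = l) (Set.Iio l) := by
      intro l hl ω ω' hω
      have hw : ∀ j ≤ l, walk j ω = walk j ω' := fun j hj => dependsOn_walk hj hω
      change (τ ω = l) = (τ ω' = l)
      rw [hτ l hl, hτ l hl, hw l le_rfl]
      refine propext (and_congr_right fun _ => forall₂_congr fun j hj => by rw [hw j hj.le])
    have hpos : ∀ l, MeasurableSet {ω | τ ω = l + 1} := fun l => by
      rcases lt_or_ge l n with hl | hl
      · have : {ω | τ ω = l + 1} = ∅ := by
          refine Set.eq_empty_of_forall_notMem fun ω (hω : τ ω = l + 1) => ?_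
          simp only [τ] at hω
          split_ifs at hω with hex
          exact absurd (Nat.find_spec hex).1 (by rw [hω]; omega)
        rw [this]
        exact MeasurableSet.empty
      · exact measurableSet_setOfPred.2
          (measurable_of_dependsOn (Set.finite_Iio _) (hd (l + 1) (by omega)))
    have hm : Measurable τ := by
      refine measurable_to_countable' fun l => ?_
      rcases l with _ | l
      · have : τ ⁻¹' {0} = (⋃ l, {ω | τ ω = l + 1})ᶜ := by
          ext ω
          simp only [Set.mem_preimage, Set.mem_singleton_iff, Set.mem_compl_iff, Set.mem_iUnion,
            Set.mem_ofPred_eq, not_exists]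
          exact ⟨fun h0 l => by omega, fun h => by_contra fun h0 => h (τ ω - 1) (by omega)⟩
        rw [this]
        exact (MeasurableSet.iUnion hpos).compl
      · exact hpos l
    have hex : ∀ᵐ ω ∂(pathMeasure μ), n + 1 ≤ τ ω ∧ walk (τ ω) ω = 1 := by
      filter_upwards [h.ae_returns] with ω hω
      simp only [τ, dif_pos (hω (n + 1))]
      exact Nat.find_spec (hω (n + 1))
    refine ⟨τ, ⟨hm, hd, hex.mono fun ω h => h.1⟩, ?_⟩
    filter_upwards [hex] with ω hω ω'
    rw [hω.2]
    exact Commute.one_left _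
  · exact ⟨fun _ => n + 1, ⟨measurable_const, fun _ _ _ _ _ => rfl, ae_of_all _ fun _ => le_rfl⟩,
      ae_of_all _ fun ω ω' => commute_of_escapes hgen h _ _⟩

omit [Group G] [MeasurableSpace G] [DiscreteMeasurableSpace G] in
lemma countable_setOf_finite_diff (K : Set G) : {B : Set G | K ⊆ B ∧ (B \ K).Finite}.Countable := by
  refine (countable_setOf_finite.image (fun F : Set G => K ∪ F)).mono fun B hB => ?_
  exact ⟨B \ K, hB.2, Set.union_sdiff_cancel hB.1⟩

lemma ae_totalRange_mem (hgen : Subgroup.closure {g : G | μ {g} ≠ 0} = ⊤)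
    (h : Recurrent μ ∨ EscapesWithoutLeftJump μ) : ∀ᵐ ω ∂(pathMeasure μ),
      totalRange ω ∈ {B : Set G | surelyVisited μ ⊆ B ∧ (B \ surelyVisited μ).Finite} := by
  have h1 : ∀ᵐ ω ∂(pathMeasure μ), surelyVisited μ ⊆ totalRange ω :=
    (ae_ball_iff (Set.to_countable _)).2 fun g hg => hg
  filter_upwards [h1, ae_finite_diff_surelyVisited hgen h] with ω h1 h2 using ⟨h1, h2⟩

omit [Countable G] [DiscreteMeasurableSpace G] in
lemma totalRangeSigma_le_tailSigma : totalRangeSigma G ≤ tailSigma G := by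
  refine le_iInf fun n => ?_
  rw [← measurable_iff_comap_le]
  refine @measurable_set_iff _ _ (futureSigma G n) _ |>.2 fun g => ?_
  have : (fun ω : ℕ → G => g ∈ totalRange ω) = fun ω => ∃ k, g ∈ range (n + k) ω := by
    ext ω
    simp only [totalRange, Set.mem_iUnion]
    exact ⟨fun ⟨k, hk⟩ => ⟨k, range_mono ω (Nat.le_add_left k n) hk⟩, fun ⟨k, hk⟩ => ⟨_, hk⟩⟩
  rw [this]
  refine @Measurable.exists _ _ (futureSigma G n) _ _ fun k => ?_
  have hk : Measurable[futureSigma G n] (rangeWalk (n + k) : (ℕ → G) → Set G × G) := by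
    rw [measurable_iff_comap_le]
    exact le_iSup₂_of_le (n + k) (Nat.le_add_right n k) le_rfl
  exact (measurable_set_mem g).comp (measurable_fst.comp hk)

omit [Countable G] [DiscreteMeasurableSpace G] in
lemma exists_preimage_of_measurableSet_futureSigma {n : ℕ} {A : Set (ℕ → G)}
    (hA : MeasurableSet[futureSigma G n] A) : ∃ F : Set (ℕ → Set G × G), MeasurableSet F ∧
      A = (fun ω k => rangeWalk (n + k) ω) ⁻¹' F := by
  have hle : futureSigma G n ≤
      MeasurableSpace.comap (fun (ω : ℕ → G) k => rangeWalk (n + k) ω) inferInstance := by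
    refine iSup₂_le fun k hk => ?_
    obtain ⟨j, rfl⟩ := Nat.exists_eq_add_of_le hk
    rw [← measurable_iff_comap_le]
    exact (measurable_pi_apply j).comp (comap_measurable (fun (ω : ℕ → G) k => rangeWalk (n + k) ω))
  obtain ⟨F, hF, rfl⟩ := hle A hA
  exact ⟨F, hF, rfl⟩

/-- On each of the countably many events `R_∞ = B`, a tail event coincides with an event defined
by the adjusted walk, to which the zero-one law applies. -/
theorem eqMod_tailSigma_totalRangeSigma (hgen : Subgroup.closure {g : G | μ {g} ≠ 0} = ⊤)
    (h : Recurrent μ ∨ EscapesWithoutLeftJump μ) :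
    EqMod (pathMeasure μ) (tailSigma G) (totalRangeSigma G) := by
  refine ⟨fun A hA => ?_, fun B hB => ⟨B, totalRangeSigma_le_tailSigma B hB, ae_eq_refl B⟩⟩
  set P := pathMeasure μ
  set K := surelyVisited μ
  have hAn : ∀ n, ∃ F : Set (ℕ → Set G × G), MeasurableSet F ∧
      A = (fun ω k => rangeWalk (n + k) ω) ⁻¹' F := fun n =>
    exists_preimage_of_measurableSet_futureSigma ((iInf_le (futureSigma G) n) A hA)
  choose F hF hAF using hAn
  set D : Set G → Set (ℕ → G) := fun B =>
    {ω | ∀ᶠ n in atTop, (fun k => adjustedRangeWalk K B (n + k) ω) ∈ F n}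
  have hDm : ∀ B, MeasurableSet (D B) := by
    intro B
    have hW : ∀ n, Measurable (adjustedRangeWalk K B n : (ℕ → G) → Set G × G) := fun n =>
      measurable_of_dependsOn (Set.finite_Iio n) fun ω ω' hω => by
        rw [adjustedRangeWalk, adjustedRangeWalk, dependsOn_range le_rfl hω,
          dependsOn_walk le_rfl hω]
    have : D B = ⋃ N, ⋂ n, ⋂ (_ : n ≥ N),
        (fun ω k => adjustedRangeWalk K B (n + k) ω) ⁻¹' F n := by
      ext ω
      simp [D, eventually_atTop]
    rw [this]
    exact .iUnion fun N => .iInter fun n => .iInter fun _ =>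
      (measurable_pi_lambda _ fun k => hW (n + k)) (hF n)
  have hcongr : ∀ (B : Set G) (ω ω' : ℕ → G), (∀ᶠ m in atTop,
      adjustedRangeWalk K B m ω = adjustedRangeWalk K B m ω') → (ω ∈ D B ↔ ω' ∈ D B) := by
    intro B ω ω' hm
    refine eventually_congr ?_
    filter_upwards [eventually_atTop.2 ((eventually_atTop.1 hm).imp fun N hN n hn k =>
      hN (n + k) (by omega))] with n hn
    simp_rw [hn]
  have hKsub : ∀ᵐ ω ∂P, K ⊆ totalRange ω := (ae_totalRange_mem hgen h).mono fun ω h => h.1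
  have h01 : ∀ B, P (D B) = 0 ∨ P (D B) = 1 := by
    intro B
    refine measure_eq_zero_or_one_of_exchange (hDm B) fun n => ?_
    obtain ⟨τ, hτ, hcomm⟩ := exists_isSplittingTime_commute hgen h n
    refine ⟨τ, hτ, ?_⟩
    have hZ : MeasurePreserving (fun p : (ℕ → G) × (ℕ → G) × (ℕ → G) =>
        splice (τ p.1) p.1 (splice (τ p.2.1) p.2.1 p.2.2)) (P.prod (P.prod P)) P :=
      hτ.measurePreserving_splice.comp ((MeasurePreserving.id P).prod hτ.measurePreserving_splice)
    filter_upwards [hZ.quasiMeasurePreserving.ae hKsub,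
      (hZ.comp (measurePreserving_exchange P)).quasiMeasurePreserving.ae hKsub,
      (Measure.quasiMeasurePreserving_fst (μ := P) (ν := P.prod P)).ae hcomm] with p h1 h2 h3
    refine hcongr B _ _ ?_
    have hw := fun k => walk_splice_comm (ω'' := p.2.2) (h3 p.2.1) k
    filter_upwards [eventually_range_inter_eq hw h1 h2,
      eventually_ge_atTop (τ p.1 + τ p.2.1)] with m hm hm'
    obtain ⟨k, rfl⟩ := Nat.exists_eq_add_of_le hm'
    rw [adjustedRangeWalk, adjustedRangeWalk, hm, hw]
  set C : Set (Set G) := {B | (K ⊆ B ∧ (B \ K).Finite) ∧ P (D B) = 1}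
  have hC : C.Countable := (countable_setOf_finite_diff K).mono fun B hB => hB.1
  refine ⟨totalRange ⁻¹' C, ⟨C, hC.measurableSet, rfl⟩, ?_⟩
  have hD1 : ∀ᵐ ω ∂P, ∀ B ∈ {B : Set G | K ⊆ B ∧ (B \ K).Finite}, (ω ∈ D B ↔ P (D B) = 1) := by
    refine (ae_ball_iff (countable_setOf_finite_diff K)).2 fun B _ => ?_
    rcases h01 B with h0 | h1
    · filter_upwards [measure_eq_zero_iff_ae_notMem.1 h0] with ω hω
      simp [hω, h0]
    · filter_upwards [(mem_ae_iff_prob_eq_one (hDm B)).2 h1] with ω hω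
      exact ⟨fun _ => h1, fun _ => hω⟩
  filter_upwards [ae_totalRange_mem hgen h, hD1] with ω h1 h2
  refine propext ?_
  change ω ∈ A ↔ totalRange ω ∈ C
  have hAD : ω ∈ A ↔ ω ∈ D (totalRange ω) := by
    have hev := eventually_adjustedRangeWalk_eq (K := K) (ω := ω) rfl h1.2
    have : ∀ᶠ n in atTop, (ω ∈ A ↔
        (fun k => adjustedRangeWalk K (totalRange ω) (n + k) ω) ∈ F n) := by
      filter_upwards [eventually_atTop.2 ((eventually_atTop.1 hev).imp fun N hN n hn k =>
        hN (n + k) (by omega))] with n hn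
      simp_rw [hn]
      conv_lhs => rw [hAF n]
      rfl
    exact ⟨fun hω => this.mono fun n hn => hn.1 hω, fun hω => by
      obtain ⟨n, h1, h2⟩ := (this.and hω).exists
      exact h1.2 h2⟩
  rw [hAD, h2 _ h1]
  exact ⟨fun h => ⟨h1, h⟩, fun h => h.2⟩

end Tail

/-! ### The range seen from the first step -/

lemma condEntropy_eq_add_of_determined {Ω D E F : Type*} [MeasurableSpace Ω] [MeasurableSpace D]
    [MeasurableSpace E] [MeasurableSpace F] [StandardBorelSpace D] [StandardBorelSpace E]
    [StandardBorelSpace F] {P : Measure Ω} [IsProbabilityMeasure P] {Z : Ω → D} {Y : Ω → E}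
    {W : Ω → F} [Nonempty E] [Nonempty F] (hY : Measurable Y) (hZ : Measurable Z)
    {f : D × E → F} (hf : Measurable f) (hW : ∀ ω, W ω = f (Z ω, Y ω)) :
    condEntropy P Y Z = condEntropy P W Z + condEntropy P Y (fun ω => (Z ω, W ω)) := by
  have hWm : Measurable W := by
    rw [funext hW]
    exact hf.comp (hZ.prodMk hY)
  rw [← condEntropy_prod hWm hY hZ]
  exact condEntropy_eq_of_determined hY (hWm.prodMk hY) hZ (f := fun p => (f p, p.2))
    (g := fun p => p.2.2) (hf.prodMk measurable_snd) (by fun_prop)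
    (fun ω => by rw [← hW]) fun ω => rfl

section FirstStep

variable {G : Type*} [Group G]

/-- The first step `x` of a path, together with the information whether the path returns to its
starting point, where `A` is the set of points visited by the path after its first step, seen
from the position at time `1`. -/
def returnMark (x : G) (A : Set G) : G × Prop := (x, x⁻¹ ∈ A)

/-- The set of points visited by a path with first step `x`, if `A` is the set of points visited
after this step, seen from the position at time `1`. -/
def prependStep (x : G) (A : Set G) : Set G := {y | y = 1 ∨ x⁻¹ * y ∈ A}

/-- The set of points visited after the first step, recovered from the set `C` of all visited
points and from the first step and the return mark `v`. -/
def removeStep (v : G × Prop) (C : Set G) : Set G := {y | v.1 * y ∈ C ∧ (v.1 * y = 1 → v.2)}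

lemma removeStep_returnMark (x : G) (A : Set G) :
    removeStep (returnMark x A) (prependStep x A) = A := by
  ext y
  simp only [removeStep, returnMark, prependStep, Set.mem_ofPred_eq, inv_mul_cancel_left]
  constructor
  · rintro ⟨h1 | h1, h2⟩
    · rw [eq_inv_of_mul_eq_one_right h1]
      exact h2 h1
    · exact h1
  · refine fun h => ⟨Or.inr h, fun h1 => ?_⟩
    rwa [← eq_inv_of_mul_eq_one_right h1]

lemma totalRange_eq_prependStep (ω : ℕ → G) :
    totalRange ω = prependStep (ω 0) (totalRange (shift ω)) :=
  Set.ext fun _ => mem_totalRange_shift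

lemma range_succ_eq_prependStep (n : ℕ) (ω : ℕ → G) :
    range (n + 1) ω = prependStep (ω 0) (range n (shift ω)) :=
  Set.ext fun _ => mem_range_succ

variable [Countable G] [MeasurableSpace G] [DiscreteMeasurableSpace G]

lemma measurable_returnMark : Measurable fun p : G × Set G => returnMark p.1 p.2 :=
  measurable_from_prod_countable_right fun x =>
    measurable_const.prodMk (measurable_set_mem x⁻¹)

lemma measurable_prependStep : Measurable fun p : G × Set G => prependStep p.1 p.2 :=
  measurable_from_prod_countable_right fun x => measurable_set_iff.2 fun y =>
    (measurable_const (a := y = 1)).or (measurable_set_mem (x⁻¹ * y))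

lemma measurable_removeStep : Measurable fun p : (G × Prop) × Set G => removeStep p.1 p.2 :=
  measurable_from_prod_countable_right fun v => measurable_set_iff.2 fun y =>
    (measurable_set_mem (v.1 * y)).and (measurable_const (a := v.1 * y = 1 → v.2))

variable {μ : Measure G} [IsProbabilityMeasure μ]

/-- Two ways to compute the information of the first step and the return mark: given the range of
the shifted walk it is the entropy of the first step. -/
lemma entropy_step_eq (A : (ℕ → G) → Set G) (hA : Measurable A) :
    entropy (pathMeasure μ) (step 0) =
      condEntropy (pathMeasure μ) (fun ω => prependStep (ω 0) (A (shift ω)))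
        (fun ω => A (shift ω)) +
      condEntropy (pathMeasure μ) (fun ω => returnMark (ω 0) (A (shift ω)))
        (fun ω => (A (shift ω), prependStep (ω 0) (A (shift ω)))) := by
  have hAs : Measurable fun ω => A (shift ω) := hA.comp measurable_shift
  have hV : Measurable fun ω => returnMark (ω 0) (A (shift ω)) :=
    measurable_returnMark.comp ((measurable_pi_apply 0).prodMk hAs)
  have hind : IndepFun (fun ω => A (shift ω)) (step 0) (pathMeasure μ) :=
    ((indepFun_shift μ (n := 1) (Y := step 0) fun ω ω' h => h 0 (by simp)).comp
      measurable_id hA).symm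
  rw [← condEntropy_of_indepFun (Y := step 0) (measurable_pi_apply 0) hAs hind,
    condEntropy_eq_of_determined (Y := step 0) (W := fun ω => returnMark (ω 0) (A (shift ω)))
      (measurable_pi_apply 0) hV hAs (f := fun p => returnMark p.2 p.1) (g := fun p => p.2.1)
      (measurable_returnMark.comp measurable_swap) (by fun_prop) (fun _ => rfl) fun _ => rfl]
  exact condEntropy_eq_add_of_determined hV hAs
    (f := fun p => prependStep p.2.1 p.1) (measurable_prependStep.comp
      ((measurable_fst.comp measurable_snd).prodMk measurable_fst)) fun _ => rfl

lemma condEntropy_returnMark (A : (ℕ → G) → Set G) (hA : Measurable A) :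
    condEntropy (pathMeasure μ) (fun ω => returnMark (ω 0) (A (shift ω)))
        (fun ω => prependStep (ω 0) (A (shift ω))) =
      condEntropy (pathMeasure μ) (fun ω => A (shift ω))
        (fun ω => prependStep (ω 0) (A (shift ω))) +
      condEntropy (pathMeasure μ) (fun ω => returnMark (ω 0) (A (shift ω)))
        (fun ω => (A (shift ω), prependStep (ω 0) (A (shift ω)))) := by
  have hAs : Measurable fun ω => A (shift ω) := hA.comp measurable_shift
  have hV : Measurable fun ω => returnMark (ω 0) (A (shift ω)) :=
    measurable_returnMark.comp ((measurable_pi_apply 0).prodMk hAs)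
  have hC : Measurable fun ω => prependStep (ω 0) (A (shift ω)) :=
    measurable_prependStep.comp ((measurable_pi_apply 0).prodMk hAs)
  rw [condEntropy_swap_right hV hAs hC]
  exact condEntropy_eq_add_of_determined hV hC (f := fun p => removeStep p.2 p.1)
    (measurable_removeStep.comp measurable_swap) fun ω => (removeStep_returnMark _ _).symm

lemma condEntropy_totalRange_shift_ne_top (hfin : entropy (pathMeasure μ) (step 0) < ∞) :
    condEntropy (pathMeasure μ) totalRange (fun ω => totalRange (shift ω)) ≠ ∞ := by
  have h := entropy_step_eq (μ := μ) totalRange measurable_totalRange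
  simp_rw [← totalRange_eq_prependStep] at h
  exact ne_top_of_le_ne_top hfin.ne (le_self_add.trans h.ge)

/-- The two ranges have the same law, which is discrete, so that `condEntropy_symm_of_map_eq`
applies. -/
theorem condEntropy_totalRange_symm (hfin : entropy (pathMeasure μ) (step 0) < ∞)
    (hgen : Subgroup.closure {g : G | μ {g} ≠ 0} = ⊤)
    (h : Recurrent μ ∨ EscapesWithoutLeftJump μ) :
    condEntropy (pathMeasure μ) (fun ω => totalRange (shift ω)) totalRange =
      condEntropy (pathMeasure μ) totalRange (fun ω => totalRange (shift ω)) := by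
  have hs := measurePreserving_shift μ
  refine condEntropy_symm_of_map_eq (measurable_totalRange.comp hs.measurable)
    measurable_totalRange ?_ (isDiscrete_map measurable_totalRange
      (countable_setOf_finite_diff _) (ae_totalRange_mem hgen h))
    (condEntropy_totalRange_shift_ne_top hfin)
  have := Measure.map_map (μ := pathMeasure μ) (measurable_totalRange (G := G)) hs.measurable
  rw [hs.map_eq] at this
  exact this

lemma condEntropy_returnMark_totalRange
    (heq : condEntropy (pathMeasure μ) (fun ω => totalRange (shift ω)) totalRange =
      condEntropy (pathMeasure μ) totalRange (fun ω => totalRange (shift ω))) :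
    condEntropy (pathMeasure μ) (fun ω => returnMark (ω 0) (totalRange (shift ω))) totalRange =
      entropy (pathMeasure μ) (step 0) := by
  have h1 := entropy_step_eq (μ := μ) totalRange measurable_totalRange
  have h2 := condEntropy_returnMark (μ := μ) totalRange measurable_totalRange
  simp_rw [← totalRange_eq_prependStep] at h1 h2
  rw [h1, ← heq]
  exact h2

/-- The entropy of `(R_n, S_n)` increases at each step by at most the part of the entropy of the
first step that is not lost by forgetting this step and whether the walk has returned. -/
lemma entropy_rangeWalk_succ_add_le (n : ℕ) :
    entropy (pathMeasure μ) (rangeWalk (n + 1)) +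
      condEntropy (pathMeasure μ) (fun ω => returnMark (ω 0) (range n (shift ω)))
        (rangeWalk (n + 1)) ≤
    entropy (pathMeasure μ) (step 0) + entropy (pathMeasure μ) (rangeWalk n) := by
  have hs := measurePreserving_shift μ
  have hY : Measurable fun ω : ℕ → G => rangeWalk n (shift ω) :=
    (measurable_rangeWalk n).comp hs.measurable
  have hV : Measurable fun ω : ℕ → G => returnMark (ω 0) (range n (shift ω)) :=
    measurable_returnMark.comp ((measurable_pi_apply 0).prodMk (measurable_fst.comp hY))
  have hind : IndepFun (step 0) (fun ω => rangeWalk n (shift ω)) (pathMeasure μ) :=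
    (indepFun_shift μ (n := 1) (Y := step 0) fun ω ω' h => h 0 (by simp)).comp
      measurable_id (measurable_rangeWalk n)
  rw [← entropy_prod_eq_add_condEntropy (measurable_rangeWalk _) hV,
    ← entropy_comp_of_measurePreserving (measurable_rangeWalk n) hs,
    ← entropy_prod_of_indepFun (Y := step 0) (measurable_pi_apply 0) hY hind]
  refine entropy_le_of_determined ((measurable_pi_apply 0).prodMk hY)
    ((measurable_rangeWalk _).prodMk hV) fun ω ω' h => ?_
  simp only [rangeWalk, step, Prod.mk.injEq] at h
  obtain ⟨h1, h2, h3⟩ := h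
  simp only [rangeWalk, range_succ_eq_prependStep, walk_succ', h1, h2, h3]

end FirstStep

/-! ### Conditional expectations along a decreasing sequence of σ-algebras -/

section Levy

variable {Ω : Type*} {m0 : MeasurableSpace Ω} {P : Measure Ω} [IsProbabilityMeasure P]

omit [IsProbabilityMeasure P] in
lemma aestronglyMeasurable_iInf {m : ℕ → MeasurableSpace Ω} (hm : Antitone m) {f : Ω → ℝ}
    (h : ∀ n, AEStronglyMeasurable[m n] f P) : AEStronglyMeasurable[⨅ n, m n] f P := by
  set g : ℕ → Ω → ℝ := fun n => (h n).mk f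
  have hg : ∀ n, Measurable[m n] (g n) := fun n => ((h n).stronglyMeasurable_mk).measurable
  have hlim : Measurable[⨅ n, m n] fun ω => limsup (fun n => g n ω) atTop := by
    intro s hs
    refine MeasurableSpace.measurableSet_iInf.2 fun k => ?_
    have hk : (fun ω => limsup (fun n => g n ω) atTop) =
        fun ω => limsup (fun n => g (n + k) ω) atTop := by
      ext ω
      exact (limsup_nat_add (fun n => g n ω) k).symm
    rw [hk]
    exact Measurable.limsup (mδ := m k)
      (fun n => (hg (n + k)).mono (hm (Nat.le_add_left k n)) le_rfl) hs
  refine ⟨_, hlim.stronglyMeasurable, ?_⟩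
  filter_upwards [ae_all_iff.2 fun n => (h n).ae_eq_mk] with ω hω
  have : (fun n => g n ω) = fun _ => f ω := funext fun n => (hω n).symm
  rw [this, limsup_const]

lemma tendsto_starProjection_iInf {E : Type*} [NormedAddCommGroup E] [InnerProductSpace ℝ E]
    [CompleteSpace E] (K : ℕ → Submodule ℝ E) [∀ n, (K n).HasOrthogonalProjection]
    [(⨅ n, K n).HasOrthogonalProjection] (hK : Antitone K) (x : E) :
    Tendsto (fun n => (K n).starProjection x) atTop (𝓝 ((⨅ n, K n).starProjection x)) := by
  have hperp : (⨆ n, (K n)ᗮ).topologicalClosure = (⨅ n, K n)ᗮ := by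
    rw [← Submodule.orthogonal_orthogonal_eq_closure, ← Submodule.iInf_orthogonal]
    simp_rw [Submodule.orthogonal_orthogonal]
  have : (⨆ n, (K n)ᗮ).topologicalClosure.HasOrthogonalProjection := by
    rw [hperp]; infer_instance
  have h := Submodule.starProjection_tendsto_closure_iSup (fun n => (K n)ᗮ)
    (fun _ _ h => Submodule.orthogonal_le (hK h)) x
  simp_rw [hperp, Submodule.starProjection_orthogonal] at h
  have h2 := (tendsto_const_nhds (x := x)).sub h
  simpa using h2

/-- Lévy's downward theorem, in mean square. -/
theorem tendsto_eLpNorm_condExp_iInf {m : ℕ → MeasurableSpace Ω} (hm : Antitone m)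
    (hm0 : ∀ n, m n ≤ m0) {f : Ω → ℝ} (hf : MemLp f 2 P) :
    Tendsto (fun n => eLpNorm (P[f | m n] - P[f | ⨅ n, m n]) 2 P) atTop (𝓝 0) := by
  have hinf : ⨅ n, m n ≤ m0 := (iInf_le m 0).trans (hm0 0)
  have := fun n => Fact.mk (hm0 n)
  have := Fact.mk hinf
  have hK : lpMeas ℝ ℝ (⨅ n, m n) 2 P = ⨅ n, lpMeas ℝ ℝ (m n) 2 P := by
    ext F
    simp only [Submodule.mem_iInf, mem_lpMeas_iff_aestronglyMeasurable]
    exact ⟨fun h n => h.mono (iInf_le m n), aestronglyMeasurable_iInf hm⟩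
  have hinst : (⨅ n, lpMeas ℝ ℝ (m n) 2 P).HasOrthogonalProjection := by
    rw [← hK]; infer_instance
  have h := tendsto_starProjection_iInf (fun n => lpMeas ℝ ℝ (m n) 2 P)
    (fun i j hij F hF => mem_lpMeas_iff_aestronglyMeasurable.2
      ((mem_lpMeas_iff_aestronglyMeasurable.1 hF).mono (hm hij))) (hf.toLp f)
  simp_rw [← hK] at h
  rw [Lp.tendsto_Lp_iff_tendsto_eLpNorm'] at h
  refine h.congr fun n => eLpNorm_congr_ae ?_
  exact (hf.condExpL2_ae_eq_condExp (𝕜 := ℝ) (hm0 n)).sub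
    (hf.condExpL2_ae_eq_condExp (𝕜 := ℝ) hinf)

end Levy

/-! ### Conditional entropy and conditional probabilities -/

lemma negMulLog_le_one {x : ℝ} (h0 : 0 ≤ x) : Real.negMulLog x ≤ 1 := by
  rcases h0.eq_or_lt with rfl | h
  · simp
  · have h1 := mul_le_mul_of_nonneg_left (Real.one_sub_inv_le_log_of_pos h) h0
    rw [mul_sub, mul_inv_cancel₀ h.ne'] at h1
    rw [Real.negMulLog]
    linarith

section CondProb

variable {Ω : Type*} {m0 : MeasurableSpace Ω} {P : Measure Ω} [IsProbabilityMeasure P]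

/-- The expectation of `-p ln p`, where `p` is the conditional probability of `A` given `m`. -/
noncomputable def eventEntropy (P : Measure Ω) (A : Set Ω) (m : MeasurableSpace Ω) : ℝ≥0∞ :=
  ∫⁻ ω, ENNReal.ofReal (Real.negMulLog ((P⟦A | m⟧) ω)) ∂P

lemma integrable_indicator_one {A : Set Ω} (hA : MeasurableSet A) :
    Integrable (A.indicator fun _ => (1 : ℝ)) P := (integrable_const _).indicator hA

lemma condExp_indicator_mem {A : Set Ω} (hA : MeasurableSet A) {m : MeasurableSpace Ω}
    (hm : m ≤ m0) : ∀ᵐ ω ∂P, 0 ≤ (P⟦A | m⟧) ω ∧ (P⟦A | m⟧) ω ≤ 1 := by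
  have h0 : 0 ≤ᵐ[P] P⟦A | m⟧ := condExp_nonneg
    (ae_of_all _ fun ω => Set.indicator_nonneg (fun _ _ => zero_le_one) ω)
  have h1 : P⟦A | m⟧ ≤ᵐ[P] P[fun _ => (1 : ℝ) | m] := condExp_mono (integrable_indicator_one hA)
    (integrable_const 1) (ae_of_all _ (Set.indicator_le_self' fun _ _ => zero_le_one))
  rw [condExp_const hm] at h1
  filter_upwards [h0, h1] with ω h0 h1 using ⟨h0, h1⟩

/-- Passing to a larger σ-algebra decreases the entropy, by Jensen's inequality. -/
lemma eventEntropy_anti {A : Set Ω} (hA : MeasurableSet A) {m m' : MeasurableSpace Ω}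
    (hmm : m ≤ m') (hm' : m' ≤ m0) : eventEntropy P A m' ≤ eventEntropy P A m := by
  have hm := hmm.trans hm'
  set f := P⟦A | m'⟧
  have hf := condExp_indicator_mem (P := P) hA hm'
  have hg := condExp_indicator_mem (P := P) hA hm
  have hint : ∀ {h : Ω → ℝ}, AEStronglyMeasurable[m0] h P → (∀ᵐ ω ∂P, 0 ≤ h ω ∧ h ω ≤ 1) →
      Integrable (fun ω => Real.negMulLog (h ω)) P := fun hm hh =>
    Integrable.of_bound (Real.continuous_negMulLog.comp_aestronglyMeasurable hm) 1 <| by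
      filter_upwards [hh] with ω hω
      rw [Real.norm_of_nonneg (Real.negMulLog_nonneg hω.1 hω.2)]
      exact negMulLog_le_one hω.1
  have hif := hint integrable_condExp.aestronglyMeasurable hf
  have hig := hint integrable_condExp.aestronglyMeasurable hg
  have hj := Real.concaveOn_negMulLog.condExp_map_le (μ := P) (f := f) hm
    (Real.continuous_negMulLog.upperSemicontinuous.upperSemicontinuousOn _)
    (hf.mono fun ω h => h.1) isClosed_Ici integrable_condExp hif
  have ht : P[f | m] =ᵐ[P] P⟦A | m⟧ := condExp_condExp_of_le hmm hm'
  rw [eventEntropy, eventEntropy,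
    ← ofReal_integral_eq_lintegral_ofReal hif
      (hf.mono fun ω h => Real.negMulLog_nonneg h.1 h.2),
    ← ofReal_integral_eq_lintegral_ofReal hig
      (hg.mono fun ω h => Real.negMulLog_nonneg h.1 h.2)]
  refine ENNReal.ofReal_le_ofReal ?_
  rw [← integral_condExp hm (f := fun ω => Real.negMulLog (f ω))]
  refine integral_mono_ae integrable_condExp hig ?_
  filter_upwards [hj, ht] with ω h1 h2
  refine h1.trans ?_
  simp only [Function.comp_apply, h2, le_refl]

/-- The entropy of an event given a decreasing sequence of σ-algebras converges. -/
lemma tendsto_eventEntropy {m : ℕ → MeasurableSpace Ω} (hm : Antitone m) (hm0 : ∀ n, m n ≤ m0)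
    {A : ℕ → Set Ω} {B : Set Ω} (hA : ∀ n, MeasurableSet (A n)) (hB : MeasurableSet B)
    (hAB : ∀ ω, ∀ᶠ n in atTop, (ω ∈ A n ↔ ω ∈ B)) :
    Tendsto (fun n => eventEntropy P (A n) (m n)) atTop (𝓝 (eventEntropy P B (⨅ n, m n))) := by
  have hinf : ⨅ n, m n ≤ m0 := (iInf_le m 0).trans (hm0 0)
  have hind : Tendsto (fun n => eLpNorm ((A n).indicator (fun _ => (1 : ℝ)) -
      B.indicator fun _ => (1 : ℝ)) 1 P) atTop (𝓝 0) := by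
    simp_rw [eLpNorm_one_eq_lintegral_enorm]
    have h0 : (0 : ℝ≥0∞) = ∫⁻ _, 0 ∂P := by simp
    rw [h0]
    refine tendsto_lintegral_of_dominated_convergence (fun _ => 1) (fun n => ?_) (fun n => ?_)
      (by simp) (ae_of_all _ fun ω => ?_)
    · exact ((measurable_const.indicator (hA n)).sub (measurable_const.indicator hB)).enorm
    · refine ae_of_all _ fun ω => ?_
      by_cases h1 : ω ∈ A n <;> by_cases h2 : ω ∈ B <;> simp [h1, h2]
    · refine tendsto_const_nhds.congr' ?_
      filter_upwards [hAB ω] with n hn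
      by_cases h2 : ω ∈ B
      · simp [hn.2 h2, h2]
      · simp [mt hn.1 h2, h2]
  have hlevy : Tendsto (fun n => eLpNorm (P⟦B | m n⟧ - P⟦B | ⨅ n, m n⟧) 1 P) atTop (𝓝 0) := by
    refine tendsto_of_tendsto_of_tendsto_of_le_of_le tendsto_const_nhds
      (tendsto_eLpNorm_condExp_iInf hm hm0 (memLp_indicator_const 2 hB (1 : ℝ)
        (Or.inr (measure_ne_top P B)))) (fun n => zero_le) fun n => ?_
    exact eLpNorm_le_eLpNorm_of_exponent_le one_le_two
      (integrable_condExp.sub integrable_condExp).aestronglyMeasurable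
  have hconv : Tendsto (fun n => eLpNorm (P⟦A n | m n⟧ - P⟦B | ⨅ n, m n⟧) 1 P) atTop (𝓝 0) := by
    have h := hind.add hlevy
    rw [add_zero] at h
    refine tendsto_of_tendsto_of_tendsto_of_le_of_le tendsto_const_nhds h (fun n => zero_le)
      fun n => ?_
    have hadd := eLpNorm_add_le (μ := P) (p := 1) (f := P⟦A n | m n⟧ - P⟦B | m n⟧)
      (g := P⟦B | m n⟧ - P⟦B | ⨅ n, m n⟧)
      (integrable_condExp.sub integrable_condExp).aestronglyMeasurable
      (integrable_condExp.sub integrable_condExp).aestronglyMeasurable le_rfl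
    rw [sub_add_sub_cancel] at hadd
    have hle : eLpNorm (P⟦A n | m n⟧ - P⟦B | m n⟧) 1 P ≤
        eLpNorm ((A n).indicator (fun _ => (1 : ℝ)) - B.indicator fun _ => (1 : ℝ)) 1 P := by
      rw [← eLpNorm_congr_ae (condExp_sub (integrable_indicator_one (hA n))
        (integrable_indicator_one hB) (m n))]
      exact eLpNorm_condExp_le_eLpNorm _ le_rfl
    exact hadd.trans (add_le_add_left hle _)
  have hmeas := tendstoInMeasure_of_tendsto_eLpNorm one_ne_zero
    (fun n => integrable_condExp.aestronglyMeasurable) integrable_condExp.aestronglyMeasurable hconv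
  refine tendsto_of_subseq_tendsto fun ns hns => ?_
  obtain ⟨ms, -, hms⟩ := (hmeas.comp hns).exists_seq_tendsto_ae
  refine ⟨ms, tendsto_lintegral_of_dominated_convergence' (fun _ => 1) (fun n => ?_) (fun n => ?_)
    (by simp) ?_⟩
  · exact (Real.continuous_negMulLog.comp_aestronglyMeasurable
      integrable_condExp.aestronglyMeasurable).aemeasurable.ennreal_ofReal
  · filter_upwards [condExp_indicator_mem (P := P) (hA (ns (ms n))) (hm0 (ns (ms n)))] with ω hω
    exact ENNReal.ofReal_le_one.2 (negMulLog_le_one hω.1)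
  · filter_upwards [hms] with ω hω
    exact ENNReal.tendsto_ofReal ((Real.continuous_negMulLog.tendsto _).comp hω)

lemma eventEntropy_congr_of_eqMod {A : Set Ω} (hA : MeasurableSet A) {m m' : MeasurableSpace Ω}
    (hmm : m ≤ m') (hm' : m' ≤ m0)
    (h : ∀ s, MeasurableSet[m'] s → ∃ t, MeasurableSet[m] t ∧ s =ᵐ[P] t) :
    eventEntropy P A m = eventEntropy P A m' := by
  have heq : P⟦A | m⟧ =ᵐ[P] P⟦A | m'⟧ := by
    refine ae_eq_condExp_of_forall_setIntegral_eq hm' (integrable_indicator_one hA)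
      (fun s _ _ => integrable_condExp.integrableOn) (fun s hs _ => ?_)
      (stronglyMeasurable_condExp.mono hmm).aestronglyMeasurable
    obtain ⟨t, ht, hst⟩ := h s hs
    rw [setIntegral_congr_set hst, setIntegral_congr_set hst,
      setIntegral_condExp (hmm.trans hm') (integrable_indicator_one hA) ht]
  refine lintegral_congr_ae ?_
  filter_upwards [heq] with ω hω
  rw [hω]

lemma condEntropy_eq_tsum_eventEntropy {E F : Type*} [MeasurableSpace E] [StandardBorelSpace E]
    [Nonempty E] [Countable E] [MeasurableSpace F] {Y : Ω → E} {Z : Ω → F}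
    (hY : Measurable Y) (hZ : Measurable Z) :
    condEntropy P Y Z =
      ∑' v, eventEntropy P (Y ⁻¹' {v}) (MeasurableSpace.comap Z inferInstance) := by
  have h1 : ∀ z, measureEntropy (condDistrib Y Z P z) =
      ∑' v, ENNReal.ofReal (Real.negMulLog ((condDistrib Y Z P z).real {v})) := fun z =>
    if_pos (isDiscrete_of_countable _)
  have hm : ∀ v, Measurable fun z =>
      ENNReal.ofReal (Real.negMulLog ((condDistrib Y Z P z).real {v})) := fun v =>
    (Real.continuous_negMulLog.measurable.comp
      (Kernel.measurable_coe _ (measurableSet_singleton v)).ennreal_toReal).ennreal_ofReal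
  simp_rw [condEntropy, h1]
  rw [lintegral_tsum fun v => (hm v).aemeasurable]
  refine tsum_congr fun v => ?_
  rw [lintegral_map (hm v) hZ]
  refine lintegral_congr_ae ?_
  filter_upwards [condDistrib_ae_eq_condExp hZ hY (measurableSet_singleton v)] with ω hω
  rw [← hω]

end CondProb

/-! ### Asymptotic rigidity of the entropy -/

section Rigidity

variable {G : Type*} [Group G] [Countable G] [MeasurableSpace G] [DiscreteMeasurableSpace G]
  {μ : Measure G} [IsProbabilityMeasure μ]

lemma futureSigma_le (n : ℕ) : futureSigma G n ≤ MeasurableSpace.pi :=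
  iSup₂_le fun k _ => (measurable_rangeWalk k).comap_le

omit [Countable G] [DiscreteMeasurableSpace G] in
lemma futureSigma_antitone : Antitone (futureSigma G) := fun _ _ h =>
  iSup₂_le fun k hk => le_iSup₂_of_le k (h.trans hk) le_rfl

omit [Countable G] [MeasurableSpace G] [DiscreteMeasurableSpace G] in
lemma eventually_returnMark_eq (ω : ℕ → G) :
    ∀ᶠ n in atTop, returnMark (ω 0) (range n (shift ω)) =
      returnMark (ω 0) (totalRange (shift ω)) := by
  by_cases h : (ω 0)⁻¹ ∈ totalRange (shift ω)
  · filter_upwards [eventually_subset_range (Set.finite_singleton _)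
      (Set.singleton_subset_iff.2 h)] with n hn
    exact Prod.ext rfl (propext ⟨fun _ => h, fun _ => hn rfl⟩)
  · exact .of_forall fun n => Prod.ext rfl (propext
      ⟨fun hn => absurd (range_subset_totalRange n _ hn) h, fun h' => absurd h' h⟩)

/-- The conditional entropy of the first step with its return mark, given `(R_n, S_n)`, is
asymptotically at least the one given the total range, if the latter generates the tail. -/
lemma condEntropy_returnMark_le_liminf
    (h : EqMod (pathMeasure μ) (tailSigma G) (totalRangeSigma G)) :
    condEntropy (pathMeasure μ) (fun ω => returnMark (ω 0) (totalRange (shift ω))) totalRange ≤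
      liminf (fun n => condEntropy (pathMeasure μ)
        (fun ω => returnMark (ω 0) (range n (shift ω))) (rangeWalk (n + 1))) atTop := by
  set P := pathMeasure μ
  set V : (ℕ → G) → G × Prop := fun ω => returnMark (ω 0) (totalRange (shift ω))
  set W : ℕ → (ℕ → G) → G × Prop := fun n ω => returnMark (ω 0) (range n (shift ω))
  have hV : Measurable V := measurable_returnMark.comp
    ((measurable_pi_apply 0).prodMk (measurable_totalRange.comp measurable_shift))
  have hW : ∀ n, Measurable (W n) := fun n => measurable_returnMark.comp
    ((measurable_pi_apply 0).prodMk ((measurable_range n).comp measurable_shift))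
  have hinf : ⨅ n, futureSigma G (n + 1) = tailSigma G := futureSigma_antitone.iInf_nat_add 1
  have htail : tailSigma G ≤ MeasurableSpace.pi := (iInf_le _ 0).trans (futureSigma_le 0)
  have hlim : ∀ v, Tendsto (fun n => eventEntropy P (W n ⁻¹' {v}) (futureSigma G (n + 1))) atTop
      (𝓝 (eventEntropy P (V ⁻¹' {v}) (totalRangeSigma G))) := by
    intro v
    rw [eventEntropy_congr_of_eqMod (hV (measurableSet_singleton v)) totalRangeSigma_le_tailSigma
      htail h.1, ← hinf]
    refine tendsto_eventEntropy (fun i j hij => futureSigma_antitone (by omega))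
      (fun n => futureSigma_le _) (fun n => hW n (measurableSet_singleton v))
      (hV (measurableSet_singleton v)) fun ω => ?_
    filter_upwards [eventually_returnMark_eq ω] with n hn
    simp only [Set.mem_preimage, W, V, hn]
  rw [condEntropy_eq_tsum_eventEntropy hV measurable_totalRange, ENNReal.tsum_eq_iSup_sum]
  refine iSup_le fun s => ?_
  rw [← (tendsto_finsetSum s fun v _ => hlim v).liminf_eq]
  refine liminf_le_liminf (.of_forall fun n => ?_)
  rw [condEntropy_eq_tsum_eventEntropy (hW n) (measurable_rangeWalk _)]
  refine le_trans (Finset.sum_le_sum fun v _ => ?_) (ENNReal.sum_le_tsum s)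
  exact eventEntropy_anti (hW n (measurableSet_singleton v))
    (le_iSup₂_of_le (n + 1) le_rfl le_rfl) (futureSigma_le _)

/-- The increment of the entropy of `(R_n, S_n)` is at most `H(X₁)` minus the conditional entropy
of the first step with its return mark, whose limit inferior is at least `H(X₁)`. -/
theorem entropy_rate_nonpos (hfin : entropy (pathMeasure μ) (step 0) < ∞)
    (heq : condEntropy (pathMeasure μ) (fun ω => totalRange (shift ω)) totalRange =
      condEntropy (pathMeasure μ) totalRange (fun ω => totalRange (shift ω)))
    (h : EqMod (pathMeasure μ) (tailSigma G) (totalRangeSigma G)) {L : ℝ}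
    (hL : Tendsto (fun n : ℕ => (entropy (pathMeasure μ) (rangeWalk n)).toReal / n) atTop (𝓝 L)) :
    L ≤ 0 := by
  set P := pathMeasure μ
  set H := entropy P (step 0)
  set u : ℕ → ℝ := fun n => (entropy P (rangeWalk n)).toReal
  have hu := entropy_rangeWalk_ne_top hfin
  refine le_of_forall_pos_le_add fun ε hε => ?_
  rw [zero_add]
  have hinc : ∀ᶠ n in atTop, u (n + 1) ≤ u n + ε := by
    have hlim := condEntropy_returnMark_le_liminf h
    rw [condEntropy_returnMark_totalRange heq] at hlim
    rcases eq_or_ne H 0 with h0 | h0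
    · filter_upwards with n
      have h1 := le_self_add.trans (entropy_rangeWalk_succ_add_le (μ := μ) n)
      have h2 : entropy P (rangeWalk (n + 1)) ≤ entropy P (rangeWalk n) := by
        change _ ≤ H + _ at h1
        rwa [h0, zero_add] at h1
      exact (ENNReal.toReal_mono (hu n) h2).trans (by linarith)
    have hlt : H - ENNReal.ofReal ε < H :=
      ENNReal.sub_lt_self hfin.ne h0 (ENNReal.ofReal_pos.2 hε).ne'
    filter_upwards [eventually_lt_of_lt_liminf (hlt.trans_le hlim)] with n hn
    have h1 := entropy_rangeWalk_succ_add_le (μ := μ) n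
    have h2 : entropy P (rangeWalk (n + 1)) + H ≤
        entropy P (rangeWalk n) + ENNReal.ofReal ε + H := by
      have h3 : H ≤ (H - ENNReal.ofReal ε) + ENNReal.ofReal ε := le_tsub_add
      calc entropy P (rangeWalk (n + 1)) + H
          ≤ entropy P (rangeWalk (n + 1)) + ((H - ENNReal.ofReal ε) + ENNReal.ofReal ε) := by gcongr
        _ ≤ (entropy P (rangeWalk (n + 1)) + _) + ENNReal.ofReal ε := by
          rw [← add_assoc]
          exact add_le_add_left (add_le_add_right hn.le _) _
        _ ≤ (H + entropy P (rangeWalk n)) + ENNReal.ofReal ε := add_le_add_left h1 _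
        _ = _ := by ring
    have h4 := (ENNReal.add_le_add_iff_right hfin.ne).1 h2
    have h5 := ENNReal.toReal_mono (ENNReal.add_ne_top.2 ⟨hu n, ENNReal.ofReal_ne_top⟩) h4
    rwa [ENNReal.toReal_add (hu n) ENNReal.ofReal_ne_top, ENNReal.toReal_ofReal hε.le] at h5
  obtain ⟨N, hN⟩ := eventually_atTop.1 hinc
  have hlin : ∀ k : ℕ, u (N + k) ≤ u N + k * ε := by
    intro k
    induction k with
    | zero => simp
    | succ k ih =>
      have := hN (N + k) (Nat.le_add_right N k)
      push_cast
      rw [← add_assoc]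
      linarith
  have hup : Tendsto (fun n : ℕ => u N / n + ε) atTop (𝓝 (0 + ε)) :=
    (tendsto_const_div_atTop_nhds_zero_nat (u N)).add tendsto_const_nhds
  rw [zero_add] at hup
  refine le_of_tendsto_of_tendsto hL hup ?_
  filter_upwards [eventually_ge_atTop N, eventually_gt_atTop 0] with n hn hn0
  obtain ⟨k, rfl⟩ := Nat.exists_eq_add_of_le hn
  have hpos : (0 : ℝ) < (N + k : ℕ) := by exact_mod_cast hn0
  rw [div_add' _ _ _ hpos.ne']
  gcongr
  refine (hlin k).trans ?_
  push_cast
  nlinarith [Nat.cast_nonneg (α := ℝ) N]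

end Rigidity

end RangeEntropy

theorem theorem1p2 {G : Type*} [Group G] [Countable G] [MeasurableSpace G]
    [DiscreteMeasurableSpace G] (μ : Measure G) [IsProbabilityMeasure μ]
    (hgen : Subgroup.closure {g : G | μ {g} ≠ 0} = ⊤)
    (hpos : 0 < RangeEntropy.entropy (RangeEntropy.pathMeasure μ) (RangeEntropy.step 0))
    (hfin : RangeEntropy.entropy (RangeEntropy.pathMeasure μ) (RangeEntropy.step 0) < ∞) :
    -- the limit defining `h_R(μ)` exists
    Tendsto (fun n : ℕ =>
        RangeEntropy.entropy (RangeEntropy.pathMeasure μ) (RangeEntropy.range n) / (n : ℝ≥0∞))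
      atTop (𝓝 (RangeEntropy.averageRangeEntropy μ)) ∧
    List.TFAE [
      RangeEntropy.averageRangeEntropy μ = 0,
      ∃ x : G, RangeEntropy.HitAlmostSurely μ x,
      RangeEntropy.Recurrent μ ∨ RangeEntropy.EscapesWithoutLeftJump μ,
      RangeEntropy.condEntropy (RangeEntropy.pathMeasure μ)
          (fun ω => RangeEntropy.totalRange (RangeEntropy.shift ω)) RangeEntropy.totalRange =
        RangeEntropy.condEntropy (RangeEntropy.pathMeasure μ)
          RangeEntropy.totalRange (fun ω => RangeEntropy.totalRange (RangeEntropy.shift ω)) ∧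
      RangeEntropy.EqMod (RangeEntropy.pathMeasure μ)
        (RangeEntropy.tailSigma G) (RangeEntropy.totalRangeSigma G)] := by
  obtain ⟨L, -, hL, hlim⟩ := RangeEntropy.exists_tendsto_entropy hfin
  have havg : RangeEntropy.averageRangeEntropy μ = ENNReal.ofReal L := hlim.limUnder_eq
  refine ⟨havg ▸ hlim, ?_⟩
  tfae_have 1 → 2 := fun h => by
    rw [← havg, h] at hlim
    exact RangeEntropy.exists_hitAlmostSurely_of_tendsto_zero hpos hlim
  tfae_have 2 → 3 := fun ⟨x, hx⟩ => RangeEntropy.recurrent_or_escapes_of_hitAlmostSurely hgen hx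
  tfae_have 3 → 4 := fun h => ⟨RangeEntropy.condEntropy_totalRange_symm hfin hgen h,
    RangeEntropy.eqMod_tailSigma_totalRangeSigma hgen h⟩
  tfae_have 4 → 1 := fun ⟨heq, h⟩ => by
    rw [havg, ENNReal.ofReal_eq_zero]
    exact RangeEntropy.entropy_rate_nonpos hfin heq h hL
  tfae_finish
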